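/- **Model.** Fix $\rho>0$ and users $i=1,2,\dots$ with path loss coefficients $\gamma_i\ge 0$. A base station with $L$ antennas serves users $1,\dots,m$, where $L\le m$. User $i$ has channel vector $\mathbf h_i\in\mathbb C^L$ with i.i.d. $\mathcal{CN}(0,1)$ entries, and a codebook $\mathcal B_i$ of $2^{R_i}$ independent isotropic unit vectors in $\mathbb C^L$; all channel vectors and all codewords are independent. With $\mathbf v_i=\mathbf h_i/\|\mathbf h_i\|$, user $i$ feeds back the codeword $\mathbf p_i\in\mathcal B_i$ maximising $|\mathbf v_i^\dagger\mathbf p|$, $\mathbf p\in\mathcal B_i$. For a set $A_{\rm on}$ of $s$ on-users ($1\le s\le m$), the zero-forcing beam $\mathbf q_i$ of $i\in A_{\rm on}$ is the normalised orthogonal projection of $\mathbf p_i$ onto the orthogonal complement of $\operatorname{span}\{\mathbf p_j: j\in A_{\rm on}\setminus\{i\}\}$ ($\mathbf q_i=0$ if that projection vanishes). Put $$P_{{\rm sig},i}=\tfrac{\rho}{s}\gamma_i|\mathbf h_i^\dagger\mathbf q_i|^2,\qquad P_{{\rm int},i}=\tfrac{\rho}{s}\gamma_i\sum_{j\in A_{\rm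 on}\setminus\{i\}}|\mathbf h_i^\dagger\mathbf q_j|^2 .$$ Given limiting normalised feedback rates $\bar r_i$, let $$\eta_i=\frac{\rho\gamma_i(1-2^{-\bar r_i})}{1+\rho\gamma_i2^{-\bar r_i}} .$$ The on/off rule turns on $s$ users with the largest $\eta_i$, that is, $|A_{\rm on}|=s$ and $\eta_i\ge\eta_j$ whenever $i\in A_{\rm on}$, $j\notin A_{\rm on}$; if several sets qualify, one of them is chosen at random, by an arbitrary law, independently of channels and codebooks. The average throughput per antenna is $$\bar{\mathcal I}^{(L)}=\mathrm E\Big[\frac1L\sum_{i\in A_{\rm on}}\log_2\Big(1+\frac{P_{{\rm sig},i}}{1+P_{{\rm int},i}}\Big)\Big].$$ **Theorem.** Let $L,m,s\to\infty$ (along any sequence of systems) with $m/L\to\bar m$ and $s/L\to\bar s$, where $\bar m,\bar s\in\mathbb R$, and let $R_i/L\to\bar r_i$ uniformly over the users, $\max_{i\le m}|R_i/L-\bar r_i|\to0$. Assume that the empirical distributions $\mu^{(m)}_\eta=\frac1m\sum_{i\le m}\delta_{\eta_i}$ converge weakly to a probability measure $\mu_\eta$, and that $\log_2(1+\eta)$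 is asymptotically uniformly integrable under them: $$\lim_{K\to\infty}\limsup\ \frac1m\sum_{i\le m,\ \eta_i>K}\log_2(1+\eta_i)=0$$ (this is automatic if the $\gamma_i$ or the $\bar r_i$ are bounded). Then every expectation above is of an integrable random variable, and the spatial efficiency $\bar{\mathcal I}(\bar s):=\lim\bar{\mathcal I}^{(L)}$ exists and is given as follows. * If $\bar s\notin(0,1)$, then $\bar{\mathcal I}(\bar s)=0$. * If $\bar s\in(0,1)$, let $\eta_{\bar s}=\sup\{x\in\mathbb R:\ \bar m\int_{x}^{\infty}d\mu_\eta>\bar s\}$. This is the supremum of a non-empty set bounded above, the function $\eta\mapsto\log_2\big(1+\eta\frac{1-\bar s}{\bar s}\big)$ is $\mu_\eta$-integrable on $(\eta_{\bar s},\infty)$, and $$\bar{\mathcal I}(\bar s)=\bar m\int_{\eta_{\bar s}^+}^\infty\log_2\Big(1+\eta\frac{1-\bar s}{\bar s}\Big)d\mu_\eta+\Big(\bar s-\bar m\int_{\eta_{\bar s}^+}^\infty d\mu_\eta\Big)\log_2\Big(1+\eta_{\bar s}\frac{1-\bar s}{\bar s}\Big).$$ Here $\int_x^\infty$ is taken over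 $[x,\infty)$, and $\int_{x^+}^\infty=\lim_{\delta\downarrow0}\int_{x+\delta}^\infty$, i.e. the integral over the open half-line $(x,\infty)$. -/

import Mathlib

open MeasureTheory ProbabilityTheory Filter Topology

noncomputable section

namespace ZFBroadcast

/-- Complex column vectors with `L` entries, with the Euclidean norm. -/
abbrev CVec (L : ℕ) : Type := EuclideanSpace ℂ (Fin L)

/-- The law `CN(0,1)`: real and imaginary part are independent centred Gaussians of
variance `1/2`. -/
def complexGaussian : Measure ℂ :=
  ((gaussianReal 0 (1 / 2)).prod (gaussianReal 0 (1 / 2))).map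
    Complex.measurableEquivRealProd.symm

instance : IsProbabilityMeasure complexGaussian :=
  Measure.isProbabilityMeasure_map Complex.measurableEquivRealProd.symm.measurable.aemeasurable

/-- The law of a channel vector (Rayleigh fading): i.i.d. `CN(0,1)` entries. -/
def channelLaw (L : ℕ) : Measure (CVec L) :=
  (Measure.pi fun _ : Fin L => complexGaussian).map (MeasurableEquiv.toLp 2 (Fin L → ℂ))

instance (L : ℕ) : IsProbabilityMeasure (channelLaw L) :=
  Measure.isProbabilityMeasure_map (MeasurableEquiv.toLp 2 (Fin L → ℂ)).measurable.aemeasurable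

/-- The direction `h / ‖h‖` of a vector. -/
def direction {L : ℕ} (h : CVec L) : CVec L := ((‖h‖⁻¹ : ℝ) : ℂ) • h

lemma measurable_direction {L : ℕ} : Measurable (direction (L := L)) := by
  unfold direction
  fun_prop

/-- The isotropic law on the unit sphere of `ℂ^L`, realised as the law of the direction of a
vector with i.i.d. `CN(0,1)` entries. -/
def isotropicLaw (L : ℕ) : Measure (CVec L) := (channelLaw L).map direction

instance (L : ℕ) : IsProbabilityMeasure (isotropicLaw L) :=
  Measure.isProbabilityMeasure_map measurable_direction.aemeasurable

/-- One realisation of the randomness: the channel vectors of the `m` users, and for user `i` a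
codebook with `2 ^ R i` codewords. -/
abbrev Sample (L m : ℕ) (R : ℕ → ℕ) : Type :=
  (Fin m → CVec L) × ((i : Fin m) → Fin (2 ^ R i) → CVec L)

/-- The joint law: all channel vectors and all codewords are independent, the channel vectors
are Rayleigh fading, the codewords are isotropic. -/
def sampleLaw (L m : ℕ) (R : ℕ → ℕ) : Measure (Sample L m R) :=
  (Measure.pi fun _ : Fin m => channelLaw L).prod
    (Measure.pi fun i : Fin m => Measure.pi fun _ : Fin (2 ^ R i) => isotropicLaw L)

/-- The indices of the codewords `p` that maximise `|v† p|`. -/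
def bestCodewords {L N : ℕ} (c : Fin N → CVec L) (v : CVec L) : Finset (Fin N) :=
  open Classical in
  Finset.univ.filter fun k => ∀ l, ‖inner ℂ v (c l)‖ ≤ ‖inner ℂ v (c k)‖

lemma bestCodewords_nonempty {L r : ℕ} (c : Fin (2 ^ r) → CVec L) (v : CVec L) :
    (bestCodewords c v).Nonempty := by
  obtain ⟨k, -, hk⟩ := Finset.exists_max_image Finset.univ
    (fun k : Fin (2 ^ r) => ‖inner ℂ v (c k)‖) ⟨⟨0, by positivity⟩, Finset.mem_univ _⟩
  exact ⟨k, by simpa [bestCodewords] using hk⟩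

/-- The quantised channel: the codeword `p` that maximises `|v† p|`, where `v` is the
direction of `h` (the one of smallest index in case of a tie, an event of probability zero
unless `L ≤ 1`, where all codewords span the same line). -/
def quantize {L r : ℕ} (c : Fin (2 ^ r) → CVec L) (h : CVec L) : CVec L :=
  c ((bestCodewords c (direction h)).min' (bestCodewords_nonempty c (direction h)))

/-- The zero-forcing beamforming vector of user `i` for the set `A` of on-users and the
quantised channels `p`: the normalised orthogonal projection of `p i` on the orthogonal
complement of the span of the other `p j`, `j ∈ A` (and `0` if this projection vanishes). -/
def zfBeam {L m : ℕ} (A : Finset (Fin m)) (p : Fin m → CVec L) (i : Fin m) : CVec L :=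
  direction ((Submodule.span ℂ (p '' (A.erase i : Set (Fin m))))ᗮ.starProjection (p i))

/-- All quantised channels of a realisation. -/
def quantizedChannels {L m : ℕ} {R : ℕ → ℕ} (ω : Sample L m R) (i : Fin m) : CVec L :=
  quantize (ω.2 i) (ω.1 i)

/-- Signal power of user `i`, each on-user being allotted the power `ρ / s`. -/
def signalPower {L m : ℕ} {R : ℕ → ℕ} (ρ : ℝ) (γ : ℕ → ℝ) (s : ℕ) (A : Finset (Fin m))
    (ω : Sample L m R) (i : Fin m) : ℝ :=
  ρ / s * γ i * ‖inner ℂ (ω.1 i) (zfBeam A (quantizedChannels ω) i)‖ ^ 2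

/-- Interference power at user `i`. -/
def interferencePower {L m : ℕ} {R : ℕ → ℕ} (ρ : ℝ) (γ : ℕ → ℝ) (s : ℕ) (A : Finset (Fin m))
    (ω : Sample L m R) (i : Fin m) : ℝ :=
  ρ / s * γ i *
    ∑ j ∈ A.erase i, ‖inner ℂ (ω.1 i) (zfBeam A (quantizedChannels ω) j)‖ ^ 2

/-- Throughput per antenna, in bits, of a realisation when the users in `A` are on. -/
def throughput {L m : ℕ} {R : ℕ → ℕ} (ρ : ℝ) (γ : ℕ → ℝ) (s : ℕ) (A : Finset (Fin m))
    (ω : Sample L m R) : ℝ :=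
  1 / (L : ℝ) * ∑ i ∈ A,
    Real.logb 2 (1 + signalPower ρ γ s A ω i / (1 + interferencePower ρ γ s A ω i))

/-- The figure of merit `η` of a user with path loss coefficient `g` and normalised feedback
rate `r`. -/
def eta (ρ g r : ℝ) : ℝ :=
  ρ * g * (1 - (2 : ℝ) ^ (-r)) / (1 + ρ * g * (2 : ℝ) ^ (-r))

/-- `A` is an admissible set of `s` on-users: it consists of `s` users with the largest `η`. -/
def IsOnSet {m : ℕ} (η : ℕ → ℝ) (s : ℕ) (A : Finset (Fin m)) : Prop :=
  A.card = s ∧ ∀ i ∈ A, ∀ j ∉ A, η j ≤ η i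

/-- The average throughput per antenna; the set of on-users is drawn from the law `κ`,
independently of the channels and the codebooks. -/
def avgThroughput (L m : ℕ) (R : ℕ → ℕ) (ρ : ℝ) (γ : ℕ → ℝ) (s : ℕ)
    (κ : PMF (Finset (Fin m))) : ℝ :=
  ∑ A, (κ A).toReal * ∫ ω, throughput ρ γ s A ω ∂(sampleLaw L m R)

/-- The empirical distribution of `η 0, …, η (m - 1)`. -/
def empiricalLaw (η : ℕ → ℝ) (m : ℕ) : FiniteMeasure ℝ :=
  (m : NNReal)⁻¹ • ∑ i ∈ Finset.range m, (diracProba (η i)).toFiniteMeasure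

/-- `∫_{x⁺}^∞ f dμ`, see `tendsto_integralAbove`. -/
def integralAbove (μ : Measure ℝ) (x : ℝ) (f : ℝ → ℝ) : ℝ := ∫ t in Set.Ioi x, f t ∂μ

/-- `∫_{x⁺}^∞ f dμ` is the limit of `∫_{[x + δ, ∞)} f dμ` as `δ ↓ 0`. -/
lemma tendsto_integralAbove (μ : Measure ℝ) (x : ℝ) (f : ℝ → ℝ)
    (hf : IntegrableOn f (Set.Ioi x) μ) :
    Tendsto (fun δ : ℝ => ∫ t in Set.Ici (x + δ), f t ∂μ) (𝓝[>] 0)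
      (𝓝 (integralAbove μ x f)) := by
  have h1 : ∀ δ : ℝ, 0 < δ → ∫ t in Set.Ici (x + δ), f t ∂μ =
      ∫ t in Set.Ioi x, (Set.Ici (x + δ)).indicator f t ∂μ := by
    intro δ hδ
    rw [integral_indicator measurableSet_Ici, Measure.restrict_restrict measurableSet_Ici,
      Set.inter_eq_left.mpr]
    intro t ht
    simp only [Set.mem_Ici, Set.mem_Ioi] at *
    linarith
  refine Tendsto.congr' (f₁ := fun δ : ℝ =>
    ∫ t in Set.Ioi x, (Set.Ici (x + δ)).indicator f t ∂μ) ?_ ?_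
  · filter_upwards [self_mem_nhdsWithin] with δ hδ using (h1 δ hδ).symm
  · refine tendsto_integral_filter_of_dominated_convergence (fun t => ‖f t‖) ?_ ?_ hf.norm ?_
    · exact Eventually.of_forall fun δ =>
        hf.aestronglyMeasurable.indicator measurableSet_Ici
    · exact Eventually.of_forall fun δ => Eventually.of_forall fun t =>
        norm_indicator_le_norm_self f t
    · filter_upwards [ae_restrict_mem measurableSet_Ioi] with t ht
      refine tendsto_const_nhds.congr' ?_
      have hpos : (0 : ℝ) < t - x := sub_pos.mpr ht
      filter_upwards [nhdsWithin_le_nhds (Iio_mem_nhds hpos)] with δ hδ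
      rw [Set.indicator_of_mem]
      simp only [Set.mem_Iio, Set.mem_Ici] at *
      linarith

/-- The levels `x` with `mbar * μ [x, ∞) > sbar`. -/
def levelSet (μ : Measure ℝ) (mbar sbar : ℝ) : Set ℝ :=
  {x | mbar * ∫ _ in Set.Ici x, (1 : ℝ) ∂μ > sbar}

/-- The threshold `η_s̄`, the supremum of the levels. -/
def etaThreshold (μ : Measure ℝ) (mbar sbar : ℝ) : ℝ := sSup (levelSet μ mbar sbar)

/-- The asymptotic rate of an on-user with figure of merit `x`. -/
def limitRate (sbar x : ℝ) : ℝ := Real.logb 2 (1 + x * ((1 - sbar) / sbar))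

end ZFBroadcast

end

/-!
# The spatial efficiency of zero-forcing with quantised channel directions

Fix an on-user `i`, its channel `h = ‖h‖ v` and the codeword `p` it reports. All other quantised
channels are independent of these data, isotropic and in general position (`lintegral_sampleLaw`,
`isIsotropic_quantizedLaw`, `ae_finrank_span`). The beams of the other on-users are orthogonal to
`p`, so they interfere only through the quantisation error `e = v - ⟨p, v⟩ p`
(`norm_inner_zfBeam_eq_quantizationError`), whose squared length is the distortion `1 - |v† p|²`.
An isotropic vector falls in the spherical cap of squared radius `t` with probability `t ^ (L - 1)`,
and there are `2 ^ R_i` codewords, so the distortion concentrates at `2 ^ (-rbar_i)`, uniformly over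
the users (`distortion_concentration`).

Given `p`, the joint law of the beams is invariant under the rotations that fix `p`
(`rotationInvariant_zfBeam`). Hence an expectation that involves `e` depends on the length of `e`
only, and can be found by averaging `e` over a Gaussian vector (`lintegral_mul_eq_of_invariant`):
this turns moments of correlations between dependent beams into moments of complex Gaussian
variables. The outcome is that `∑ |q_j† e|²` is close to `‖e‖² (s - 1) / (L - 1)`
(`lintegral_interference_sub_sq_le`) and that the energy of `p` in the interference-free space is
close to `(L - s + 1) / L` (`lintegral_starProjection_sub_sq_le`). So for `s / L → σ ∈ (0, 1)`, with
`D = 2 ^ (-rbar_i)`, the ratio `P_sig / (1 + P_int)` is close to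
`(ρ γ_i / σ) (1 - D) (1 - σ) / (1 + ρ γ_i D) = η_i (1 - σ) / σ`,
uniformly over the users with bounded `η_i`.

Convergence in mean needs a moment bound that is uniform in the unbounded path gains. The ratio `X`
satisfies `E X ^ (1/4) ≤ C ((L - s + 1) / s) ^ (1/4) (1 + η_i)` (`lintegral_sinr_rpow_le`): for large
`γ_i` it is controlled by inverse moments of the interference and of the distortion. This has three
uses. It upgrades convergence in probability to convergence of the mean rates
(`exists_lintegral_rate_sub_le`). By Jensen's inequality it bounds a mean rate by a multiple of
`log₂ (1 + η_i)` plus `log₂ (L / s)` and a constant (`meanRate_le_logb`), so that uniform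
integrability disposes of the users with large `η_i`. Finally it settles the boundary regimes
(`eventually_sum_meanRate_le`): for `s / L → 0` because `(s / L) log₂ (L / s) → 0`, for `s / L → 1`
because the factor `(L - s + 1) / s` vanishes; and for `s > L` all beams are zero.

It remains to find the limit of the average of the limiting rates over the `s` best users
(`eventually_abs_sum_sub_le`). Averages over all users converge by weak convergence and uniform
integrability (`tendsto_average`). A sum `∑ F(η_i)` over the `s` best users, with `F` increasing, is
at most `s F(x₀) + ∑ (F(η_i) - F(x₀))⁺`, the last sum being over all users, and at least
`∑ w(η_i) F(η_i)` for every weight `w` with values in `[0, 1]` and total mass at most `s`. With `x₀`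
the threshold `η_{sbar}`, and `w` close to the weight that is `1` above `x₀`, `0` below, and on the
atom at `x₀` the constant that makes the masses match, both bounds tend to the asserted formula.
-/

noncomputable section

namespace ZFBroadcast

/-! ### Complex Gaussian vectors -/

lemma real_inner_eq_re_inner {L : ℕ} (x y : CVec L) : inner ℝ x y = (inner ℂ x y).re := by
  simp only [PiLp.inner_apply, Complex.re_sum]
  rfl

lemma charFun_complexGaussian (t : ℂ) :
    charFun complexGaussian t = Complex.exp (-(‖t‖ ^ 2 : ℝ) / 4) := by
  have h1 : ∀ x : ℝ × ℝ, Complex.exp (((inner ℝ (Complex.measurableEquivRealProd.symm x) t : ℝ) : ℂ)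
      * Complex.I) = Complex.exp (((inner ℝ x.1 t.re : ℝ) : ℂ) * Complex.I) *
        Complex.exp (((inner ℝ x.2 t.im : ℝ) : ℂ) * Complex.I) := by
    intro x
    rw [← Complex.exp_add, ← add_mul]
    congr 2
    norm_cast
    simp [Complex.inner, Complex.measurableEquivRealProd_symm_apply]
  rw [charFun_apply, complexGaussian, integral_map_equiv]
  simp_rw [h1]
  rw [integral_prod_mul (fun x : ℝ => Complex.exp (((inner ℝ x t.re : ℝ) : ℂ) * Complex.I))
    (fun x : ℝ => Complex.exp (((inner ℝ x t.im : ℝ) : ℂ) * Complex.I))]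
  rw [← charFun_apply, ← charFun_apply, charFun_gaussianReal, charFun_gaussianReal,
    ← Complex.exp_add]
  congr 1
  rw [← Complex.normSq_eq_norm_sq, Complex.normSq_apply]
  push_cast
  ring

lemma charFun_channelLaw {L : ℕ} (t : CVec L) :
    charFun (channelLaw L) t = Complex.exp (-(‖t‖ ^ 2 : ℝ) / 4) := by
  rw [channelLaw, MeasurableEquiv.coe_toLp, charFun_pi]
  simp_rw [charFun_complexGaussian]
  rw [← Complex.exp_sum, EuclideanSpace.norm_sq_eq]
  congr 1
  push_cast
  rw [← Finset.sum_neg_distrib, Finset.sum_div]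

/-- Rayleigh fading is unitarily invariant. -/
lemma map_channelLaw {L : ℕ} (U : CVec L ≃ₗᵢ[ℂ] CVec L) :
    (channelLaw L).map U = channelLaw L := by
  have hU : Measurable U := U.continuous.measurable
  have : IsProbabilityMeasure ((channelLaw L).map U) :=
    Measure.isProbabilityMeasure_map hU.aemeasurable
  apply Measure.ext_of_charFun
  ext t
  rw [charFun_apply, integral_map hU.aemeasurable (by fun_prop)]
  have : ∀ x, inner ℝ (U x) t = inner ℝ x (U.symm t) := by
    intro x
    rw [real_inner_eq_re_inner, real_inner_eq_re_inner, ← U.inner_map_map x, U.apply_symm_apply]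
  simp_rw [this]
  rw [← charFun_apply, charFun_channelLaw, charFun_channelLaw, U.symm.norm_map]

/-- The coordinate of a Rayleigh fading vector along a unit vector is `CN(0,1)`. -/
lemma map_inner_channelLaw {L : ℕ} {w : CVec L} (hw : ‖w‖ = 1) :
    (channelLaw L).map (fun g => inner ℂ w g) = complexGaussian := by
  have hU : Measurable (fun g : CVec L => inner ℂ w g) := by fun_prop
  have : IsProbabilityMeasure ((channelLaw L).map (fun g => inner ℂ w g)) :=
    Measure.isProbabilityMeasure_map hU.aemeasurable
  apply Measure.ext_of_charFun
  ext t
  rw [charFun_apply, integral_map hU.aemeasurable (by fun_prop)]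
  have : ∀ x, inner ℝ (inner ℂ w x) t = inner ℝ x (t • w) := by
    intro x
    rw [real_inner_eq_re_inner, inner_smul_right, ← inner_conj_symm x w, Complex.inner, mul_comm]
  simp_rw [this]
  rw [← charFun_apply, charFun_channelLaw, charFun_complexGaussian, norm_smul, hw, mul_one]

/-- The squared modulus of a `CN(0,1)` variable is exponentially distributed. -/
lemma lintegral_complexGaussian_normSq (f : ℝ → ENNReal) (hf : Measurable f) :
    ∫⁻ z, f (‖z‖ ^ 2) ∂complexGaussian =
      ∫⁻ x in Set.Ioi (0 : ℝ), f x * ENNReal.ofReal (Real.exp (-x)) := by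
  have hpdf : Measurable (gaussianPDF 0 (1 / 2)) := measurable_gaussianPDF 0 (1 / 2)
  have hden : ∀ p : ℝ × ℝ, gaussianPDF 0 (1 / 2) p.1 * gaussianPDF 0 (1 / 2) p.2 =
      ENNReal.ofReal (Real.pi⁻¹ * Real.exp (-(p.1 ^ 2 + p.2 ^ 2))) := by
    intro p
    rw [gaussianPDF, gaussianPDF, ← ENNReal.ofReal_mul (gaussianPDFReal_nonneg _ _ _)]
    congr 1
    simp only [gaussianPDFReal]
    have h1 : (2 * Real.pi * ((1 / 2 : NNReal) : ℝ)) = Real.pi := by push_cast; ring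
    have h2 : (2 * ((1 / 2 : NNReal) : ℝ)) = 1 := by push_cast; ring
    rw [h1, h2, mul_mul_mul_comm, ← Real.exp_add, ← mul_inv, Real.mul_self_sqrt Real.pi_pos.le]
    congr 2
    ring
  rw [complexGaussian, lintegral_map_equiv]
  rw [gaussianReal_of_var_ne_zero _ (by norm_num), prod_withDensity hpdf hpdf,
    lintegral_withDensity_eq_lintegral_mul _ (by fun_prop) (by
      exact hf.comp ((measurable_norm.comp
        Complex.measurableEquivRealProd.symm.measurable).pow_const 2))]
  simp only [Pi.mul_apply]
  simp_rw [hden]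
  rw [← Measure.volume_eq_prod, ← lintegral_comp_polarCoord_symm]
  have key : ∀ p ∈ polarCoord.target, ENNReal.ofReal p.1 •
      (ENNReal.ofReal (Real.pi⁻¹ * Real.exp (-((polarCoord.symm p).1 ^ 2 +
        (polarCoord.symm p).2 ^ 2))) *
        f (‖Complex.measurableEquivRealProd.symm (polarCoord.symm p)‖ ^ 2)) =
      ENNReal.ofReal (Real.pi⁻¹) *
        (ENNReal.ofReal p.1 * (f (p.1 ^ 2) * ENNReal.ofReal (Real.exp (-(p.1 ^ 2))))) := by
    rintro ⟨r, θ⟩ hp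
    have h3 : (r * Real.cos θ) ^ 2 + (r * Real.sin θ) ^ 2 = r ^ 2 := by
      nlinarith [Real.sin_sq_add_cos_sq θ]
    have h4 : ‖Complex.measurableEquivRealProd.symm (polarCoord.symm (r, θ))‖ ^ 2 = r ^ 2 := by
      rw [← Complex.normSq_eq_norm_sq, Complex.normSq_apply]
      simp only [Complex.measurableEquivRealProd_symm_apply, polarCoord_symm_apply]
      nlinarith [Real.sin_sq_add_cos_sq θ]
    rw [h4]
    simp only [polarCoord_symm_apply, h3, smul_eq_mul]
    rw [ENNReal.ofReal_mul (by positivity)]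
    ring
  rw [setLIntegral_congr_fun polarCoord.open_target.measurableSet key]
  have htar : polarCoord.target = Set.Ioi (0 : ℝ) ×ˢ Set.Ioo (-Real.pi) Real.pi := rfl
  rw [htar, Measure.volume_eq_prod, ← Measure.prod_restrict, lintegral_const_mul _ (by fun_prop),
    lintegral_prod _ (by fun_prop)]
  simp only [lintegral_const, Measure.restrict_apply MeasurableSet.univ, Set.univ_inter,
    Real.volume_Ioo]
  rw [lintegral_mul_const _ (by fun_prop)]
  have himg : (fun x : ℝ => x ^ 2) '' Set.Ioi (0 : ℝ) = Set.Ioi 0 := by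
    ext y
    constructor
    · rintro ⟨x, hx, rfl⟩
      have : (0 : ℝ) < x := hx
      exact Set.mem_Ioi.2 (by positivity)
    · intro hy
      exact ⟨√y, Real.sqrt_pos.2 hy, Real.sq_sqrt (le_of_lt hy)⟩
  have hsub := lintegral_image_eq_lintegral_abs_deriv_mul (s := Set.Ioi (0 : ℝ))
    (f := fun x => x ^ 2) (f' := fun x => 2 * x) measurableSet_Ioi
    (fun x _ => by simpa using (hasDerivAt_pow 2 x).hasDerivWithinAt)
    (fun x hx y hy h => by
      have hx' : (0 : ℝ) < x := hx
      have hy' : (0 : ℝ) < y := hy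
      exact (pow_left_inj₀ hx'.le hy'.le two_ne_zero).1 h)
    (fun x => f x * ENNReal.ofReal (Real.exp (-x)))
  rw [himg] at hsub
  rw [hsub]
  have h5 : ∀ x ∈ Set.Ioi (0 : ℝ), ENNReal.ofReal |2 * x| *
      (f (x ^ 2) * ENNReal.ofReal (Real.exp (-x ^ 2))) =
      ENNReal.ofReal 2 * (ENNReal.ofReal x * (f (x ^ 2) * ENNReal.ofReal (Real.exp (-(x ^ 2))))) := by
    intro x hx
    have hx' : (0 : ℝ) < x := hx
    rw [abs_of_pos (by positivity), ENNReal.ofReal_mul (by norm_num)]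
    ring
  rw [setLIntegral_congr_fun measurableSet_Ioi h5, lintegral_const_mul _ (by fun_prop)]
  rw [mul_comm, mul_assoc, ← ENNReal.ofReal_mul (by linarith [Real.pi_pos]), mul_comm]
  congr 2
  field_simp
  ring

/-- The moments of the modulus of a `CN(0,1)` variable are values of the Gamma function. -/
lemma lintegral_complexGaussian_rpow {q : ℝ} (hq : -1 < q) :
    ∫⁻ z, ENNReal.ofReal ((‖z‖ ^ 2) ^ q) ∂complexGaussian = ENNReal.ofReal (Real.Gamma (q + 1)) := by
  rw [lintegral_complexGaussian_normSq (fun x => ENNReal.ofReal (x ^ q)) (by fun_prop)]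
  have hint : IntegrableOn (fun x : ℝ => Real.exp (-x) * x ^ (q + 1 - 1)) (Set.Ioi 0) :=
    Real.GammaIntegral_convergent (by linarith)
  rw [Real.Gamma_eq_integral (by linarith), ofReal_integral_eq_lintegral_ofReal hint]
  · refine setLIntegral_congr_fun measurableSet_Ioi fun x hx => ?_
    have hx' : (0 : ℝ) < x := hx
    rw [← ENNReal.ofReal_mul (by positivity), mul_comm, add_sub_cancel_right]
  · filter_upwards [ae_restrict_mem measurableSet_Ioi] with x hx
    have hx' : (0 : ℝ) < x := hx
    positivity

lemma lintegral_complexGaussian_sq :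
    ∫⁻ z, ENNReal.ofReal (‖z‖ ^ 2) ∂complexGaussian = 1 := by
  have := lintegral_complexGaussian_rpow (q := 1) (by norm_num)
  simp only [Real.rpow_one] at this
  rw [this]
  norm_num [Real.Gamma_two]

lemma lintegral_complexGaussian_pow_four :
    ∫⁻ z, ENNReal.ofReal (‖z‖ ^ 4) ∂complexGaussian = 2 := by
  have := lintegral_complexGaussian_rpow (q := 2) (by norm_num)
  have h2 : Real.Gamma (2 + 1) = 2 := by
    rw [Real.Gamma_add_one two_ne_zero, Real.Gamma_two, mul_one]
  rw [h2] at this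
  simp only [Real.rpow_two, ← pow_mul] at this
  simpa using this

lemma lintegral_complexGaussian_inv :
    ∫⁻ z, ENNReal.ofReal ‖z‖⁻¹ ∂complexGaussian = ENNReal.ofReal (√Real.pi) := by
  have := lintegral_complexGaussian_rpow (q := -(1 / 2)) (by norm_num)
  have h2 : (-(1 / 2) + 1 : ℝ) = 1 / 2 := by norm_num
  rw [h2, Real.Gamma_one_half_eq] at this
  rw [← this]
  refine lintegral_congr fun z => ?_
  rw [Real.rpow_neg (by positivity), ← Real.sqrt_eq_rpow, Real.sqrt_sq (norm_nonneg _)]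

lemma complexGaussian_zero : complexGaussian {0} = 0 := by
  have h := lintegral_complexGaussian_normSq (Set.indicator {0} 1)
    (measurable_one.indicator (measurableSet_singleton 0))
  have h1 : ∀ z : ℂ, Set.indicator {(0 : ℝ)} (1 : ℝ → ENNReal) (‖z‖ ^ 2) =
      Set.indicator {(0 : ℂ)} 1 z := by
    intro z
    by_cases hz : z = 0 <;> simp [hz]
  simp_rw [h1] at h
  rw [lintegral_indicator_one (measurableSet_singleton 0)] at h
  rw [h, lintegral_eq_zero_iff' (by
    exact (Measurable.mul (measurable_one.indicator (measurableSet_singleton 0))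
      (by fun_prop)).aemeasurable)]
  filter_upwards [ae_restrict_mem measurableSet_Ioi] with x hx
  have hx' : x ≠ 0 := (show (0 : ℝ) < x from hx).ne'
  simp [hx']

/-- The exponential tail of the squared modulus of a `CN(0,1)` variable. -/
lemma complexGaussian_tail {t : ℝ} (ht : 0 ≤ t) :
    complexGaussian {z | t ≤ ‖z‖ ^ 2} = ENNReal.ofReal (Real.exp (-t)) := by
  have h := lintegral_complexGaussian_normSq (Set.indicator (Set.Ici t) 1)
    (measurable_one.indicator measurableSet_Ici)
  have h1 : ∀ z : ℂ, Set.indicator (Set.Ici t) (1 : ℝ → ENNReal) (‖z‖ ^ 2) =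
      Set.indicator {z : ℂ | t ≤ ‖z‖ ^ 2} 1 z := by
    intro z
    by_cases hz : t ≤ ‖z‖ ^ 2 <;> simp [hz]
  have hm : MeasurableSet {z : ℂ | t ≤ ‖z‖ ^ 2} :=
    measurableSet_le measurable_const (by fun_prop)
  simp_rw [h1] at h
  rw [lintegral_indicator_one hm] at h
  rw [h]
  have h2 : ∀ x : ℝ, Set.indicator (Set.Ici t) (1 : ℝ → ENNReal) x * ENNReal.ofReal (Real.exp (-x))
      = Set.indicator (Set.Ici t) (fun x => ENNReal.ofReal (Real.exp (-x))) x := by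
    intro x
    by_cases hx : t ≤ x <;> simp [hx]
  simp_rw [h2]
  rw [lintegral_indicator measurableSet_Ici, Measure.restrict_restrict measurableSet_Ici,
    setLIntegral_congr (t := Set.Ioi t)]
  · rw [← ofReal_integral_eq_lintegral_ofReal (integrableOn_exp_neg_Ioi t), integral_exp_neg_Ioi]
    exact Eventually.of_forall fun x => (Real.exp_pos _).le
  · have h3 : Set.Ioi t ≤ᵐ[volume] (Set.Ici t ∩ Set.Ioi 0 : Set ℝ) := by
      refine Eventually.of_forall fun x hx => ⟨le_of_lt hx, lt_of_le_of_lt ht hx⟩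
    have h4 : (Set.Ici t ∩ Set.Ioi 0 : Set ℝ) ≤ᵐ[volume] Set.Ioi t :=
      (LE.le.eventuallyLE Set.inter_subset_left).trans Ioi_ae_eq_Ici.symm.le
    exact h4.antisymm h3

lemma lintegral_complexGaussian_exp {a : ℝ} (ha : 0 ≤ a) :
    ∫⁻ z, ENNReal.ofReal (Real.exp (-(a * ‖z‖ ^ 2))) ∂complexGaussian =
      ENNReal.ofReal (1 + a)⁻¹ := by
  rw [lintegral_complexGaussian_normSq (fun x => ENNReal.ofReal (Real.exp (-(a * x))))
    (by fun_prop)]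
  have h1 : ∀ x : ℝ, ENNReal.ofReal (Real.exp (-(a * x))) * ENNReal.ofReal (Real.exp (-x)) =
      ENNReal.ofReal (Real.exp (-(1 + a) * x)) := by
    intro x
    rw [← ENNReal.ofReal_mul (Real.exp_pos _).le, ← Real.exp_add]
    congr 2
    ring
  simp_rw [h1]
  rw [← ofReal_integral_eq_lintegral_ofReal, integral_exp_mul_Ioi (by linarith)]
  · congr 1
    have h2 : -(1 + a) ≠ 0 := by linarith
    have h3 : 1 + a ≠ 0 := by linarith
    rw [mul_zero, Real.exp_zero]
    field_simp
  · exact integrableOn_exp_mul_Ioi (by linarith) 0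
  · exact Eventually.of_forall fun x => (Real.exp_pos _).le

lemma lintegral_channelLaw_inner {L : ℕ} {w : CVec L} (hw : ‖w‖ = 1) (f : ℂ → ENNReal)
    (hf : Measurable f) :
    ∫⁻ g, f (inner ℂ w g) ∂channelLaw L = ∫⁻ z, f z ∂complexGaussian := by
  rw [← map_inner_channelLaw hw, lintegral_map hf (by fun_prop)]

lemma lintegral_channelLaw_inner_pow {L : ℕ} (w : CVec L) {k : ℕ} (hk : k ≠ 0) :
    ∫⁻ g, ENNReal.ofReal (‖inner ℂ w g‖ ^ k) ∂channelLaw L =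
      ENNReal.ofReal (‖w‖ ^ k) * ∫⁻ z, ENNReal.ofReal (‖z‖ ^ k) ∂complexGaussian := by
  by_cases hw : w = 0
  · simp [hw, hk]
  have hn : ‖w‖ ≠ 0 := norm_ne_zero_iff.2 hw
  have hu : ‖((‖w‖⁻¹ : ℝ) : ℂ) • w‖ = 1 := by
    rw [norm_smul, Complex.norm_real, norm_inv, norm_norm, inv_mul_cancel₀ hn]
  rw [← lintegral_channelLaw_inner hu _ (by fun_prop),
    ← lintegral_const_mul _ (by fun_prop)]
  refine lintegral_congr fun g => ?_
  rw [← ENNReal.ofReal_mul (by positivity), inner_smul_left, norm_mul, RCLike.norm_conj,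
    Complex.norm_real, norm_inv, norm_norm, mul_pow, ← mul_assoc, ← mul_pow, mul_inv_cancel₀ hn,
    one_pow, one_mul]

lemma lintegral_channelLaw_inner_sq {L : ℕ} (w : CVec L) :
    ∫⁻ g, ENNReal.ofReal (‖inner ℂ w g‖ ^ 2) ∂channelLaw L = ENNReal.ofReal (‖w‖ ^ 2) := by
  rw [lintegral_channelLaw_inner_pow w two_ne_zero, lintegral_complexGaussian_sq, mul_one]

lemma lintegral_channelLaw_inner_pow_four {L : ℕ} (w : CVec L) :
    ∫⁻ g, ENNReal.ofReal (‖inner ℂ w g‖ ^ 4) ∂channelLaw L = ENNReal.ofReal (2 * ‖w‖ ^ 4) := by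
  rw [lintegral_channelLaw_inner_pow w four_ne_zero, lintegral_complexGaussian_pow_four,
    mul_comm, ENNReal.ofReal_mul zero_le_two]
  simp

/-- Wick's formula for the squared moduli of two coordinates, obtained by polarisation from the
fourth moment of a single coordinate. -/
lemma lintegral_channelLaw_inner_sq_mul {L : ℕ} {w z : CVec L} (hw : ‖w‖ = 1) (hz : ‖z‖ = 1) :
    ∫⁻ g, ENNReal.ofReal (‖inner ℂ w g‖ ^ 2 * ‖inner ℂ z g‖ ^ 2) ∂channelLaw L =
      ENNReal.ofReal (1 + ‖inner ℂ w z‖ ^ 2) := by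
  have polar : ∀ a b : ℂ, ‖a + b‖ ^ 4 + ‖a - b‖ ^ 4 + ‖a + Complex.I * b‖ ^ 4 +
      ‖a - Complex.I * b‖ ^ 4 = 4 * ‖a‖ ^ 4 + 4 * ‖b‖ ^ 4 + 16 * (‖a‖ ^ 2 * ‖b‖ ^ 2) := by
    intro a b
    have h4 : ∀ c : ℂ, ‖c‖ ^ 4 = (c.re ^ 2 + c.im ^ 2) ^ 2 := by
      intro c
      rw [show (4 : ℕ) = 2 * 2 from rfl, pow_mul, ← Complex.normSq_eq_norm_sq,
        Complex.normSq_apply]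
      ring
    have h2 : ∀ c : ℂ, ‖c‖ ^ 2 = c.re ^ 2 + c.im ^ 2 := by
      intro c
      rw [← Complex.normSq_eq_norm_sq, Complex.normSq_apply]
      ring
    simp only [h4, h2]
    simp
    ring
  have hc : ∀ c : ℂ, ‖c‖ = 1 → ‖w + c • z‖ ^ 4 = (2 + 2 * (c * inner ℂ w z).re) ^ 2 := by
    intro c hc
    rw [show (4 : ℕ) = 2 * 2 from rfl, pow_mul, norm_add_sq (𝕜 := ℂ), norm_smul, hc, hw, hz,
      inner_smul_right]
    simp only [RCLike.re_to_complex]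
    ring
  have hpolar : ∀ g : CVec L, ‖inner ℂ (w + (1 : ℂ) • z) g‖ ^ 4 +
      ‖inner ℂ (w + (-1 : ℂ) • z) g‖ ^ 4 + ‖inner ℂ (w + (-Complex.I) • z) g‖ ^ 4 +
      ‖inner ℂ (w + Complex.I • z) g‖ ^ 4 = 4 * ‖inner ℂ w g‖ ^ 4 + 4 * ‖inner ℂ z g‖ ^ 4 +
        16 * (‖inner ℂ w g‖ ^ 2 * ‖inner ℂ z g‖ ^ 2) := by
    intro g
    rw [← polar]
    simp only [inner_add_left, inner_smul_left, map_neg, map_one, Complex.conj_I, neg_neg]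
    simp only [one_mul, neg_mul, sub_eq_add_neg]
  have hlin := congrArg (fun F : CVec L → ENNReal => ∫⁻ g, F g ∂channelLaw L)
    (funext fun g => congrArg ENNReal.ofReal (hpolar g))
  have hsplit : ∀ a b : CVec L → ℝ, Measurable a → (∀ g, 0 ≤ a g) → (∀ g, 0 ≤ b g) →
      ∫⁻ g, ENNReal.ofReal (a g + b g) ∂channelLaw L =
        ∫⁻ g, ENNReal.ofReal (a g) ∂channelLaw L + ∫⁻ g, ENNReal.ofReal (b g) ∂channelLaw L := by
    intro a b ha ha0 hb0
    rw [← lintegral_add_left (by fun_prop)]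
    exact lintegral_congr fun g => ENNReal.ofReal_add (ha0 g) (hb0 g)
  have hmul : ∀ (c : ℝ) (a : CVec L → ℝ), 0 ≤ c → Measurable a →
      ∫⁻ g, ENNReal.ofReal (c * a g) ∂channelLaw L =
        ENNReal.ofReal c * ∫⁻ g, ENNReal.ofReal (a g) ∂channelLaw L := by
    intro c a hc ha
    rw [← lintegral_const_mul _ (by fun_prop)]
    exact lintegral_congr fun g => ENNReal.ofReal_mul hc
  rw [hsplit _ _ (by fun_prop) (fun g => by positivity) (fun g => by positivity),
    hsplit _ _ (by fun_prop) (fun g => by positivity) (fun g => by positivity),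
    hsplit _ _ (by fun_prop) (fun g => by positivity) (fun g => by positivity),
    hsplit _ _ (by fun_prop) (fun g => by positivity) (fun g => by positivity),
    hsplit _ _ (by fun_prop) (fun g => by positivity) (fun g => by positivity),
    hmul 4 _ (by norm_num) (by fun_prop), hmul 4 _ (by norm_num) (by fun_prop),
    hmul 16 _ (by norm_num) (by fun_prop)] at hlin
  simp only [lintegral_channelLaw_inner_pow_four] at hlin
  rw [hc 1 (by simp), hc (-1) (by simp), hc (-Complex.I) (by simp), hc Complex.I (by simp),
    hw, hz] at hlin
  set E := ∫⁻ g, ENNReal.ofReal (‖inner ℂ w g‖ ^ 2 * ‖inner ℂ z g‖ ^ 2) ∂channelLaw L with hE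
  have hEtop : E ≠ ⊤ := by
    intro h
    rw [h, ENNReal.mul_top (by norm_num), add_top] at hlin
    exact absurd hlin (by
      simp only [ENNReal.add_eq_top, ENNReal.ofReal_ne_top, or_self, not_false_eq_true])
  obtain ⟨r, hr0, hr⟩ : ∃ r : ℝ, 0 ≤ r ∧ E = ENNReal.ofReal r :=
    ⟨E.toReal, ENNReal.toReal_nonneg, (ENNReal.ofReal_toReal hEtop).symm⟩
  rw [hr] at hlin ⊢
  rw [← ENNReal.ofReal_add (by positivity) (by positivity),
    ← ENNReal.ofReal_add (by positivity) (by positivity),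
    ← ENNReal.ofReal_add (by positivity) (by positivity),
    ← ENNReal.ofReal_mul (by positivity),
    ← ENNReal.ofReal_mul (by positivity),
    ← ENNReal.ofReal_add (by positivity) (by positivity),
    ← ENNReal.ofReal_add (by positivity) (by positivity),
    ENNReal.ofReal_eq_ofReal_iff (by positivity) (by positivity)] at hlin
  congr 1
  rw [← Complex.normSq_eq_norm_sq, Complex.normSq_apply]
  simp at hlin
  nlinarith [hlin]

/-! ### Averaging over rotations -/

lemma inner_starProjection_of_mem {L : ℕ} {V : Submodule ℂ (CVec L)} {u : CVec L} (hu : u ∈ V)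
    (g : CVec L) : inner ℂ u (V.starProjection g) = inner ℂ u g := by
  have h := V.starProjection_inner_eq_zero g u hu
  rw [inner_sub_left, sub_eq_zero] at h
  rw [← inner_conj_symm, ← h, inner_conj_symm]

lemma norm_starProjection_sq {L : ℕ} (V : Submodule ℂ (CVec L)) (g : CVec L) :
    ‖V.starProjection g‖ ^ 2 = ∑ i, ‖inner ℂ (stdOrthonormalBasis ℂ V i : CVec L) g‖ ^ 2 := by
  rw [Submodule.starProjection_apply, ← Submodule.coe_norm,
    ← (stdOrthonormalBasis ℂ V).sum_sq_norm_inner_right]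
  refine Finset.sum_congr rfl fun i _ => ?_
  rw [Submodule.inner_orthogonalProjectionOnto_eq_of_mem_left]

lemma norm_stdOrthonormalBasis_coe {L : ℕ} (V : Submodule ℂ (CVec L)) (i) :
    ‖(stdOrthonormalBasis ℂ V i : CVec L)‖ = 1 :=
  (stdOrthonormalBasis ℂ V).norm_eq_one i

lemma lintegral_norm_starProjection_sq {L : ℕ} (V : Submodule ℂ (CVec L)) :
    ∫⁻ g, ENNReal.ofReal (‖V.starProjection g‖ ^ 2) ∂channelLaw L = Module.finrank ℂ V := by
  simp_rw [norm_starProjection_sq]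
  rw [lintegral_congr fun g => ENNReal.ofReal_sum_of_nonneg fun i _ => by positivity,
    lintegral_finsetSum _ fun i _ => by fun_prop]
  simp_rw [lintegral_channelLaw_inner_sq, norm_stdOrthonormalBasis_coe]
  simp

/-- The fourth moment of a sum of coordinates along unit vectors. -/
lemma lintegral_sum_inner_sq_sq {L : ℕ} {J : Type*} (s : Finset J) (q : J → CVec L)
    (hq : ∀ j ∈ s, ‖q j‖ = 1) :
    ∫⁻ g, ENNReal.ofReal ((∑ j ∈ s, ‖inner ℂ (q j) g‖ ^ 2) ^ 2) ∂channelLaw L =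
      ENNReal.ofReal (∑ j ∈ s, ∑ k ∈ s, (1 + ‖inner ℂ (q j) (q k)‖ ^ 2)) := by
  simp_rw [sq (∑ j ∈ s, _), Finset.sum_mul_sum]
  rw [lintegral_congr fun g => ENNReal.ofReal_sum_of_nonneg fun i _ =>
      Finset.sum_nonneg fun k _ => by positivity,
    lintegral_finsetSum _ fun i _ => by fun_prop,
    ENNReal.ofReal_sum_of_nonneg fun i _ => Finset.sum_nonneg fun k _ => by positivity]
  refine Finset.sum_congr rfl fun i hi => ?_
  rw [lintegral_congr fun g => ENNReal.ofReal_sum_of_nonneg fun i _ => by positivity,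
    lintegral_finsetSum _ fun i _ => by fun_prop,
    ENNReal.ofReal_sum_of_nonneg fun i _ => by positivity]
  exact Finset.sum_congr rfl fun k hk => lintegral_channelLaw_inner_sq_mul (hq i hi) (hq k hk)

lemma lintegral_norm_starProjection_pow_four {L : ℕ} (V : Submodule ℂ (CVec L)) :
    ∫⁻ g, ENNReal.ofReal (‖V.starProjection g‖ ^ 4) ∂channelLaw L =
      ENNReal.ofReal ((Module.finrank ℂ V : ℝ) ^ 2 + Module.finrank ℂ V) := by
  simp_rw [show (4 : ℕ) = 2 * 2 from rfl, pow_mul, norm_starProjection_sq]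
  rw [lintegral_sum_inner_sq_sq _ _ fun i _ => norm_stdOrthonormalBasis_coe V i]
  congr 1
  have h : ∀ i j, ‖inner ℂ (stdOrthonormalBasis ℂ V i : CVec L) (stdOrthonormalBasis ℂ V j)‖ ^ 2 =
      if i = j then (1 : ℝ) else 0 := by
    intro i j
    rw [← Submodule.coe_inner, orthonormal_iff_ite.1 (stdOrthonormalBasis ℂ V).orthonormal i j]
    split_ifs <;> simp
  simp_rw [h, Finset.sum_add_distrib]
  simp
  ring

/-- Any two unit vectors of `V` are related, up to a phase, by a unitary map that fixes `Vᗮ`: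
after a change of phase their inner product is real, and a reflection exchanges them. -/
lemma exists_unitary_map_eq_smul {L : ℕ} {V : Submodule ℂ (CVec L)} {u u' : CVec L}
    (hu : u ∈ V) (hu' : u' ∈ V) (hn : ‖u‖ = ‖u'‖) :
    ∃ U : CVec L ≃ₗᵢ[ℂ] CVec L, (∀ w ∈ Vᗮ, U w = w) ∧ ∃ c : ℂ, ‖c‖ = 1 ∧ U u = c • u' := by
  obtain ⟨c, hc, hreal⟩ : ∃ c : ℂ, ‖c‖ = 1 ∧ inner ℂ u (c • u') = inner ℂ (c • u') u := by
    by_cases hz : (inner ℂ u u' : ℂ) = 0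
    · have hz' : (inner ℂ u' u : ℂ) = 0 := by rw [← inner_conj_symm, hz, map_zero]
      exact ⟨1, by simp, by simp [hz, hz']⟩
    · have hn0 : (‖(inner ℂ u u' : ℂ)‖ : ℂ) ≠ 0 := by exact_mod_cast norm_ne_zero_iff.2 hz
      refine ⟨(starRingEnd ℂ) (inner ℂ u u') / ‖(inner ℂ u u' : ℂ)‖, ?_, ?_⟩
      · rw [norm_div, RCLike.norm_conj, Complex.norm_real, norm_norm, div_self (by simpa using hz)]
      · rw [inner_smul_right, inner_smul_left, map_div₀, Complex.conj_conj, Complex.conj_ofReal,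
          inner_conj_symm, ← inner_conj_symm u' u]
        simp
        ring
  set v := c • u' with hv
  have hvn : ‖v‖ = ‖u‖ := by rw [hv, norm_smul, hc, one_mul, hn]
  set W : Submodule ℂ (CVec L) := (Submodule.span ℂ {u - v})ᗮ with hW
  refine ⟨W.reflection, fun w hw => ?_, c, hc, ?_⟩
  · refine W.reflection_mem_subspace_eq_self ?_
    rw [hW, Submodule.mem_orthogonal_singleton_iff_inner_right]
    exact hw _ (V.sub_mem hu (V.smul_mem c hu'))
  · have h1 : W.reflection (u - v) = -(u - v) :=
      Submodule.reflection_orthogonalComplement_singleton_eq_neg (u - v)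
    have h2 : W.reflection (u + v) = u + v := by
      refine W.reflection_mem_subspace_eq_self ?_
      rw [hW, Submodule.mem_orthogonal_singleton_iff_inner_right, inner_sub_left, inner_add_right,
        inner_add_right, inner_self_eq_norm_sq_to_K, inner_self_eq_norm_sq_to_K, hreal, hvn]
      ring
    have h3 : (2 : ℂ) • W.reflection u = (2 : ℂ) • v := by
      rw [← map_smul, show (2 : ℂ) • u = (u - v) + (u + v) by rw [two_smul]; abel, map_add, h1, h2,
        two_smul]
      abel
    exact smul_right_injective _ (two_ne_zero) h3

/-- A homogeneous function on `V` that is invariant under the unitary maps fixing `Vᗮ` depends on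
the norm only. -/
lemma eq_mul_of_invariant {L : ℕ} {V : Submodule ℂ (CVec L)} {K : CVec L → ENNReal}
    {φ : ℝ → ENNReal} (hφ : φ 1 = 1)
    (hinv : ∀ U : CVec L ≃ₗᵢ[ℂ] CVec L, (∀ w ∈ Vᗮ, U w = w) → ∀ e ∈ V, K (U e) = K e)
    (hhom : ∀ (c : ℂ) (e : CVec L), c ≠ 0 → K (c • e) = φ ‖c‖ * K e)
    {u e : CVec L} (hu : u ∈ V) (hu1 : ‖u‖ = 1) (he : e ∈ V) (he0 : e ≠ 0) :
    K e = φ ‖e‖ * K u := by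
  have hn : ‖e‖ ≠ 0 := norm_ne_zero_iff.2 he0
  obtain ⟨U, hU, c, hc, hUc⟩ := exists_unitary_map_eq_smul hu
    (V.smul_mem ((‖e‖⁻¹ : ℝ) : ℂ) he) (by
      rw [norm_smul, Complex.norm_real, norm_inv, norm_norm, inv_mul_cancel₀ hn, hu1])
  have h1 : K u = K (((‖e‖⁻¹ : ℝ) : ℂ) • e) := by
    rw [← hinv U hU u hu, hUc, hhom c _ (by rintro rfl; simp at hc), hc, hφ, one_mul]
  have h2 : e = ((‖e‖ : ℝ) : ℂ) • (((‖e‖⁻¹ : ℝ) : ℂ) • e) := by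
    rw [smul_smul, ← Complex.ofReal_mul, mul_inv_cancel₀ hn, Complex.ofReal_one, one_smul]
  rw [h1]
  conv_lhs => rw [h2]
  rw [hhom _ _ (by exact_mod_cast hn), Complex.norm_real, norm_norm]

lemma channelLaw_inner_eq_zero {L : ℕ} {w : CVec L} (hw : w ≠ 0) :
    ∀ᵐ g ∂channelLaw L, inner ℂ w g ≠ 0 := by
  have hn : ‖w‖ ≠ 0 := norm_ne_zero_iff.2 hw
  have hu : ‖((‖w‖⁻¹ : ℝ) : ℂ) • w‖ = 1 := by
    rw [norm_smul, Complex.norm_real, norm_inv, norm_norm, inv_mul_cancel₀ hn]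
  have h := complexGaussian_zero
  rw [← map_inner_channelLaw hu, Measure.map_apply (by fun_prop) (measurableSet_singleton 0)] at h
  rw [ae_iff]
  refine measure_mono_null (fun g hg => ?_) h
  simp only [ne_eq, not_not, Set.mem_ofPred_eq] at hg
  simp [hg]

/-- The averaging principle: if `K e = ∫ Φ e` depends on the norm of `e ∈ V` only, then its value
at a unit vector is found by averaging `e` over the projection of a Rayleigh fading vector. -/
lemma lintegral_mul_eq_of_invariant {L : ℕ} {V : Submodule ℂ (CVec L)} {Ω : Type*}
    [MeasurableSpace Ω] {P : Measure Ω} [SFinite P] {Φ : CVec L → Ω → ENNReal}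
    (hΦ : Measurable (Function.uncurry Φ)) {φ : ℝ → ENNReal} (hφ : φ 1 = 1) (hφm : Measurable φ)
    (hinv : ∀ U : CVec L ≃ₗᵢ[ℂ] CVec L, (∀ w ∈ Vᗮ, U w = w) → ∀ e ∈ V,
      ∫⁻ ω, Φ (U e) ω ∂P = ∫⁻ ω, Φ e ω ∂P)
    (hhom : ∀ (c : ℂ) (e : CVec L), c ≠ 0 → ∫⁻ ω, Φ (c • e) ω ∂P = φ ‖c‖ * ∫⁻ ω, Φ e ω ∂P)
    {u : CVec L} (hu : u ∈ V) (hu1 : ‖u‖ = 1) :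
    (∫⁻ g, φ ‖V.starProjection g‖ ∂channelLaw L) * ∫⁻ ω, Φ u ω ∂P =
      ∫⁻ ω, ∫⁻ g, Φ (V.starProjection g) ω ∂channelLaw L ∂P := by
  have hP : Measurable fun g : CVec L => V.starProjection g :=
    V.starProjection.continuous.measurable
  rw [lintegral_lintegral_swap, ← lintegral_mul_const _ (by fun_prop)]
  · refine lintegral_congr_ae ?_
    have hu0 : u ≠ 0 := by rintro rfl; simp at hu1
    filter_upwards [channelLaw_inner_eq_zero hu0] with g hg
    refine (eq_mul_of_invariant (K := fun e => ∫⁻ ω, Φ e ω ∂P) hφ hinv hhom hu hu1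
      (V.starProjection_apply_mem g) ?_).symm
    intro h0
    refine hg ?_
    rw [← inner_starProjection_of_mem hu, h0, inner_zero_right]
  · exact (hΦ.comp ((hP.comp measurable_snd).prodMk measurable_fst)).aemeasurable

/-- The joint law of the random vectors `q ω j` is invariant under the unitary maps that fix the
orthogonal complement of `V`. -/
def RotationInvariant {L : ℕ} {Ω J : Type*} [MeasurableSpace Ω] (V : Submodule ℂ (CVec L))
    (P : Measure Ω) (q : Ω → J → CVec L) : Prop :=
  ∀ U : CVec L ≃ₗᵢ[ℂ] CVec L, (∀ w ∈ Vᗮ, U w = w) → P.map (fun ω j => U (q ω j)) = P.map q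

section RotationInvariant

variable {L : ℕ} {Ω J : Type*} [MeasurableSpace Ω] {V : Submodule ℂ (CVec L)}
  {P : Measure Ω} [IsProbabilityMeasure P] {q : Ω → J → CVec L}

/-- The averaging principle for functions `F` of the moduli of the coordinates `⟪q ω j, u⟫` that
are homogeneous, with factor `φ`. -/
lemma RotationInvariant.lintegral_mul_eq [Finite J] (hrot : RotationInvariant V P q)
    (hq : Measurable q)
    {F : (J → ℝ) → ENNReal} (hF : Measurable F) {φ : ℝ → ENNReal} (hφ : φ 1 = 1)
    (hφm : Measurable φ) (hhom : ∀ c : ℝ, 0 < c → ∀ x, F (fun j => c * x j) = φ c * F x)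
    {u : CVec L} (hu : u ∈ V) (hu1 : ‖u‖ = 1) :
    (∫⁻ g, φ ‖V.starProjection g‖ ∂channelLaw L) * ∫⁻ ω, F (fun j => ‖inner ℂ (q ω j) u‖) ∂P =
      ∫⁻ ω, ∫⁻ g, F (fun j => ‖inner ℂ (q ω j) (V.starProjection g)‖) ∂channelLaw L ∂P := by
  have hqj : ∀ j, Measurable fun ω => q ω j := fun j => (measurable_pi_apply j).comp hq
  refine lintegral_mul_eq_of_invariant (Φ := fun e ω => F (fun j => ‖inner ℂ (q ω j) e‖)) ?_ hφ hφm
    ?_ ?_ hu hu1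
  · refine hF.comp (measurable_pi_lambda _ fun j => ?_)
    exact (((hqj j).comp measurable_snd).inner measurable_fst).norm
  · intro U hU e he
    have hUs : ∀ w ∈ Vᗮ, U.symm w = w := fun w hw => by
      conv_lhs => rw [← hU w hw]
      exact U.symm_apply_apply w
    have hUm : Measurable fun ω j => U.symm (q ω j) :=
      measurable_pi_lambda _ fun j => U.symm.continuous.measurable.comp (hqj j)
    have hFe : Measurable fun x : J → CVec L => F (fun j => ‖inner ℂ (x j) e‖) := by
      refine hF.comp (measurable_pi_lambda _ fun j => ?_)
      exact ((measurable_pi_apply j).inner measurable_const).norm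
    have h := congrArg (fun m => ∫⁻ x, F (fun j => ‖inner ℂ (x j) e‖) ∂m) (hrot U.symm hUs)
    rw [lintegral_map hFe hUm, lintegral_map hFe hq] at h
    rw [← h]
    refine lintegral_congr fun ω => ?_
    congr 1
    ext j
    rw [← U.inner_map_map (U.symm (q ω j)) e, U.apply_symm_apply]
  · intro c e hc
    have hm : Measurable fun ω => F (fun j => ‖inner ℂ (q ω j) e‖) := by
      refine hF.comp (measurable_pi_lambda _ fun j => ?_)
      exact ((hqj j).inner measurable_const).norm
    rw [← lintegral_const_mul _ hm]
    refine lintegral_congr fun ω => ?_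
    rw [← hhom _ (norm_pos_iff.2 hc)]
    simp only [inner_smul_right, norm_mul]

/-- A coordinate of a rotation invariant vector has mean square `1 / dim V` or less. -/
lemma RotationInvariant.lintegral_inner_sq_le [Finite J] (hrot : RotationInvariant V P q)
    (hq : Measurable q) {j : J} (hj : ∀ᵐ ω ∂P, ‖q ω j‖ ≤ 1) {u : CVec L} (hu : u ∈ V)
    (hu1 : ‖u‖ = 1) :
    Module.finrank ℂ V * ∫⁻ ω, ENNReal.ofReal (‖inner ℂ (q ω j) u‖ ^ 2) ∂P ≤ 1 := by
  have h := hrot.lintegral_mul_eq hq (F := fun x => ENNReal.ofReal (x j ^ 2))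
    (φ := fun r => ENNReal.ofReal (r ^ 2)) (by fun_prop) (by simp) (by fun_prop)
    (fun c hc x => by rw [mul_pow, ENNReal.ofReal_mul (by positivity)]) hu hu1
  rw [lintegral_norm_starProjection_sq] at h
  rw [h]
  calc _ ≤ ∫⁻ _, 1 ∂P := by
        refine lintegral_mono_ae ?_
        filter_upwards [hj] with ω hω
        simp_rw [← Submodule.inner_starProjection_left_eq_right]
        rw [lintegral_channelLaw_inner_sq, ← ENNReal.ofReal_one]
        refine ENNReal.ofReal_le_ofReal (pow_le_one₀ (norm_nonneg _) ?_)
        exact (V.norm_starProjection_apply_le _).trans hω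
    _ = 1 := by simp

lemma RotationInvariant.lintegral_inner_sq_eq [Finite J] (hrot : RotationInvariant V P q)
    (hq : Measurable q) {j : J} (hj : ∀ᵐ ω ∂P, ‖q ω j‖ = 1) (hjV : ∀ᵐ ω ∂P, q ω j ∈ V)
    {u : CVec L} (hu : u ∈ V) (hu1 : ‖u‖ = 1) :
    Module.finrank ℂ V * ∫⁻ ω, ENNReal.ofReal (‖inner ℂ (q ω j) u‖ ^ 2) ∂P = 1 := by
  have h := hrot.lintegral_mul_eq hq (F := fun x => ENNReal.ofReal (x j ^ 2))
    (φ := fun r => ENNReal.ofReal (r ^ 2)) (by fun_prop) (by simp) (by fun_prop)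
    (fun c hc x => by rw [mul_pow, ENNReal.ofReal_mul (by positivity)]) hu hu1
  rw [lintegral_norm_starProjection_sq] at h
  rw [h]
  calc _ = ∫⁻ _, 1 ∂P := by
        refine lintegral_congr_ae ?_
        filter_upwards [hj, hjV] with ω hω hV
        simp_rw [inner_starProjection_of_mem hV]
        rw [lintegral_channelLaw_inner_sq, hω]
        simp
    _ = 1 := by simp

/-- The second moment of the energy that a rotation invariant family of unit vectors of `V` has in
a fixed direction of `V`. -/
lemma RotationInvariant.lintegral_sum_sq_le [Finite J] (hrot : RotationInvariant V P q)
    (hq : Measurable q) {s : Finset J} (hs : ∀ j ∈ s, ∀ᵐ ω ∂P, ‖q ω j‖ = 1)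
    (hsV : ∀ j ∈ s, ∀ᵐ ω ∂P, q ω j ∈ V) {u : CVec L} (hu : u ∈ V) (hu1 : ‖u‖ = 1) :
    ENNReal.ofReal ((Module.finrank ℂ V : ℝ) ^ 2) *
        ∫⁻ ω, ENNReal.ofReal ((∑ j ∈ s, ‖inner ℂ (q ω j) u‖ ^ 2) ^ 2) ∂P ≤
      ∫⁻ ω, ENNReal.ofReal (∑ j ∈ s, ∑ k ∈ s, (1 + ‖inner ℂ (q ω j) (q ω k)‖ ^ 2)) ∂P := by
  have h := hrot.lintegral_mul_eq hq (F := fun x => ENNReal.ofReal ((∑ j ∈ s, x j ^ 2) ^ 2))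
    (φ := fun r => ENNReal.ofReal (r ^ 4)) (by fun_prop) (by simp) (by fun_prop)
    (fun c hc x => by
      rw [← ENNReal.ofReal_mul (by positivity)]
      congr 1
      simp_rw [mul_pow, ← Finset.mul_sum]
      ring) hu hu1
  rw [lintegral_norm_starProjection_pow_four] at h
  have hs' : ∀ᵐ ω ∂P, ∀ j ∈ s, ‖q ω j‖ = 1 := (ae_ball_iff s.countable_toSet).2 hs
  have hsV' : ∀ᵐ ω ∂P, ∀ j ∈ s, q ω j ∈ V := (ae_ball_iff s.countable_toSet).2 hsV
  calc _ ≤ _ := mul_le_mul_left (ENNReal.ofReal_le_ofReal (le_add_of_nonneg_right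
          (Nat.cast_nonneg _))) _
    _ = _ := h
    _ = _ := by
      refine lintegral_congr_ae ?_
      filter_upwards [hs', hsV'] with ω h1 h2
      rw [← lintegral_sum_inner_sq_sq s (q ω) h1]
      refine lintegral_congr fun g => ?_
      congr 2
      exact Finset.sum_congr rfl fun j hj => by rw [inner_starProjection_of_mem (h2 j hj)]

/-- Jensen's inequality for `r ↦ r⁻¹` as a convex function of `r ^ 2`, in the form of a tangent
bound, since the integrand may be infinite. -/
lemma ofReal_inv_sqrt_le_lintegral (V : Submodule ℂ (CVec L)) (hL : 0 < L) :
    ENNReal.ofReal (√L)⁻¹ ≤ ∫⁻ g, (ENNReal.ofReal ‖V.starProjection g‖)⁻¹ ∂channelLaw L := by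
  have hm : Measurable fun g : CVec L => V.starProjection g :=
    V.starProjection.continuous.measurable
  have hs : 0 < √(L : ℝ) := Real.sqrt_pos.2 (by exact_mod_cast hL)
  -- the tangent of `r ↦ r⁻¹`, as a function of `r ^ 2`, at `r ^ 2 = L`
  have hpt : ∀ r : ℝ, 0 ≤ r → ENNReal.ofReal (3 / 2 * (√L)⁻¹) ≤
      (ENNReal.ofReal r)⁻¹ + ENNReal.ofReal (1 / 2 * (√L)⁻¹ ^ 3) * ENNReal.ofReal (r ^ 2) := by
    intro r hr
    rcases hr.eq_or_lt with rfl | hr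
    · simp
    rw [← ENNReal.ofReal_inv_of_pos hr, ← ENNReal.ofReal_mul (by positivity),
      ← ENNReal.ofReal_add (by positivity) (by positivity)]
    refine ENNReal.ofReal_le_ofReal ?_
    have : r⁻¹ + 1 / 2 * (√L)⁻¹ ^ 3 * r ^ 2 - 3 / 2 * (√L)⁻¹ =
        (r - √L) ^ 2 * (r + 2 * √L) / (2 * r * √L ^ 3) := by
      field_simp
      ring
    have h2 : 0 ≤ (r - √L) ^ 2 * (r + 2 * √L) / (2 * r * √L ^ 3) := by positivity
    linarith
  have hint := lintegral_mono (μ := channelLaw L) fun g => hpt ‖V.starProjection g‖ (norm_nonneg _)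
  rw [lintegral_add_right _ (by fun_prop), lintegral_const_mul _ (by fun_prop),
    lintegral_norm_starProjection_sq] at hint
  simp only [lintegral_const, measure_univ, mul_one] at hint
  have hfin : (Module.finrank ℂ V : ENNReal) ≤ ENNReal.ofReal L := by
    rw [ENNReal.ofReal_natCast]
    have := V.finrank_le
    rw [finrank_euclideanSpace_fin] at this
    exact_mod_cast this
  have h3 : ENNReal.ofReal (1 / 2 * (√L)⁻¹ ^ 3) * (Module.finrank ℂ V : ENNReal) ≤
      ENNReal.ofReal (1 / 2 * (√L)⁻¹) := by
    refine (mul_le_mul_right hfin _).trans ?_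
    rw [← ENNReal.ofReal_mul (by positivity)]
    refine ENNReal.ofReal_le_ofReal (le_of_eq ?_)
    have h4 : (L : ℝ) = √L ^ 2 := (Real.sq_sqrt (Nat.cast_nonneg _)).symm
    conv_lhs => rw [h4, Real.sqrt_sq hs.le]
    field_simp
  have h5 := hint.trans (add_le_add_right h3 _)
  rw [show 3 / 2 * (√(L : ℝ))⁻¹ = (√L)⁻¹ + 1 / 2 * (√L)⁻¹ by ring,
    ENNReal.ofReal_add (by positivity) (by positivity)] at h5
  exact ENNReal.le_of_add_le_add_right ENNReal.ofReal_ne_top h5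

/-- A coordinate of a rotation invariant unit vector of `V` is not much smaller than `1 / √L`. -/
lemma RotationInvariant.lintegral_inner_inv_le [Finite J] (hrot : RotationInvariant V P q)
    (hq : Measurable q) {j : J} (hj : ∀ᵐ ω ∂P, ‖q ω j‖ = 1) (hjV : ∀ᵐ ω ∂P, q ω j ∈ V)
    {u : CVec L} (hu : u ∈ V) (hu1 : ‖u‖ = 1) :
    ∫⁻ ω, (ENNReal.ofReal ‖inner ℂ (q ω j) u‖)⁻¹ ∂P ≤ ENNReal.ofReal (√Real.pi * √L) := by
  have hL : 0 < L := by
    rcases Nat.eq_zero_or_pos L with rfl | h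
    · exfalso
      rw [Subsingleton.elim u 0, norm_zero] at hu1
      exact zero_ne_one hu1
    · exact h
  have h := hrot.lintegral_mul_eq hq (F := fun x => (ENNReal.ofReal (x j))⁻¹)
    (φ := fun r => (ENNReal.ofReal r)⁻¹) (by fun_prop) (by simp) (by fun_prop)
    (fun c hc x => by
      rw [ENNReal.ofReal_mul hc.le, ENNReal.mul_inv (Or.inl (by simpa using hc)) (Or.inl (by simp))])
    hu hu1
  have h2 : ∫⁻ ω, ∫⁻ g, (ENNReal.ofReal ‖inner ℂ (q ω j) (V.starProjection g)‖)⁻¹ ∂channelLaw L ∂P =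
      ENNReal.ofReal (√Real.pi) := by
    have : ∀ᵐ ω ∂P, ∫⁻ g, (ENNReal.ofReal ‖inner ℂ (q ω j) (V.starProjection g)‖)⁻¹ ∂channelLaw L =
        ENNReal.ofReal (√Real.pi) := by
      filter_upwards [hj, hjV] with ω h1 h2
      simp_rw [inner_starProjection_of_mem h2]
      rw [lintegral_channelLaw_inner h1 (fun z => (ENNReal.ofReal ‖z‖)⁻¹) (by fun_prop),
        ← lintegral_complexGaussian_inv]
      refine lintegral_congr_ae ?_
      have h0 : ∀ᵐ z ∂complexGaussian, z ≠ 0 := by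
        rw [ae_iff]
        simpa using complexGaussian_zero
      filter_upwards [h0] with z hz
      rw [ENNReal.ofReal_inv_of_pos (norm_pos_iff.2 hz)]
    rw [lintegral_congr_ae this]
    simp
  rw [h2] at h
  have hs : 0 < √(L : ℝ) := Real.sqrt_pos.2 (by exact_mod_cast hL)
  have h3 : ENNReal.ofReal (√L)⁻¹ * ∫⁻ ω, (ENNReal.ofReal ‖inner ℂ (q ω j) u‖)⁻¹ ∂P ≤
      ENNReal.ofReal (√Real.pi) := by
    rw [← h]
    exact mul_le_mul_left (ofReal_inv_sqrt_le_lintegral V hL) _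
  rw [ENNReal.ofReal_inv_of_pos hs] at h3
  rw [ENNReal.ofReal_mul (by positivity), mul_comm]
  rwa [ENNReal.inv_mul_le_iff (by simpa using hs) (by simp)] at h3

end RotationInvariant

/-! ### Zero-forcing beams: geometry and measurability -/

lemma norm_direction_le_one {L : ℕ} (x : CVec L) : ‖direction x‖ ≤ 1 := by
  rw [direction, norm_smul, Complex.norm_real, norm_inv, norm_norm]
  exact inv_mul_le_one

lemma norm_direction {L : ℕ} {x : CVec L} (hx : x ≠ 0) : ‖direction x‖ = 1 := by
  rw [direction, norm_smul, Complex.norm_real, norm_inv, norm_norm,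
    inv_mul_cancel₀ (norm_ne_zero_iff.2 hx)]

lemma norm_smul_direction {L : ℕ} (x : CVec L) : ((‖x‖ : ℝ) : ℂ) • direction x = x := by
  by_cases hx : x = 0
  · simp [hx]
  rw [direction, smul_smul, ← Complex.ofReal_mul, mul_inv_cancel₀ (norm_ne_zero_iff.2 hx),
    Complex.ofReal_one, one_smul]

lemma direction_map {L : ℕ} (U : CVec L ≃ₗᵢ[ℂ] CVec L) (x : CVec L) :
    direction (U x) = U (direction x) := by
  rw [direction, direction, U.norm_map, map_smul]

lemma direction_mem {L : ℕ} {V : Submodule ℂ (CVec L)} {x : CVec L} (hx : x ∈ V) :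
    direction x ∈ V := V.smul_mem _ hx

lemma norm_inner_direction {L : ℕ} (x y : CVec L) :
    ‖inner ℂ x (direction y)‖ = ‖inner ℂ x y‖ / ‖y‖ := by
  rw [direction, inner_smul_right, norm_mul, Complex.norm_real, norm_inv, norm_norm, div_eq_inv_mul]

lemma norm_inner_direction_left {L : ℕ} (x y : CVec L) :
    ‖inner ℂ (direction x) y‖ = ‖inner ℂ x y‖ / ‖x‖ := by
  rw [norm_inner_symm, norm_inner_direction, norm_inner_symm]

lemma inner_self_eq_ofReal {L : ℕ} (x : CVec L) : inner ℂ x x = ((‖x‖ ^ 2 : ℝ) : ℂ) := by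
  rw [inner_self_eq_norm_sq_to_K]
  push_cast
  rfl

lemma starProjection_orthogonal_congr {L : ℕ} {K K' : Submodule ℂ (CVec L)} (h : K = K')
    (x : CVec L) : Kᗮ.starProjection x = K'ᗮ.starProjection x := by
  subst h
  rfl

/-- One Gram–Schmidt step for the projection on an orthogonal complement. -/
lemma starProjection_orthogonal_span_insert {L : ℕ} (S : Set (CVec L)) (a v : CVec L) :
    (Submodule.span ℂ (insert a S))ᗮ.starProjection v =
      (Submodule.span ℂ S)ᗮ.starProjection v -
        (inner ℂ ((Submodule.span ℂ S)ᗮ.starProjection a)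
          ((Submodule.span ℂ S)ᗮ.starProjection v) /
          ((‖(Submodule.span ℂ S)ᗮ.starProjection a‖ ^ 2 : ℝ) : ℂ)) •
        (Submodule.span ℂ S)ᗮ.starProjection a := by
  set K := Submodule.span ℂ S with hK
  set c : ℂ := inner ℂ (Kᗮ.starProjection a) (Kᗮ.starProjection v) /
          ((‖Kᗮ.starProjection a‖ ^ 2 : ℝ) : ℂ) with hc
  have hr : Kᗮ.starProjection v - c • Kᗮ.starProjection a ∈ Kᗮ :=
    Kᗮ.sub_mem (Kᗮ.starProjection_apply_mem v) (Kᗮ.smul_mem _ (Kᗮ.starProjection_apply_mem a))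
  have hle : K ≤ Submodule.span ℂ (insert a S) := Submodule.span_mono (Set.subset_insert a S)
  have hmem : ∀ w, w - Kᗮ.starProjection w ∈ K := by
    intro w
    rw [Submodule.starProjection_orthogonal_val, sub_sub_cancel]
    exact K.starProjection_apply_mem w
  refine Submodule.eq_starProjection_of_mem_orthogonal ?_ ?_
  · rw [Submodule.span_insert, ← Submodule.inf_orthogonal, Submodule.mem_inf]
    refine ⟨?_, hr⟩
    rw [Submodule.mem_orthogonal_singleton_iff_inner_right]
    have h1 : inner ℂ a (Kᗮ.starProjection v - c • Kᗮ.starProjection a) =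
        inner ℂ (Kᗮ.starProjection a) (Kᗮ.starProjection v - c • Kᗮ.starProjection a) := by
      have h := Submodule.inner_right_of_mem_orthogonal (hmem a) hr
      rw [inner_sub_left, sub_eq_zero] at h
      exact h
    rw [h1, inner_sub_right, inner_smul_right, inner_self_eq_ofReal, hc]
    by_cases h0 : Kᗮ.starProjection a = 0
    · simp [h0]
    · have h2 : ((‖Kᗮ.starProjection a‖ ^ 2 : ℝ) : ℂ) ≠ 0 := by
        exact_mod_cast pow_ne_zero 2 (norm_ne_zero_iff.2 h0)
      rw [div_mul_cancel₀ _ h2, sub_self]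
  · refine Submodule.le_orthogonal_orthogonal _ ?_
    rw [← sub_add]
    refine Submodule.add_mem _ (hle (hmem v)) (Submodule.smul_mem _ _ ?_)
    rw [← sub_sub_cancel a (Kᗮ.starProjection a)]
    exact Submodule.sub_mem _ (Submodule.subset_span (Set.mem_insert _ _)) (hle (hmem a))

lemma measurable_starProjection_orthogonal_span {L : ℕ} {Ω J : Type*} [MeasurableSpace Ω]
    [DecidableEq J] (S : Finset J) {p : Ω → J → CVec L} (hp : ∀ j, Measurable fun ω => p ω j)
    {v : Ω → CVec L} (hv : Measurable v) :
    Measurable fun ω => (Submodule.span ℂ (p ω '' (S : Set J)))ᗮ.starProjection (v ω) := by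
  induction S using Finset.induction_on generalizing v with
  | empty =>
    have h : ∀ ω, (Submodule.span ℂ (p ω '' ((∅ : Finset J) : Set J)))ᗮ.starProjection (v ω) = v ω :=
      fun ω => Submodule.starProjection_eq_self_iff.2 (by simp)
    simp_rw [h]
    exact hv
  | insert a S ha ih =>
    simp_rw [Finset.coe_insert, Set.image_insert_eq, starProjection_orthogonal_span_insert]
    have h1 := ih hv
    have h2 := ih (hp a)
    refine h1.sub (Measurable.smul (Measurable.div (h2.inner (𝕜 := ℂ) h1) ?_) h2)
    exact Complex.measurable_ofReal.comp (h2.norm.pow_const 2)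

lemma measurable_zfBeam {L m : ℕ} (A : Finset (Fin m)) (i : Fin m) :
    Measurable fun p : Fin m → CVec L => zfBeam A p i := by
  refine measurable_direction.comp ?_
  exact measurable_starProjection_orthogonal_span (p := fun p : Fin m → CVec L => p) (A.erase i)
    (fun j => measurable_pi_apply j) (measurable_pi_apply i)

lemma zfBeam_map {L m : ℕ} (U : CVec L ≃ₗᵢ[ℂ] CVec L) (A : Finset (Fin m)) (p : Fin m → CVec L)
    (i : Fin m) : zfBeam A (fun j => U (p j)) i = U (zfBeam A p i) := by
  rw [zfBeam, zfBeam, ← direction_map]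
  congr 1
  have h : (Submodule.span ℂ ((fun j => U (p j)) '' (A.erase i : Set (Fin m)))) =
      (Submodule.span ℂ (p '' (A.erase i : Set (Fin m)))).map
        (U.toLinearEquiv : CVec L →ₗ[ℂ] CVec L) := by
    rw [Submodule.map_span, Set.image_image]
    rfl
  rw [starProjection_orthogonal_congr h, Submodule.starProjection_orthogonal_val,
    Submodule.starProjection_orthogonal_val,
    Submodule.starProjection_map_apply, U.symm_apply_apply, map_sub]

lemma zfBeam_mem {L m : ℕ} (A : Finset (Fin m)) (p : Fin m → CVec L) (i : Fin m) :
    zfBeam A p i ∈ (Submodule.span ℂ (p '' (A.erase i : Set (Fin m))))ᗮ :=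
  direction_mem (Submodule.starProjection_apply_mem _ _)

lemma inner_zfBeam_eq_zero {L m : ℕ} {A : Finset (Fin m)} (p : Fin m → CVec L) {i j : Fin m}
    (hj : j ∈ A.erase i) : inner ℂ (p j) (zfBeam A p i) = 0 :=
  Submodule.inner_right_of_mem_orthogonal
    (Submodule.subset_span (Set.mem_image_of_mem p (Finset.mem_coe.2 hj))) (zfBeam_mem A p i)

lemma norm_zfBeam_le_one {L m : ℕ} (A : Finset (Fin m)) (p : Fin m → CVec L) (i : Fin m) :
    ‖zfBeam A p i‖ ≤ 1 := norm_direction_le_one _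

lemma norm_zfBeam {L m : ℕ} {A : Finset (Fin m)} {p : Fin m → CVec L} {i : Fin m}
    (h : p i ∉ Submodule.span ℂ (p '' (A.erase i : Set (Fin m)))) : ‖zfBeam A p i‖ = 1 := by
  refine norm_direction fun h0 => h ?_
  rw [Submodule.starProjection_orthogonal_val, sub_eq_zero] at h0
  rw [h0]
  exact Submodule.starProjection_apply_mem _ _

lemma inner_self_zfBeam {L m : ℕ} (A : Finset (Fin m)) (p : Fin m → CVec L) (i : Fin m) :
    ‖inner ℂ (p i) (zfBeam A p i)‖ =
      ‖(Submodule.span ℂ (p '' (A.erase i : Set (Fin m))))ᗮ.starProjection (p i)‖ := by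
  set V := (Submodule.span ℂ (p '' (A.erase i : Set (Fin m))))ᗮ
  rw [zfBeam, norm_inner_direction, norm_inner_symm,
    ← inner_starProjection_of_mem (V.starProjection_apply_mem (p i)), inner_self_eq_norm_sq_to_K]
  by_cases h0 : ‖V.starProjection (p i)‖ = 0
  · refine Eq.trans ?_ h0.symm
    simp only [h0]
    simp
  · simp only [norm_pow, RCLike.norm_ofReal, abs_norm]
    rw [sq, mul_div_assoc, div_self h0, mul_one]

lemma norm_inner_zfBeam_le {L m : ℕ} (A : Finset (Fin m)) (p : Fin m → CVec L) (i : Fin m)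
    (v : CVec L) : ‖inner ℂ v (zfBeam A p i)‖ ≤
      ‖(Submodule.span ℂ (p '' (A.erase i : Set (Fin m))))ᗮ.starProjection v‖ := by
  rw [norm_inner_symm, ← inner_starProjection_of_mem (zfBeam_mem A p i)]
  refine (norm_inner_le_norm _ _).trans ?_
  exact mul_le_of_le_one_left (norm_nonneg _) (norm_zfBeam_le_one A p i)

/-- In a plane, the directions dual to two vectors have the same angle as the two vectors. -/
lemma norm_inner_direction_sub_le {L : ℕ} (x y : CVec L) :
    ‖inner ℂ (direction (x - (inner ℂ y x / ((‖y‖ ^ 2 : ℝ) : ℂ)) • y))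
        (direction (y - (inner ℂ x y / ((‖x‖ ^ 2 : ℝ) : ℂ)) • x))‖ ≤
      ‖inner ℂ (direction x) (direction y)‖ := by
  have key : ∀ x y : CVec L, inner ℂ y (x - (inner ℂ y x / ((‖y‖ ^ 2 : ℝ) : ℂ)) • y) = 0 := by
    intro x y
    by_cases hy : y = 0
    · simp [hy]
    have hy' : ((‖y‖ ^ 2 : ℝ) : ℂ) ≠ 0 := by exact_mod_cast pow_ne_zero 2 (norm_ne_zero_iff.2 hy)
    rw [inner_sub_right, inner_smul_right, inner_self_eq_ofReal, div_mul_cancel₀ _ hy', sub_self]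
  have hnorm : ∀ x y : CVec L, y ≠ 0 → ‖x - (inner ℂ y x / ((‖y‖ ^ 2 : ℝ) : ℂ)) • y‖ ^ 2 * ‖y‖ ^ 2 =
      ‖x‖ ^ 2 * ‖y‖ ^ 2 - ‖inner ℂ x y‖ ^ 2 := by
    intro x y hy
    have hy' : ‖y‖ ≠ 0 := norm_ne_zero_iff.2 hy
    set r := x - (inner ℂ y x / ((‖y‖ ^ 2 : ℝ) : ℂ)) • y with hr
    have hx : x = r + (inner ℂ y x / ((‖y‖ ^ 2 : ℝ) : ℂ)) • y := by rw [hr]; abel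
    have h1 : ‖x‖ ^ 2 = ‖r‖ ^ 2 + ‖(inner ℂ y x / ((‖y‖ ^ 2 : ℝ) : ℂ)) • y‖ ^ 2 := by
      conv_lhs => rw [hx]
      have h0 : inner ℂ r ((inner ℂ y x / ((‖y‖ ^ 2 : ℝ) : ℂ)) • y) = 0 := by
        rw [inner_smul_right, ← inner_conj_symm r y, hr, key x y, map_zero, mul_zero]
      simpa [sq] using norm_add_sq_eq_norm_sq_add_norm_sq_of_inner_eq_zero _ _ h0
    rw [h1, norm_smul, norm_div, Complex.norm_real, norm_pow, norm_norm, norm_inner_symm]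
    field_simp
    ring
  by_cases hx : x = 0
  · simp [hx, direction]
  by_cases hy : y = 0
  · simp [hy, direction]
  have hx' : ‖x‖ ≠ 0 := norm_ne_zero_iff.2 hx
  have hy' : ‖y‖ ≠ 0 := norm_ne_zero_iff.2 hy
  set r := x - (inner ℂ y x / ((‖y‖ ^ 2 : ℝ) : ℂ)) • y with hr
  set t := y - (inner ℂ x y / ((‖x‖ ^ 2 : ℝ) : ℂ)) • x with ht
  rw [norm_inner_direction, norm_inner_direction_left, norm_inner_direction,
    norm_inner_direction_left]
  by_cases hr0 : r = 0
  · simp only [hr0, inner_zero_left, norm_zero, zero_div]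
    positivity
  by_cases ht0 : t = 0
  · simp only [ht0, inner_zero_right, norm_zero, zero_div]
    positivity
  have hr' : ‖r‖ ≠ 0 := norm_ne_zero_iff.2 hr0
  have ht' : ‖t‖ ≠ 0 := norm_ne_zero_iff.2 ht0
  have e1 : ‖r‖ * ‖y‖ = ‖t‖ * ‖x‖ := by
    have h1 := hnorm x y hy
    have h2 := hnorm y x hx
    rw [norm_inner_symm y x] at h2
    refine (pow_left_inj₀ (by positivity) (by positivity) two_ne_zero).1 ?_
    rw [mul_pow, mul_pow]
    linarith
  have e2 : ‖inner ℂ r t‖ = ‖inner ℂ x y‖ * ‖r‖ ^ 2 / ‖x‖ ^ 2 := by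
    have h1 : inner ℂ r y = 0 := by rw [← inner_conj_symm, key x y, map_zero]
    have h2 : inner ℂ r x = ((‖r‖ ^ 2 : ℝ) : ℂ) := by
      have hx2 : x = r + (inner ℂ y x / ((‖y‖ ^ 2 : ℝ) : ℂ)) • y := by rw [hr]; abel
      conv_lhs => rw [hx2]
      rw [inner_add_right, inner_smul_right, h1, mul_zero, add_zero, inner_self_eq_norm_sq_to_K]
      push_cast
      rfl
    rw [ht, inner_sub_right, h1, inner_smul_right, h2, zero_sub, norm_neg, norm_mul, norm_div,
      Complex.norm_real, Complex.norm_real, norm_pow, norm_norm, norm_pow, norm_norm]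
    ring
  rw [e2]
  apply le_of_eq
  have e3 : ‖r‖ = ‖t‖ * ‖x‖ / ‖y‖ := by rw [← e1]; field_simp
  rw [e3]
  field_simp

/-- The correlation of two beams is at most that of the projections of the two quantised channels
on the orthogonal complement of the remaining ones. -/
lemma norm_inner_zfBeam_zfBeam_le {L m : ℕ} {A : Finset (Fin m)} (p : Fin m → CVec L) {j k : Fin m}
    (hj : j ∈ A) (hk : k ∈ A) (hjk : j ≠ k) {V : Submodule ℂ (CVec L)}
    (hV : V = (Submodule.span ℂ (p '' ((A.erase j).erase k : Set (Fin m))))ᗮ) :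
    ‖inner ℂ (zfBeam A p j) (zfBeam A p k)‖ ≤
      ‖inner ℂ (direction (V.starProjection (p j))) (direction (V.starProjection (p k)))‖ := by
  have h1 : (A.erase j : Set (Fin m)) = insert k ((A.erase j).erase k : Set (Fin m)) := by
    rw [← Finset.coe_insert, Finset.insert_erase]
    exact Finset.mem_erase.2 ⟨hjk.symm, hk⟩
  have h2 : (A.erase k : Set (Fin m)) = insert j ((A.erase j).erase k : Set (Fin m)) := by
    rw [← Finset.coe_insert, Finset.erase_right_comm, Finset.insert_erase]
    exact Finset.mem_erase.2 ⟨hjk, hj⟩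
  subst hV
  rw [zfBeam, zfBeam, starProjection_orthogonal_congr (congrArg (Submodule.span ℂ)
      ((congrArg (p '' ·) h1).trans (Set.image_insert_eq))),
    starProjection_orthogonal_congr (congrArg (Submodule.span ℂ)
      ((congrArg (p '' ·) h2).trans (Set.image_insert_eq))),
    starProjection_orthogonal_span_insert, starProjection_orthogonal_span_insert]
  exact norm_inner_direction_sub_le _ _

/-! ### Quantisation: equivariance and measurability -/

lemma mem_bestCodewords {L N : ℕ} {c : Fin N → CVec L} {v : CVec L} {k : Fin N} :
    k ∈ bestCodewords c v ↔ ∀ l, ‖inner ℂ v (c l)‖ ≤ ‖inner ℂ v (c k)‖ := by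
  simp [bestCodewords]

lemma bestCodewords_map {L N : ℕ} (U : CVec L ≃ₗᵢ[ℂ] CVec L) (c : Fin N → CVec L) (v : CVec L) :
    bestCodewords (fun k => U (c k)) (U v) = bestCodewords c v := by
  ext k
  simp [mem_bestCodewords]

lemma quantize_map {L r : ℕ} (U : CVec L ≃ₗᵢ[ℂ] CVec L) (c : Fin (2 ^ r) → CVec L) (h : CVec L) :
    quantize (fun k => U (c k)) (U h) = U (quantize c h) := by
  have h1 : bestCodewords (fun k => U (c k)) (direction (U h)) = bestCodewords c (direction h) := by
    rw [direction_map, bestCodewords_map]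
  simp only [quantize, h1]

lemma quantize_mem_range {L r : ℕ} (c : Fin (2 ^ r) → CVec L) (h : CVec L) :
    ∃ k, quantize c h = c k := ⟨_, rfl⟩

lemma norm_inner_le_quantize {L r : ℕ} (c : Fin (2 ^ r) → CVec L) (h : CVec L) (k : Fin (2 ^ r)) :
    ‖inner ℂ (direction h) (c k)‖ ≤ ‖inner ℂ (direction h) (quantize c h)‖ :=
  mem_bestCodewords.1 (Finset.min'_mem _ (bestCodewords_nonempty c (direction h))) k

lemma measurable_quantize {L r : ℕ} :
    Measurable fun y : CVec L × (Fin (2 ^ r) → CVec L) => quantize y.2 y.1 := by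
  have hbest : ∀ k, MeasurableSet {y : CVec L × (Fin (2 ^ r) → CVec L) |
      k ∈ bestCodewords y.2 (direction y.1)} := by
    intro k
    simp_rw [mem_bestCodewords, Set.ofPred_forall]
    have hp : ∀ l, Measurable fun y : CVec L × (Fin (2 ^ r) → CVec L) =>
        ‖inner ℂ (direction y.1) (y.2 l)‖ := fun l =>
      ((measurable_direction.comp measurable_fst).inner (𝕜 := ℂ)
        ((measurable_pi_apply l).comp measurable_snd)).norm
    exact MeasurableSet.iInter fun l => measurableSet_le (hp l) (hp k)
  have hidx : Measurable fun y : CVec L × (Fin (2 ^ r) → CVec L) =>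
      (bestCodewords y.2 (direction y.1)).min' (bestCodewords_nonempty _ _) := by
    refine measurable_to_countable' fun k => ?_
    have : (fun y : CVec L × (Fin (2 ^ r) → CVec L) => (bestCodewords y.2 (direction y.1)).min'
        (bestCodewords_nonempty _ _)) ⁻¹' {k} =
        {y | k ∈ bestCodewords y.2 (direction y.1)} ∩
          ⋂ l : Fin (2 ^ r), {y | l < k → l ∉ bestCodewords y.2 (direction y.1)} := by
      ext y
      simp only [Set.mem_preimage, Set.mem_singleton_iff, Set.mem_inter_iff, Set.mem_iInter]
      rw [Finset.min'_eq_iff]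
      refine and_congr_right fun _ => forall_congr' fun l => ?_
      exact ⟨fun h hl hm => absurd (h hm) (not_le.2 hl), fun h hm => not_lt.1 fun hl => h hl hm⟩
    rw [this]
    refine (hbest k).inter (MeasurableSet.iInter fun l => ?_)
    by_cases hl : l < k
    · simp only [hl, forall_true_left]
      exact (hbest l).compl
    · simp [hl]
  have heval : Measurable fun z : (Fin (2 ^ r) → CVec L) × Fin (2 ^ r) => z.1 z.2 :=
    measurable_from_prod_countable_left fun k => measurable_pi_apply k
  exact heval.comp (measurable_snd.prodMk hidx)

/-! ### Resampling one coordinate of a product measure -/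

section Resampling

variable {ι : Type*} [Fintype ι] [DecidableEq ι] {X : ι → Type*} [∀ i, MeasurableSpace (X i)]
  {μ : ∀ i, Measure (X i)} [∀ i, IsProbabilityMeasure (μ i)]

/-- Fubini's theorem in the form used for conditioning: resampling one coordinate does not change
the law. -/
lemma lintegral_pi_update (i : ι) {F : (∀ i, X i) → ENNReal} (hF : Measurable F) :
    ∫⁻ x, F x ∂Measure.pi μ = ∫⁻ x, ∫⁻ y, F (Function.update x i y) ∂μ i ∂Measure.pi μ := by
  have hG : Measurable fun x => ∫⁻ y, F (Function.update x i y) ∂μ i := by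
    have := hF.lmarginal μ (s := {i})
    rwa [lmarginal_singleton] at this
  by_cases hne : Nonempty (∀ i, X i)
  · obtain ⟨x₀⟩ := hne
    rw [lintegral_eq_lmarginal_univ x₀, lintegral_eq_lmarginal_univ x₀,
      lmarginal_erase' F hF (Finset.mem_univ i), lmarginal_erase' _ hG (Finset.mem_univ i)]
    congr 2
    ext x
    simp
  · rw [not_nonempty_iff] at hne
    simp [lintegral_of_isEmpty]

lemma ae_pi_of_update (i : ι) {p : (∀ i, X i) → Prop} (hp : MeasurableSet {x | p x})
    (h : ∀ x, ∀ᵐ y ∂μ i, p (Function.update x i y)) : ∀ᵐ x ∂Measure.pi μ, p x := by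
  rw [ae_iff]
  have hc : MeasurableSet {x | ¬ p x} := hp.compl
  rw [← lintegral_indicator_one hc, lintegral_pi_update i (measurable_one.indicator hc)]
  have : ∀ x, ∫⁻ y, {x | ¬ p x}.indicator 1 (Function.update x i y) ∂μ i =
      ∫⁻ _, (0 : ENNReal) ∂μ i := by
    intro x
    refine lintegral_congr_ae ?_
    filter_upwards [h x] with y hy
    simp [hy]
  simp [this]

end Resampling

/-! ### Isotropic laws -/

/-- A unitarily invariant law on the unit sphere that does not charge proper subspaces. -/
structure IsIsotropic {L : ℕ} (ν : Measure (CVec L)) : Prop where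
  map_eq : ∀ U : CVec L ≃ₗᵢ[ℂ] CVec L, ν.map U = ν
  norm_eq_one : ∀ᵐ x ∂ν, ‖x‖ = 1
  notMem : ∀ W : Submodule ℂ (CVec L), W ≠ ⊤ → ∀ᵐ x ∂ν, x ∉ W

lemma channelLaw_notMem {L : ℕ} {W : Submodule ℂ (CVec L)} (hW : W ≠ ⊤) :
    ∀ᵐ x ∂channelLaw L, x ∉ W := by
  have h1 : Wᗮ ≠ ⊥ := fun h => hW ((Submodule.orthogonal_eq_bot_iff).1 h)
  obtain ⟨w, hw, hw0⟩ := Submodule.exists_mem_ne_zero_of_ne_bot h1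
  filter_upwards [channelLaw_inner_eq_zero hw0] with g hg hgW
  exact hg (Submodule.inner_left_of_mem_orthogonal hgW hw)

lemma channelLaw_ne_zero {L : ℕ} (hL : 0 < L) : ∀ᵐ x ∂channelLaw L, x ≠ 0 := by
  have : Nonempty (Fin L) := ⟨⟨0, hL⟩⟩
  have h : (⊥ : Submodule ℂ (CVec L)) ≠ ⊤ := bot_ne_top
  filter_upwards [channelLaw_notMem h] with x hx h0
  exact hx (by simp [h0])

lemma isIsotropic_isotropicLaw {L : ℕ} (hL : 0 < L) : IsIsotropic (isotropicLaw L) where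
  map_eq U := by
    rw [isotropicLaw, Measure.map_map U.continuous.measurable measurable_direction]
    have : U ∘ direction = direction ∘ U := by
      ext1 x
      exact (direction_map U x).symm
    rw [this, ← Measure.map_map measurable_direction U.continuous.measurable, map_channelLaw]
  norm_eq_one := by
    rw [isotropicLaw, ae_map_iff measurable_direction.aemeasurable
      (measurableSet_eq_fun measurable_norm measurable_const)]
    filter_upwards [channelLaw_ne_zero hL] with x hx using norm_direction hx
  notMem W hW := by
    have hm : MeasurableSet {x : CVec L | x ∉ W} :=
      W.closed_of_finiteDimensional.measurableSet.compl
    rw [isotropicLaw, ae_map_iff measurable_direction.aemeasurable hm]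
    filter_upwards [channelLaw_notMem hW] with x hx h
    refine hx ?_
    rw [← norm_smul_direction x]
    exact W.smul_mem _ h

/-- The law of the channel vector and the codebook of one user. -/
def userLaw (L r : ℕ) : Measure (CVec L × (Fin (2 ^ r) → CVec L)) :=
  (channelLaw L).prod (Measure.pi fun _ : Fin (2 ^ r) => isotropicLaw L)

instance (L r : ℕ) : IsProbabilityMeasure (userLaw L r) := by
  unfold userLaw
  infer_instance

/-- The law of the quantised channel of one user. -/
def quantizedLaw (L r : ℕ) : Measure (CVec L) := (userLaw L r).map fun y => quantize y.2 y.1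

instance (L r : ℕ) : IsProbabilityMeasure (quantizedLaw L r) :=
  Measure.isProbabilityMeasure_map measurable_quantize.aemeasurable

lemma ae_userLaw_codewords {L r : ℕ} {s : Set (CVec L)}
    (h : ∀ᵐ x ∂isotropicLaw L, x ∈ s) : ∀ᵐ y ∂userLaw L r, ∀ k, y.2 k ∈ s := by
  have h1 : ∀ k : Fin (2 ^ r), ∀ᵐ c ∂(Measure.pi fun _ : Fin (2 ^ r) => isotropicLaw L),
      c k ∈ s := fun k => (measurePreserving_eval (fun _ : Fin (2 ^ r) => isotropicLaw L)
        k).quasiMeasurePreserving.ae h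
  have h2 := ae_all_iff.2 h1
  exact (Measure.quasiMeasurePreserving_snd (μ := channelLaw L)).ae h2

lemma ae_userLaw_quantize {L r : ℕ} {s : Set (CVec L)}
    (h : ∀ᵐ x ∂isotropicLaw L, x ∈ s) : ∀ᵐ y ∂userLaw L r, quantize y.2 y.1 ∈ s := by
  filter_upwards [ae_userLaw_codewords (r := r) h] with y hy
  obtain ⟨k, hk⟩ := quantize_mem_range y.2 y.1
  rw [hk]
  exact hy k

/-- Quantisation commutes with unitary maps, so the quantised channel inherits the isotropy of the
channel and of the codebook. -/
lemma isIsotropic_quantizedLaw {L : ℕ} (hL : 0 < L) (r : ℕ) : IsIsotropic (quantizedLaw L r) where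
  map_eq U := by
    have hU : Measurable U := U.continuous.measurable
    have hUc : Measurable fun c : Fin (2 ^ r) → CVec L => fun k => U (c k) :=
      measurable_pi_lambda _ fun k => hU.comp (measurable_pi_apply k)
    rw [quantizedLaw, Measure.map_map hU measurable_quantize]
    have : (U ∘ fun y : CVec L × (Fin (2 ^ r) → CVec L) => quantize y.2 y.1) =
        (fun y : CVec L × (Fin (2 ^ r) → CVec L) => quantize y.2 y.1) ∘
          Prod.map U (fun c : Fin (2 ^ r) → CVec L => fun k => U (c k)) := by
      ext1 y
      exact (quantize_map U y.2 y.1).symm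
    rw [this, ← Measure.map_map measurable_quantize (hU.prodMap hUc)]
    congr 1
    rw [userLaw, ← Measure.map_prod_map _ _ hU hUc, map_channelLaw]
    congr 1
    have hp : ∀ k : Fin (2 ^ r), IsProbabilityMeasure ((isotropicLaw L).map U) := fun _ =>
      Measure.isProbabilityMeasure_map hU.aemeasurable
    rw [Measure.pi_map_pi fun _ => hU.aemeasurable]
    simp_rw [(isIsotropic_isotropicLaw hL).map_eq U]
  norm_eq_one := by
    rw [quantizedLaw, ae_map_iff measurable_quantize.aemeasurable
      (measurableSet_eq_fun measurable_norm measurable_const)]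
    exact ae_userLaw_quantize (s := {x | ‖x‖ = 1}) (isIsotropic_isotropicLaw hL).norm_eq_one
  notMem W hW := by
    have hm : MeasurableSet {x : CVec L | x ∉ W} :=
      W.closed_of_finiteDimensional.measurableSet.compl
    rw [quantizedLaw, ae_map_iff measurable_quantize.aemeasurable hm]
    exact ae_userLaw_quantize (s := {x | x ∉ W}) ((isIsotropic_isotropicLaw hL).notMem W hW)

/-! ### Separating one user from the others -/

lemma pi_userLaw_eq_map (L m : ℕ) (R : ℕ → ℕ) :
    (Measure.pi fun i : Fin m => userLaw L (R i)) =
      (sampleLaw L m R).map fun ω i => (ω.1 i, ω.2 i) := by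
  have hm : Measurable fun (ω : Sample L m R) (i : Fin m) => (ω.1 i, ω.2 i) := by fun_prop
  refine Measure.pi_eq_generateFrom (C := fun i : Fin m => Set.image2 (· ×ˢ ·)
    {s : Set (CVec L) | MeasurableSet s} {t : Set (Fin (2 ^ R i) → CVec L) | MeasurableSet t})
    (fun i => generateFrom_prod) (fun i => isPiSystem_prod)
    (fun i => ⟨fun _ => Set.univ, fun _ => ⟨Set.univ, by simp, Set.univ, by simp,
      Set.univ_prod_univ⟩, fun _ => by simp, Set.iUnion_const _⟩) ?_
  intro s hs
  choose a ha b hb hab using hs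
  have hset : (fun (ω : Sample L m R) (i : Fin m) => (ω.1 i, ω.2 i)) ⁻¹' Set.univ.pi s =
      (Set.univ.pi a) ×ˢ (Set.univ.pi b) := by
    ext ω
    simp only [Set.mem_preimage, Set.mem_univ_pi, ← hab, Set.mem_prod]
    exact forall_and
  have hsm : ∀ i, MeasurableSet (s i) := fun i => by
    rw [← hab i]
    exact (Set.mem_ofPred.1 (ha i)).prod (Set.mem_ofPred.1 (hb i))
  rw [Measure.map_apply hm (MeasurableSet.univ_pi hsm), hset, sampleLaw, Measure.prod_prod,
    Measure.pi_pi, Measure.pi_pi, ← Finset.prod_mul_distrib]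
  refine Finset.prod_congr rfl fun i _ => ?_
  rw [← hab i]
  dsimp only
  rw [userLaw, Measure.prod_prod]

/-- The data of user `i` and the quantised channels of the other users are independent. -/
lemma lintegral_sampleLaw {L m : ℕ} {R : ℕ → ℕ} (i : Fin m)
    {H : (CVec L × (Fin (2 ^ R i) → CVec L)) → (Fin m → CVec L) → ENNReal}
    (hH : Measurable (Function.uncurry H)) :
    ∫⁻ ω, H (ω.1 i, ω.2 i) (quantizedChannels ω) ∂sampleLaw L m R =
      ∫⁻ y, ∫⁻ x, H y (Function.update x i (quantize y.2 y.1))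
        ∂(Measure.pi fun j : Fin m => quantizedLaw L (R j)) ∂userLaw L (R i) := by
  set Q : (∀ j : Fin m, CVec L × (Fin (2 ^ R j) → CVec L)) → Fin m → CVec L :=
    fun z j => quantize (z j).2 (z j).1 with hQ
  have hQm : Measurable Q := measurable_pi_lambda _ fun j =>
    measurable_quantize.comp (measurable_pi_apply j)
  have hm : Measurable fun (ω : Sample L m R) (i : Fin m) => (ω.1 i, ω.2 i) := by fun_prop
  have hG : Measurable fun z : ∀ j : Fin m, CVec L × (Fin (2 ^ R j) → CVec L) => H (z i) (Q z) :=
    hH.comp ((measurable_pi_apply i).prodMk hQm)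
  have h1 : ∫⁻ ω, H (ω.1 i, ω.2 i) (quantizedChannels ω) ∂sampleLaw L m R =
      ∫⁻ z, H (z i) (Q z) ∂(Measure.pi fun i : Fin m => userLaw L (R i)) := by
    rw [pi_userLaw_eq_map, lintegral_map hG hm]
    rfl
  have hupd : Measurable fun w : (CVec L × (Fin (2 ^ R i) → CVec L)) × (Fin m → CVec L) =>
      Function.update w.2 i (quantize w.1.2 w.1.1) := by
    refine measurable_pi_lambda _ fun j => ?_
    by_cases hj : j = i
    · subst hj
      simp only [Function.update_self]
      exact measurable_quantize.comp measurable_fst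
    · simp only [Function.update_of_ne hj]
      exact (measurable_pi_apply j).comp measurable_snd
  have h2 : ∀ z y, H ((Function.update z i y : ∀ j : Fin m, CVec L × (Fin (2 ^ R j) → CVec L)) i)
      (Q (Function.update z i y)) = H y (Function.update (Q z) i (quantize y.2 y.1)) := by
    intro z y
    congr 1
    · simp
    · ext1 j
      by_cases hj : j = i
      · subst hj
        simp [hQ]
      · simp [hQ, hj]
  have hHu : Measurable fun w : (CVec L × (Fin (2 ^ R i) → CVec L)) × (Fin m → CVec L) =>
      H w.1 (Function.update w.2 i (quantize w.1.2 w.1.1)) :=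
    hH.comp (measurable_fst.prodMk hupd)
  rw [h1, lintegral_pi_update i hG]
  simp_rw [h2]
  rw [lintegral_lintegral_swap]
  · refine lintegral_congr fun y => ?_
    have hpi : (Measure.pi fun j : Fin m => quantizedLaw L (R j)) =
        (Measure.pi fun j : Fin m => userLaw L (R j)).map Q := by
      have hp : ∀ j : Fin m, IsProbabilityMeasure ((userLaw L (R j)).map
          (fun y : CVec L × (Fin (2 ^ R j) → CVec L) => quantize y.2 y.1)) := fun j =>
        Measure.isProbabilityMeasure_map measurable_quantize.aemeasurable
      exact (Measure.pi_map_pi (μ := fun j : Fin m => userLaw L (R j))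
        (f := fun j y => quantize y.2 y.1)
        fun j => measurable_quantize.aemeasurable).symm
    rw [hpi, lintegral_map _ hQm]
    exact hHu.comp (measurable_const.prodMk measurable_id)
  · exact (hHu.comp (measurable_snd.prodMk (hQm.comp measurable_fst))).aemeasurable

/-! ### General position -/

section GeneralPosition

variable {L m : ℕ} {ν : Fin m → Measure (CVec L)} [∀ j, IsProbabilityMeasure (ν j)]

lemma mem_span_iff_starProjection_eq_zero (K : Submodule ℂ (CVec L)) (x : CVec L) :
    x ∈ K ↔ Kᗮ.starProjection x = 0 := by
  rw [Submodule.starProjection_orthogonal_val, sub_eq_zero, eq_comm,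
    Submodule.starProjection_eq_self_iff]

lemma measurable_update_apply (i : Fin m) (p : CVec L) (j : Fin m) :
    Measurable fun x : Fin m → CVec L => Function.update x i p j :=
  (measurable_pi_apply j).comp measurable_update_left

lemma finrank_span_image_le (z : Fin m → CVec L) (S : Finset (Fin m)) :
    Module.finrank ℂ (Submodule.span ℂ (z '' (S : Set (Fin m)))) ≤ S.card := by
  classical
  rw [← Finset.coe_image]
  exact (finrank_span_finset_le_card _).trans Finset.card_image_le

/-- Independent isotropic vectors avoid the span of fewer than `L` others. -/
lemma ae_notMem_span (hν : ∀ j, IsIsotropic (ν j)) (i : Fin m) (p : CVec L) {j : Fin m}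
    (hji : j ≠ i) {S : Finset (Fin m)} (hjS : j ∉ S) (hS : S.card < L) :
    ∀ᵐ x ∂Measure.pi ν, x j ∉ Submodule.span ℂ (Function.update x i p '' (S : Set (Fin m))) := by
  have hmeas : MeasurableSet {x : Fin m → CVec L |
      x j ∉ Submodule.span ℂ (Function.update x i p '' (S : Set (Fin m)))} := by
    simp_rw [mem_span_iff_starProjection_eq_zero]
    exact (measurableSet_eq_fun (measurable_starProjection_orthogonal_span S
      (measurable_update_apply i p) (measurable_pi_apply j)) measurable_const).compl
  refine ae_pi_of_update j hmeas fun x => ?_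
  have himg : ∀ y, Function.update (Function.update x j y) i p '' (S : Set (Fin m)) =
      Function.update x i p '' (S : Set (Fin m)) := by
    intro y
    refine Set.image_congr fun k hk => ?_
    have hkj : k ≠ j := fun h => hjS (h ▸ hk)
    rw [Function.update_comm hji, Function.update_of_ne hkj]
  have hW : Submodule.span ℂ (Function.update x i p '' (S : Set (Fin m))) ≠ ⊤ := by
    intro h
    have h1 := finrank_span_image_le (Function.update x i p) S
    rw [h, finrank_top, finrank_euclideanSpace_fin] at h1
    omega
  filter_upwards [(hν j).notMem _ hW] with y hy
  rw [himg, Function.update_self]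
  exact hy

/-- At most `L` independent isotropic vectors, one of which may be replaced by a fixed non-zero
vector, are linearly independent: this is the dimension of their span. -/
lemma ae_finrank_span (hν : ∀ j, IsIsotropic (ν j)) (i : Fin m) (p : CVec L)
    {S : Finset (Fin m)} (hiS : i ∉ S) (hS : S.card ≤ L) :
    ∀ᵐ x ∂Measure.pi ν,
      Module.finrank ℂ (Submodule.span ℂ (Function.update x i p '' (S : Set (Fin m)))) =
        S.card := by
  classical
  have h1 : ∀ᵐ x ∂Measure.pi ν, ∀ j ∈ S,
      x j ∉ Submodule.span ℂ (Function.update x i p '' (S.erase j : Set (Fin m))) := by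
    refine (ae_ball_iff S.countable_toSet).2 fun j hj => ?_
    refine ae_notMem_span hν i p (fun h => hiS (h ▸ hj)) (Finset.notMem_erase j S) ?_
    rw [Finset.card_erase_of_mem hj]
    have := Finset.card_pos.2 ⟨j, hj⟩
    omega
  filter_upwards [h1] with x hx
  have hli : LinearIndependent ℂ (fun j : S => Function.update x i p j) := by
    rw [linearIndependent_iff_notMem_span]
    intro j hmem
    refine hx j j.2 ?_
    have hji : (j : Fin m) ≠ i := fun h => hiS (h ▸ j.2)
    rw [Function.update_of_ne hji] at hmem
    refine Submodule.span_mono ?_ hmem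
    rintro _ ⟨k, hk, rfl⟩
    refine ⟨k, ?_, rfl⟩
    have hkj : (k : Fin m) ≠ j := fun h => hk.2 (Subtype.ext h)
    exact Finset.mem_coe.2 (Finset.mem_erase.2 ⟨hkj, k.2⟩)
  have h2 := finrank_span_eq_card hli
  rw [Fintype.card_coe] at h2
  have h3 : Set.range (fun j : S => Function.update x i p j) =
      Function.update x i p '' (S : Set (Fin m)) := by
    ext y
    simp
  rw [← h2, h3]

end GeneralPosition

/-! ### Moments of the zero-forcing beams -/

/-- A bound on the variance, from the first two moments. -/
lemma lintegral_sub_sq_le {Ω : Type*} [MeasurableSpace Ω] {P : Measure Ω} [IsProbabilityMeasure P]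
    {S : Ω → ℝ} (hS : Measurable S) (hS0 : ∀ ω, 0 ≤ S ω) {μ e : ℝ} (hμ : 0 ≤ μ) (he : 0 ≤ e)
    (h1 : ∫⁻ ω, ENNReal.ofReal (S ω) ∂P = ENNReal.ofReal μ)
    (h2 : ∫⁻ ω, ENNReal.ofReal (S ω ^ 2) ∂P ≤ ENNReal.ofReal (μ ^ 2 + e)) :
    ∫⁻ ω, ENNReal.ofReal ((S ω - μ) ^ 2) ∂P ≤ ENNReal.ofReal e := by
  have hpt : ∀ ω, ENNReal.ofReal ((S ω - μ) ^ 2) + ENNReal.ofReal (2 * μ) * ENNReal.ofReal (S ω) =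
      ENNReal.ofReal (S ω ^ 2) + ENNReal.ofReal (μ ^ 2) := by
    intro ω
    have := hS0 ω
    rw [← ENNReal.ofReal_mul (by positivity), ← ENNReal.ofReal_add (by positivity) (by positivity),
      ← ENNReal.ofReal_add (by positivity) (by positivity)]
    congr 1
    ring
  have h3 := lintegral_congr (μ := P) hpt
  rw [lintegral_add_right _ (by fun_prop), lintegral_add_right _ (by fun_prop),
    lintegral_const_mul _ (by fun_prop), h1] at h3
  simp only [lintegral_const, measure_univ, mul_one] at h3
  have h4 := h3.le.trans (add_le_add_left h2 _)
  rw [← ENNReal.ofReal_mul (by positivity), ← ENNReal.ofReal_add (by positivity) (by positivity),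
    show μ ^ 2 + e + μ ^ 2 = e + 2 * μ * μ by ring, ENNReal.ofReal_add he (by positivity)] at h4
  exact ENNReal.le_of_add_le_add_right ENNReal.ofReal_ne_top h4

section Beams

variable {L m : ℕ} {ν : Fin m → Measure (CVec L)} [∀ j, IsProbabilityMeasure (ν j)]
  {A : Finset (Fin m)} {i : Fin m} {p : CVec L}

lemma map_pi_unitary (hν : ∀ j, IsIsotropic (ν j)) (U : CVec L ≃ₗᵢ[ℂ] CVec L) :
    (Measure.pi ν).map (fun x j => U (x j)) = Measure.pi ν := by
  have hU : Measurable U := U.continuous.measurable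
  have hp : ∀ j, IsProbabilityMeasure ((ν j).map U) := fun _ =>
    Measure.isProbabilityMeasure_map hU.aemeasurable
  rw [Measure.pi_map_pi fun _ => hU.aemeasurable]
  simp_rw [(hν _).map_eq U]

lemma measurable_pi_unitary (U : CVec L ≃ₗᵢ[ℂ] CVec L) :
    Measurable fun (x : Fin m → CVec L) j => U (x j) :=
  measurable_pi_lambda _ fun j => U.continuous.measurable.comp (measurable_pi_apply j)

lemma measurable_zfBeam_update (A : Finset (Fin m)) (i : Fin m) (p : CVec L) :
    Measurable fun (x : Fin m → CVec L) j => zfBeam A (Function.update x i p) j :=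
  measurable_pi_lambda _ fun j => (measurable_zfBeam A j).comp measurable_update_left

/-- Given the codeword `p` of user `i`, the joint law of all beams is invariant under the unitary
maps that fix `p`. -/
lemma rotationInvariant_zfBeam (hν : ∀ j, IsIsotropic (ν j)) (A : Finset (Fin m)) (i : Fin m)
    (p : CVec L) : RotationInvariant (Submodule.span ℂ {p})ᗮ (Measure.pi ν)
      (fun x j => zfBeam A (Function.update x i p) j) := by
  intro U hU
  have hUp : U p = p :=
    hU p (Submodule.le_orthogonal_orthogonal _ (Submodule.mem_span_singleton_self p))
  have h1 : (fun (x : Fin m → CVec L) j => U (zfBeam A (Function.update x i p) j)) =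
      (fun x j => zfBeam A (Function.update x i p) j) ∘ fun x j => U (x j) := by
    ext1 x
    ext1 j
    dsimp only [Function.comp]
    rw [← zfBeam_map]
    congr 1
    ext1 k
    by_cases hk : k = i
    · subst hk
      simp [hUp]
    · simp [hk]
  rw [h1, ← Measure.map_map (measurable_zfBeam_update A i p) (measurable_pi_unitary U),
    map_pi_unitary hν]

lemma zfBeam_mem_orthogonal (hi : i ∈ A) {j : Fin m} (hj : j ∈ A.erase i) (x : Fin m → CVec L) :
    zfBeam A (Function.update x i p) j ∈ (Submodule.span ℂ {p})ᗮ := by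
  rw [Submodule.mem_orthogonal_singleton_iff_inner_right]
  have h := inner_zfBeam_eq_zero (Function.update x i p) (A := A) (i := j) (j := i)
    (Finset.mem_erase.2 ⟨(Finset.ne_of_mem_erase hj).symm, hi⟩)
  rwa [Function.update_self] at h

lemma ae_norm_zfBeam (hν : ∀ j, IsIsotropic (ν j)) (p : CVec L) (hA : A.card ≤ L) {j : Fin m}
    (hj : j ∈ A.erase i) :
    ∀ᵐ x ∂Measure.pi ν, ‖zfBeam A (Function.update x i p) j‖ = 1 := by
  have hji := Finset.ne_of_mem_erase hj
  have hjA := Finset.mem_of_mem_erase hj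
  have hcard : (A.erase j).card < L := by
    rw [Finset.card_erase_of_mem hjA]
    have := Finset.card_pos.2 ⟨j, hjA⟩
    omega
  filter_upwards [ae_notMem_span hν i p hji (Finset.notMem_erase j A) hcard] with x hx
  refine norm_zfBeam ?_
  rwa [Function.update_of_ne hji]

lemma finrank_orthogonal_singleton {p : CVec L} (hp : p ≠ 0) :
    (Module.finrank ℂ (Submodule.span ℂ {p} : Submodule ℂ (CVec L))ᗮ : ℝ) = (L : ℝ) - 1 := by
  have h := (Submodule.span ℂ {p}).finrank_add_finrank_orthogonal
  rw [finrank_span_singleton hp, finrank_euclideanSpace_fin] at h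
  have h2 : ((1 + Module.finrank ℂ (Submodule.span ℂ {p} : Submodule ℂ (CVec L))ᗮ : ℕ) : ℝ) = L := by
    exact_mod_cast h
  push_cast at h2
  linarith

/-- The correlation of two beams has mean square `1 / (L - s + 2)` or less: given the other
quantised channels, the projection of the first one on their orthogonal complement is rotation
invariant. -/
lemma lintegral_inner_zfBeam_zfBeam_le (hν : ∀ j, IsIsotropic (ν j)) (p : CVec L)
    (hA : A.card ≤ L) {j k : Fin m} (hj : j ∈ A.erase i) (hk : k ∈ A.erase i) (hjk : j ≠ k) :
    ∫⁻ x, ENNReal.ofReal (‖inner ℂ (zfBeam A (Function.update x i p) j)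
      (zfBeam A (Function.update x i p) k)‖ ^ 2) ∂Measure.pi ν ≤
        ENNReal.ofReal (1 / (L - A.card + 2)) := by
  have hji := Finset.ne_of_mem_erase hj
  have hjA := Finset.mem_of_mem_erase hj
  have hkA := Finset.mem_of_mem_erase hk
  set S := (A.erase j).erase k with hS
  set Z : (Fin m → CVec L) → Fin m → CVec L := fun x => Function.update x i p with hZ
  set V : (Fin m → CVec L) → Submodule ℂ (CVec L) := fun x =>
    (Submodule.span ℂ (Z x '' (S : Set (Fin m))))ᗮ with hV
  have hVm : ∀ l, Measurable fun x => direction ((V x).starProjection (Z x l)) := fun l =>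
    measurable_direction.comp (measurable_starProjection_orthogonal_span S
      (measurable_update_apply i p) (measurable_update_apply i p l))
  calc _ ≤ ∫⁻ x, ENNReal.ofReal (‖inner ℂ (direction ((V x).starProjection (Z x j)))
        (direction ((V x).starProjection (Z x k)))‖ ^ 2) ∂Measure.pi ν := by
        refine lintegral_mono fun x => ENNReal.ofReal_le_ofReal ?_
        exact pow_le_pow_left₀ (norm_nonneg _)
          (norm_inner_zfBeam_zfBeam_le (Z x) hjA hkA hjk rfl) 2
    _ = ∫⁻ x, ∫⁻ y, ENNReal.ofReal (‖inner ℂ (direction ((V x).starProjection y))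
        (direction ((V x).starProjection (Z x k)))‖ ^ 2) ∂ν j ∂Measure.pi ν := by
        rw [lintegral_pi_update j (((hVm j).inner (hVm k)).norm.pow_const 2).ennreal_ofReal]
        refine lintegral_congr fun x => lintegral_congr fun y => ?_
        have h1 : ∀ l, l ≠ j → Z (Function.update x j y) l = Z x l := by
          intro l hl
          rw [hZ]
          dsimp only
          rw [Function.update_comm hji, Function.update_of_ne hl]
        have h2 : Z (Function.update x j y) j = y := by
          rw [hZ]
          dsimp only
          rw [Function.update_of_ne hji, Function.update_self]
        have h3 : ∀ w, (V (Function.update x j y)).starProjection w = (V x).starProjection w := by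
          refine starProjection_orthogonal_congr (congrArg (Submodule.span ℂ)
            (Set.image_congr fun l hl => h1 l ?_))
          rintro rfl
          simp [hS] at hl
        rw [h2, h1 k hjk.symm, h3, h3]
    _ ≤ ∫⁻ _, ENNReal.ofReal (1 / (L - A.card + 2)) ∂Measure.pi ν := by
        refine lintegral_mono fun x => ?_
        have hmem : direction ((V x).starProjection (Z x k)) ∈ V x :=
          direction_mem ((V x).starProjection_apply_mem _)
        by_cases h0 : (V x).starProjection (Z x k) = 0
        · simp [h0, direction]
        -- given the other channels, the law of the projection of the channel of user `j` on `V x`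
        -- is rotation invariant
        have hrot : RotationInvariant (V x) (ν j)
            (fun y (_ : Unit) => direction ((V x).starProjection y)) := by
          intro U hU
          have hcomm : ∀ y, (V x).starProjection (U y) = U ((V x).starProjection y) := by
            intro y
            refine Submodule.eq_starProjection_of_mem_orthogonal ?_ ?_
            · refine (V x).orthogonal_orthogonal.le ((Submodule.mem_orthogonal _ _).2 ?_)
              intro w hw
              rw [← hU w hw, U.inner_map_map]
              exact Submodule.inner_left_of_mem_orthogonal ((V x).starProjection_apply_mem y) hw
            · rw [← map_sub, hU _ ((V x).sub_starProjection_mem_orthogonal y)]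
              exact (V x).sub_starProjection_mem_orthogonal y
          have hUm : Measurable U := U.continuous.measurable
          have hd : Measurable fun y => (fun _ : Unit => direction ((V x).starProjection y)) :=
            measurable_pi_lambda _ fun _ =>
              measurable_direction.comp (V x).starProjection.continuous.measurable
          have h1 : (fun y (_ : Unit) => U (direction ((V x).starProjection y))) =
              (fun y (_ : Unit) => direction ((V x).starProjection y)) ∘ U := by
            ext1 y
            ext1
            dsimp only [Function.comp]
            rw [hcomm, direction_map]
          rw [h1, ← Measure.map_map hd hUm, (hν j).map_eq U]
        have h1 := hrot.lintegral_inner_sq_le (j := ())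
          (measurable_pi_lambda _ fun _ =>
            measurable_direction.comp (V x).starProjection.continuous.measurable)
          (Eventually.of_forall fun y => norm_direction_le_one _) hmem (norm_direction h0)
        have hcard : S.card + 2 = A.card := by
          have h2 := Finset.card_erase_of_mem hjA
          have hk' : k ∈ A.erase j := Finset.mem_erase.2 ⟨hjk.symm, hkA⟩
          have h3 : S.card = (A.erase j).card - 1 := Finset.card_erase_of_mem hk'
          have h4 : 0 < (A.erase j).card := Finset.card_pos.2 ⟨k, hk'⟩
          have h5 := Finset.card_pos.2 ⟨j, hjA⟩
          omega
        have hfin : (L : ℝ) - A.card + 2 ≤ Module.finrank ℂ (V x) := by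
          have h2 : Module.finrank ℂ (Submodule.span ℂ (Z x '' (S : Set (Fin m)))) +
              Module.finrank ℂ (V x) = L :=
            (Submodule.finrank_add_finrank_orthogonal _).trans finrank_euclideanSpace_fin
          have h3 := finrank_span_image_le (Z x) S
          have h4 : L + 2 ≤ Module.finrank ℂ (V x) + A.card := by
            omega
          have h5 : (L : ℝ) + 2 ≤ Module.finrank ℂ (V x) + A.card := by exact_mod_cast h4
          linarith
        have hpos : (0 : ℝ) < (L : ℝ) - A.card + 2 := by
          have : (A.card : ℝ) ≤ L := by exact_mod_cast hA
          linarith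
        rw [one_div, ENNReal.ofReal_inv_of_pos hpos, ← one_div,
          ENNReal.le_div_iff_mul_le (Or.inl (by simpa using hpos)) (Or.inl (by simp)), mul_comm]
        refine le_trans (mul_le_mul_left ?_ _) h1
        rw [← ENNReal.ofReal_natCast]
        exact ENNReal.ofReal_le_ofReal hfin
    _ = _ := by simp

end Beams

section Beams

variable {L m : ℕ} {ν : Fin m → Measure (CVec L)} [∀ j, IsProbabilityMeasure (ν j)]
  {A : Finset (Fin m)} {i : Fin m} {p : CVec L}

lemma norm_inner_eq_norm_mul_direction (q e : CVec L) :
    ‖inner ℂ q e‖ = ‖e‖ * ‖inner ℂ q (direction e)‖ := by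
  conv_lhs => rw [← norm_smul_direction e]
  rw [inner_smul_right, norm_mul, Complex.norm_real, norm_norm]

lemma natCast_finrank_orthogonal_singleton (hp : ‖p‖ = 1) :
    (Module.finrank ℂ (Submodule.span ℂ {p} : Submodule ℂ (CVec L))ᗮ : ENNReal) =
      ENNReal.ofReal ((L : ℝ) - 1) := by
  have hp0 : p ≠ 0 := by rintro rfl; simp at hp
  rw [← finrank_orthogonal_singleton hp0, ENNReal.ofReal_natCast]

lemma ofReal_le_of_mul_le {a b : ℝ} (ha : 0 < a) {x : ENNReal}
    (h : ENNReal.ofReal a * x ≤ ENNReal.ofReal b) : x ≤ ENNReal.ofReal (b / a) := by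
  rw [ENNReal.ofReal_div_of_pos ha,
    ENNReal.le_div_iff_mul_le (Or.inl (by simpa using ha)) (Or.inl (by simp)), mul_comm]
  exact h

/-- The part of the signal that comes from the quantisation error is negligible. -/
lemma lintegral_inner_zfBeam_sq_le (hν : ∀ j, IsIsotropic (ν j)) (hp : ‖p‖ = 1) (hL : 2 ≤ L)
    (A : Finset (Fin m)) (i j : Fin m) {e : CVec L} (he : e ∈ (Submodule.span ℂ {p})ᗮ) :
    ∫⁻ x, ENNReal.ofReal (‖inner ℂ (zfBeam A (Function.update x i p) j) e‖ ^ 2) ∂Measure.pi ν ≤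
      ENNReal.ofReal (‖e‖ ^ 2 / (L - 1)) := by
  by_cases he0 : e = 0
  · simp [he0]
  have hL1 : (0 : ℝ) < (L : ℝ) - 1 := by
    have : (2 : ℝ) ≤ L := by exact_mod_cast hL
    linarith
  have h := (rotationInvariant_zfBeam hν A i p).lintegral_inner_sq_le
    (measurable_zfBeam_update A i p) (j := j) (Eventually.of_forall fun x => norm_zfBeam_le_one _ _ _)
    (direction_mem he) (norm_direction he0)
  rw [natCast_finrank_orthogonal_singleton hp] at h
  simp_rw [norm_inner_eq_norm_mul_direction _ e, mul_pow]
  have hm : Measurable fun x : Fin m → CVec L => ENNReal.ofReal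
      (‖inner ℂ (zfBeam A (Function.update x i p) j) (direction e)‖ ^ 2) :=
    (((((measurable_pi_apply j).comp (measurable_zfBeam_update A i p)).inner
      measurable_const).norm).pow_const 2).ennreal_ofReal
  simp_rw [ENNReal.ofReal_mul (sq_nonneg ‖e‖)]
  rw [lintegral_const_mul _ hm, div_eq_mul_one_div, ENNReal.ofReal_mul (by positivity)]
  refine mul_le_mul_right (ofReal_le_of_mul_le hL1 ?_) _
  simpa using h

/-- The leakage of a single beam is not too small: its inverse modulus has bounded mean. This keeps
the ratio under control when the path gain is large. -/
lemma lintegral_inner_zfBeam_inv_le (hν : ∀ j, IsIsotropic (ν j)) (hA : A.card ≤ L)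
    (hi : i ∈ A) {j : Fin m} (hj : j ∈ A.erase i) {e : CVec L} (he : e ∈ (Submodule.span ℂ {p})ᗮ)
    (he0 : e ≠ 0) :
    ∫⁻ x, (ENNReal.ofReal ‖inner ℂ (zfBeam A (Function.update x i p) j) e‖)⁻¹ ∂Measure.pi ν ≤
      ENNReal.ofReal (√Real.pi * √L / ‖e‖) := by
  have hn : 0 < ‖e‖ := norm_pos_iff.2 he0
  have h := (rotationInvariant_zfBeam hν A i p).lintegral_inner_inv_le
    (measurable_zfBeam_update A i p) (j := j) (ae_norm_zfBeam hν p hA hj)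
    (Eventually.of_forall fun x => zfBeam_mem_orthogonal hi hj x)
    (direction_mem he) (norm_direction he0)
  simp_rw [norm_inner_eq_norm_mul_direction _ e, ENNReal.ofReal_mul (norm_nonneg e)]
  have hm : Measurable fun x : Fin m → CVec L => (ENNReal.ofReal
      ‖inner ℂ (zfBeam A (Function.update x i p) j) (direction e)‖)⁻¹ :=
    ((((measurable_pi_apply j).comp (measurable_zfBeam_update A i p)).inner
      measurable_const).norm).ennreal_ofReal.inv
  have hmul : ∀ y : ENNReal, (ENNReal.ofReal ‖e‖ * y)⁻¹ = (ENNReal.ofReal ‖e‖)⁻¹ * y⁻¹ := fun y =>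
    ENNReal.mul_inv (Or.inl (by simpa using he0)) (Or.inl (by simp))
  simp_rw [hmul]
  rw [lintegral_const_mul _ hm, div_eq_mul_inv, ENNReal.ofReal_mul (by positivity), mul_comm,
    ENNReal.ofReal_inv_of_pos hn]
  exact mul_le_mul_left h _

/-- The interference concentrates around its mean. -/
lemma lintegral_interference_sub_sq_le (hν : ∀ j, IsIsotropic (ν j)) (hp : ‖p‖ = 1) (hL : 2 ≤ L)
    (hA : A.card ≤ L) (hi : i ∈ A) {e : CVec L} (he : e ∈ (Submodule.span ℂ {p})ᗮ) :
    ∫⁻ x, ENNReal.ofReal ((∑ j ∈ A.erase i, ‖inner ℂ (zfBeam A (Function.update x i p) j) e‖ ^ 2 -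
        ‖e‖ ^ 2 * ((A.card - 1) / (L - 1))) ^ 2) ∂Measure.pi ν ≤
      ENNReal.ofReal (‖e‖ ^ 4 * ((A.card + A.card ^ 2 / (L - A.card + 2)) / (L - 1) ^ 2)) := by
  by_cases he0 : e = 0
  · simp [he0]
  have hL1 : (0 : ℝ) < (L : ℝ) - 1 := by
    have : (2 : ℝ) ≤ L := by exact_mod_cast hL
    linarith
  have hApos : 1 ≤ A.card := Finset.card_pos.2 ⟨i, hi⟩
  have hA1 : (0 : ℝ) ≤ (A.card : ℝ) - 1 := by
    have : (1 : ℝ) ≤ A.card := by exact_mod_cast hApos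
    linarith
  have hdpos : (0 : ℝ) < (L : ℝ) - A.card + 2 := by
    have : (A.card : ℝ) ≤ L := by exact_mod_cast hA
    linarith
  have hcard : ((A.erase i).card : ℝ) = A.card - 1 := by
    rw [Finset.card_erase_of_mem hi, Nat.cast_sub hApos, Nat.cast_one]
  set u := direction e with hu
  have huV : u ∈ (Submodule.span ℂ {p})ᗮ := direction_mem he
  have hu1 : ‖u‖ = 1 := norm_direction he0
  set q : (Fin m → CVec L) → Fin m → CVec L := fun x j => zfBeam A (Function.update x i p) j with hq
  have hqm : Measurable q := measurable_zfBeam_update A i p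
  have hqj : ∀ j, Measurable fun x => q x j := fun j => (measurable_pi_apply j).comp hqm
  have hrot : RotationInvariant (Submodule.span ℂ {p})ᗮ (Measure.pi ν) q :=
    rotationInvariant_zfBeam hν A i p
  have hunit : ∀ j ∈ A.erase i, ∀ᵐ x ∂Measure.pi ν, ‖q x j‖ = 1 := fun j hj =>
    ae_norm_zfBeam hν p hA hj
  have hV : ∀ j ∈ A.erase i, ∀ᵐ x ∂Measure.pi ν, q x j ∈ (Submodule.span ℂ {p})ᗮ := fun j hj =>
    Eventually.of_forall fun x => zfBeam_mem_orthogonal hi hj x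
  have hp0 : p ≠ 0 := by rintro rfl; simp at hp
  set S : (Fin m → CVec L) → ℝ := fun x => ∑ j ∈ A.erase i, ‖inner ℂ (q x j) u‖ ^ 2 with hS
  have hSm : Measurable S := Finset.measurable_sum _ fun j _ =>
    (((hqj j).inner measurable_const).norm).pow_const 2
  set B : ℝ := (A.card + A.card ^ 2 / (L - A.card + 2)) / (L - 1) ^ 2 with hB
  have hB0 : 0 ≤ B := by positivity
  -- each of the `s - 1` other beams has mean energy `1 / (L - 1)` in the direction of `e`
  have hfirst : ∫⁻ x, ENNReal.ofReal (S x) ∂Measure.pi ν =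
      ENNReal.ofReal ((A.card - 1) / (L - 1)) := by
    have h1 : ∀ j ∈ A.erase i, ∫⁻ x, ENNReal.ofReal (‖inner ℂ (q x j) u‖ ^ 2) ∂Measure.pi ν =
        ENNReal.ofReal (1 / (L - 1)) := by
      intro j hj
      have h := hrot.lintegral_inner_sq_eq hqm (hunit j hj) (hV j hj) huV hu1
      rw [natCast_finrank_orthogonal_singleton hp] at h
      rw [one_div, ENNReal.ofReal_inv_of_pos hL1]
      exact ENNReal.eq_inv_of_mul_eq_one_left (by rwa [mul_comm])
    rw [lintegral_congr fun x => ENNReal.ofReal_sum_of_nonneg fun j _ => by positivity,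
      lintegral_finsetSum _ fun j _ =>
        ((((hqj j).inner measurable_const).norm).pow_const 2).ennreal_ofReal,
      Finset.sum_congr rfl h1, Finset.sum_const, nsmul_eq_mul, ← ENNReal.ofReal_natCast,
      ← ENNReal.ofReal_mul (by positivity), hcard]
    congr 1
    ring
  -- the second moment is governed by the pair correlations of the beams, small off the diagonal
  have hsecond : ∫⁻ x, ENNReal.ofReal (S x ^ 2) ∂Measure.pi ν ≤
      ENNReal.ofReal (((A.card - 1) / (L - 1)) ^ 2 + B) := by
    have h := hrot.lintegral_sum_sq_le hqm hunit hV huV hu1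
    rw [finrank_orthogonal_singleton hp0] at h
    have hcorr : ∫⁻ x, ENNReal.ofReal (∑ j ∈ A.erase i, ∑ k ∈ A.erase i,
        (1 + ‖inner ℂ (q x j) (q x k)‖ ^ 2)) ∂Measure.pi ν ≤
        ENNReal.ofReal ((A.card - 1) ^ 2 + (A.card + A.card ^ 2 / (L - A.card + 2))) := by
      have hjk : ∀ j ∈ A.erase i, ∀ k ∈ A.erase i,
          ∫⁻ x, ENNReal.ofReal (1 + ‖inner ℂ (q x j) (q x k)‖ ^ 2) ∂Measure.pi ν ≤
            ENNReal.ofReal (1 + ((if j = k then 1 else 0) + 1 / (L - A.card + 2))) := by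
        intro j hj k hk
        have h0 : ∫⁻ x, ENNReal.ofReal (‖inner ℂ (q x j) (q x k)‖ ^ 2) ∂Measure.pi ν ≤
            ENNReal.ofReal ((if j = k then 1 else 0) + 1 / (L - A.card + 2)) := by
          split_ifs with hjk
          · calc _ ≤ ∫⁻ _, 1 ∂Measure.pi ν := by
                  refine lintegral_mono fun x => ?_
                  rw [← ENNReal.ofReal_one]
                  refine ENNReal.ofReal_le_ofReal (pow_le_one₀ (norm_nonneg _) ?_)
                  exact (norm_inner_le_norm _ _).trans (mul_le_one₀ (norm_zfBeam_le_one _ _ _)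
                    (norm_nonneg _) (norm_zfBeam_le_one _ _ _))
              _ = ENNReal.ofReal 1 := by simp
              _ ≤ _ := ENNReal.ofReal_le_ofReal (le_add_of_nonneg_right (by positivity))
          · rw [zero_add]
            exact lintegral_inner_zfBeam_zfBeam_le hν p hA hj hk hjk
        calc _ = ∫⁻ x, (ENNReal.ofReal 1 + ENNReal.ofReal (‖inner ℂ (q x j) (q x k)‖ ^ 2))
                ∂Measure.pi ν :=
              lintegral_congr fun x => ENNReal.ofReal_add zero_le_one (by positivity)
          _ = ENNReal.ofReal 1 + ∫⁻ x, ENNReal.ofReal (‖inner ℂ (q x j) (q x k)‖ ^ 2)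
                ∂Measure.pi ν := by
              rw [lintegral_add_left measurable_const]
              simp
          _ ≤ _ := by
              rw [ENNReal.ofReal_add zero_le_one (by positivity)]
              exact add_le_add_right h0 _
      have hmjk : ∀ j k, Measurable fun x => ENNReal.ofReal (1 + ‖inner ℂ (q x j) (q x k)‖ ^ 2) :=
        fun j k => (measurable_const.add
          ((((hqj j).inner (hqj k)).norm).pow_const 2)).ennreal_ofReal
      calc _ = ∑ j ∈ A.erase i, ∑ k ∈ A.erase i,
            ∫⁻ x, ENNReal.ofReal (1 + ‖inner ℂ (q x j) (q x k)‖ ^ 2) ∂Measure.pi ν := by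
            rw [lintegral_congr fun x => ENNReal.ofReal_sum_of_nonneg fun j _ =>
              Finset.sum_nonneg fun k _ => by positivity]
            simp_rw [fun x j => ENNReal.ofReal_sum_of_nonneg (s := A.erase i)
              (f := fun k => 1 + ‖inner ℂ (q x j) (q x k)‖ ^ 2) fun k _ => by positivity]
            rw [lintegral_finsetSum _ fun j _ => Finset.measurable_sum _ fun k _ => hmjk j k]
            exact Finset.sum_congr rfl fun j _ => lintegral_finsetSum _ fun k _ => hmjk j k
        _ ≤ ∑ j ∈ A.erase i, ∑ k ∈ A.erase i,
            ENNReal.ofReal (1 + ((if j = k then 1 else 0) + 1 / (L - A.card + 2))) :=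
            Finset.sum_le_sum fun j hj => Finset.sum_le_sum fun k hk => hjk j hj k hk
        _ = ENNReal.ofReal (∑ j ∈ A.erase i, ∑ k ∈ A.erase i,
            (1 + ((if j = k then 1 else 0) + 1 / (L - A.card + 2)))) := by
            rw [ENNReal.ofReal_sum_of_nonneg fun j _ => Finset.sum_nonneg fun k _ => by positivity]
            refine Finset.sum_congr rfl fun j _ => ?_
            rw [ENNReal.ofReal_sum_of_nonneg fun k _ => by positivity]
        _ ≤ _ := by
            refine ENNReal.ofReal_le_ofReal ?_
            have e1 : ∑ j ∈ A.erase i, ∑ k ∈ A.erase i,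
                ((1 : ℝ) + ((if j = k then 1 else 0) + 1 / (L - A.card + 2))) =
                (A.card - 1) ^ 2 + ((A.card - 1) + (A.card - 1) ^ 2 / (L - A.card + 2)) := by
              simp only [Finset.sum_add_distrib, Finset.sum_const, nsmul_eq_mul, hcard,
                Finset.sum_ite_eq, Finset.sum_ite_mem, Finset.inter_self]
              ring
            rw [e1]
            have e2 : ((A.card : ℝ) - 1) ^ 2 / (L - A.card + 2) ≤
                (A.card : ℝ) ^ 2 / (L - A.card + 2) := by
              refine div_le_div_of_nonneg_right (pow_le_pow_left₀ hA1 (by linarith) 2) hdpos.le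
            linarith
    have h2 := ofReal_le_of_mul_le (by positivity) (h.trans hcorr)
    refine h2.trans (le_of_eq ?_)
    congr 1
    rw [hB, add_div, div_pow]
  have hvar := lintegral_sub_sq_le hSm (fun x => Finset.sum_nonneg fun j _ => by positivity)
    (by positivity) hB0 hfirst hsecond
  calc _ = ∫⁻ x, ENNReal.ofReal (‖e‖ ^ 4) * ENNReal.ofReal ((S x - (A.card - 1) / (L - 1)) ^ 2)
        ∂Measure.pi ν := by
        refine lintegral_congr fun x => ?_
        rw [← ENNReal.ofReal_mul (by positivity)]
        congr 1
        have : ∑ j ∈ A.erase i, ‖inner ℂ (zfBeam A (Function.update x i p) j) e‖ ^ 2 =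
            ‖e‖ ^ 2 * S x := by
          rw [hS, Finset.mul_sum]
          refine Finset.sum_congr rfl fun j _ => ?_
          rw [norm_inner_eq_norm_mul_direction _ e, mul_pow]
        rw [this]
        ring
    _ = ENNReal.ofReal (‖e‖ ^ 4) *
          ∫⁻ x, ENNReal.ofReal ((S x - (A.card - 1) / (L - 1)) ^ 2) ∂Measure.pi ν :=
        lintegral_const_mul _ (by fun_prop)
    _ ≤ ENNReal.ofReal (‖e‖ ^ 4) * ENNReal.ofReal B := mul_le_mul_right hvar _
    _ = _ := by rw [← ENNReal.ofReal_mul (by positivity)]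

end Beams

section Projection

variable {L m : ℕ} {ν : Fin m → Measure (CVec L)} [∀ j, IsProbabilityMeasure (ν j)]
  {A : Finset (Fin m)} {i : Fin m}

/-- The orthogonal complement of the quantised channels of the users in `A` other than `i`. -/
def interferenceFree {L m : ℕ} (A : Finset (Fin m)) (i : Fin m) (x : Fin m → CVec L) :
    Submodule ℂ (CVec L) := (Submodule.span ℂ (x '' (A.erase i : Set (Fin m))))ᗮ

lemma interferenceFree_update (A : Finset (Fin m)) (i : Fin m) (x : Fin m → CVec L) (p : CVec L) :
    interferenceFree A i (Function.update x i p) = interferenceFree A i x := by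
  rw [interferenceFree, interferenceFree]
  congr 2
  refine Set.image_congr fun j hj => Function.update_of_ne ?_ _ _
  exact Finset.ne_of_mem_erase (Finset.mem_coe.1 hj)

lemma measurable_starProjection_interferenceFree (A : Finset (Fin m)) (i : Fin m) :
    Measurable fun z : CVec L × (Fin m → CVec L) =>
      (interferenceFree A i z.2).starProjection z.1 :=
  measurable_starProjection_orthogonal_span (p := fun z : CVec L × (Fin m → CVec L) => z.2)
    (A.erase i) (fun j => (measurable_pi_apply j).comp measurable_snd) measurable_fst

lemma measurable_starProjection_interferenceFree_const (A : Finset (Fin m)) (i : Fin m)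
    (v : CVec L) : Measurable fun x : Fin m → CVec L => (interferenceFree A i x).starProjection v :=
  measurable_starProjection_orthogonal_span (p := fun x : Fin m → CVec L => x)
    (A.erase i) measurable_pi_apply measurable_const

lemma starProjection_interferenceFree_map (U : CVec L ≃ₗᵢ[ℂ] CVec L) (x : Fin m → CVec L)
    (v : CVec L) : (interferenceFree A i fun j => U (x j)).starProjection (U v) =
      U ((interferenceFree A i x).starProjection v) := by
  have h : (Submodule.span ℂ ((fun j => U (x j)) '' (A.erase i : Set (Fin m)))) =
      (Submodule.span ℂ (x '' (A.erase i : Set (Fin m)))).map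
        (U.toLinearEquiv : CVec L →ₗ[ℂ] CVec L) := by
    rw [Submodule.map_span, Set.image_image]
    rfl
  refine (starProjection_orthogonal_congr h _).trans ?_
  refine (Submodule.starProjection_orthogonal_val _).trans ?_
  rw [Submodule.starProjection_map_apply, U.symm_apply_apply, ← map_sub]
  exact congrArg U (Submodule.starProjection_orthogonal_val _).symm

lemma ae_finrank_interferenceFree (hν : ∀ j, IsIsotropic (ν j)) (hA : A.card ≤ L) (hi : i ∈ A) :
    ∀ᵐ x ∂Measure.pi ν, (Module.finrank ℂ (interferenceFree A i x) : ℝ) = L - A.card + 1 := by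
  have hpos : 1 ≤ A.card := Finset.card_pos.2 ⟨i, hi⟩
  have hc : (A.erase i).card = A.card - 1 := Finset.card_erase_of_mem hi
  filter_upwards [ae_finrank_span hν i 0 (Finset.notMem_erase i A)
    (by rw [hc]; omega)] with x hx
  rw [← interferenceFree_update A i x 0]
  have h2 : Module.finrank ℂ (Submodule.span ℂ
      (Function.update x i 0 '' (A.erase i : Set (Fin m)))) +
      Module.finrank ℂ (interferenceFree A i (Function.update x i 0)) = L :=
    (Submodule.finrank_add_finrank_orthogonal _).trans finrank_euclideanSpace_fin
  have h3 : Module.finrank ℂ (interferenceFree A i (Function.update x i 0)) + A.card = L + 1 := by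
    rw [hx] at h2
    omega
  have h4 : (Module.finrank ℂ (interferenceFree A i (Function.update x i 0)) : ℝ) + A.card =
      L + 1 := by exact_mod_cast h3
  linarith

/-- The moments of the length of the projection of a fixed vector on the random space
`interferenceFree A i x` are, up to normalisation, those of the projection of a Gaussian vector. -/
lemma lintegral_starProjection_pow (hν : ∀ j, IsIsotropic (ν j)) (A : Finset (Fin m)) (i : Fin m)
    {v : CVec L} (hv : ‖v‖ = 1) (k : ℕ) :
    (∫⁻ g, ENNReal.ofReal (‖g‖ ^ k) ∂channelLaw L) *
        ∫⁻ x, ENNReal.ofReal (‖(interferenceFree A i x).starProjection v‖ ^ k) ∂Measure.pi ν =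
      ∫⁻ x, ∫⁻ g, ENNReal.ofReal (‖(interferenceFree A i x).starProjection g‖ ^ k) ∂channelLaw L
        ∂Measure.pi ν := by
  have hΦ : Measurable (Function.uncurry fun (e : CVec L) (x : Fin m → CVec L) =>
      ENNReal.ofReal (‖(interferenceFree A i x).starProjection e‖ ^ k)) :=
    ((measurable_starProjection_interferenceFree A i).norm.pow_const k).ennreal_ofReal
  have h := lintegral_mul_eq_of_invariant (V := (⊤ : Submodule ℂ (CVec L))) (P := Measure.pi ν) hΦ
    (φ := fun r => ENNReal.ofReal (r ^ k)) (by simp) (by fun_prop) ?_ ?_ (Submodule.mem_top) hv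
  · have htop : ∀ g : CVec L, (⊤ : Submodule ℂ (CVec L)).starProjection g = g := fun g =>
      Submodule.starProjection_eq_self_iff.2 Submodule.mem_top
    simpa only [htop] using h
  · intro U _ e _
    have hm : Measurable fun x : Fin m → CVec L =>
        ENNReal.ofReal (‖(interferenceFree A i x).starProjection (U e)‖ ^ k) :=
      ((measurable_starProjection_interferenceFree_const A i _).norm.pow_const k).ennreal_ofReal
    conv_lhs => rw [← map_pi_unitary hν U]
    rw [lintegral_map hm (measurable_pi_unitary U)]
    refine lintegral_congr fun x => ?_
    rw [starProjection_interferenceFree_map, U.norm_map]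
  · intro c e _
    have hm : Measurable fun x : Fin m → CVec L =>
        ENNReal.ofReal (‖(interferenceFree A i x).starProjection e‖ ^ k) :=
      ((measurable_starProjection_interferenceFree_const A i _).norm.pow_const k).ennreal_ofReal
    rw [← lintegral_const_mul _ hm]
    refine lintegral_congr fun x => ?_
    rw [← ENNReal.ofReal_mul (by positivity), map_smul, norm_smul, mul_pow]

lemma lintegral_norm_sq_channelLaw :
    ∫⁻ g, ENNReal.ofReal (‖g‖ ^ 2) ∂channelLaw L = ENNReal.ofReal L := by
  have h := lintegral_norm_starProjection_sq (⊤ : Submodule ℂ (CVec L))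
  have htop : ∀ g : CVec L, (⊤ : Submodule ℂ (CVec L)).starProjection g = g := fun g =>
    Submodule.starProjection_eq_self_iff.2 Submodule.mem_top
  simp only [htop, finrank_top, finrank_euclideanSpace_fin] at h
  rw [h, ENNReal.ofReal_natCast]

lemma lintegral_norm_pow_four_channelLaw :
    ∫⁻ g, ENNReal.ofReal (‖g‖ ^ 4) ∂channelLaw L = ENNReal.ofReal ((L : ℝ) ^ 2 + L) := by
  have h := lintegral_norm_starProjection_pow_four (⊤ : Submodule ℂ (CVec L))
  have htop : ∀ g : CVec L, (⊤ : Submodule ℂ (CVec L)).starProjection g = g := fun g =>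
    Submodule.starProjection_eq_self_iff.2 Submodule.mem_top
  simp only [htop, finrank_top, finrank_euclideanSpace_fin] at h
  exact h

lemma lintegral_norm_sq_sub_sq_channelLaw_le (L : ℕ) :
    ∫⁻ g, ENNReal.ofReal ((‖g‖ ^ 2 - L) ^ 2) ∂channelLaw L ≤ ENNReal.ofReal L := by
  refine lintegral_sub_sq_le (by fun_prop) (fun g => by positivity) (by positivity) (by positivity)
    lintegral_norm_sq_channelLaw ?_
  simp_rw [← pow_mul]
  exact lintegral_norm_pow_four_channelLaw.le

/-- The mean energy of a fixed unit vector in the random space of dimension `L - s + 1`. -/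
lemma lintegral_starProjection_sq (hν : ∀ j, IsIsotropic (ν j)) (hA : A.card ≤ L) (hi : i ∈ A)
    {v : CVec L} (hv : ‖v‖ = 1) :
    ∫⁻ x, ENNReal.ofReal (‖(interferenceFree A i x).starProjection v‖ ^ 2) ∂Measure.pi ν =
      ENNReal.ofReal ((L - A.card + 1) / L) := by
  have hL : 0 < (L : ℝ) := by
    have : 1 ≤ A.card := Finset.card_pos.2 ⟨i, hi⟩
    exact_mod_cast (by omega : 0 < L)
  have h := lintegral_starProjection_pow hν A i hv 2
  have h2 : ∫⁻ x, ∫⁻ g, ENNReal.ofReal (‖(interferenceFree A i x).starProjection g‖ ^ 2)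
      ∂channelLaw L ∂Measure.pi ν = ∫⁻ _, ENNReal.ofReal (L - A.card + 1) ∂Measure.pi ν := by
    refine lintegral_congr_ae ?_
    filter_upwards [ae_finrank_interferenceFree hν hA hi] with x hx
    rw [lintegral_norm_starProjection_sq, ← hx, ENNReal.ofReal_natCast]
  rw [h2, lintegral_norm_sq_channelLaw] at h
  simp only [lintegral_const, measure_univ, mul_one] at h
  rw [ENNReal.ofReal_div_of_pos hL, ENNReal.eq_div_iff (ENNReal.ofReal_pos.2 hL).ne' (by simp)]
  exact h

/-- The squared length of the projection of a fixed unit vector concentrates around its mean. -/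
lemma lintegral_starProjection_sub_sq_le (hν : ∀ j, IsIsotropic (ν j)) (hA : A.card ≤ L)
    (hi : i ∈ A) {v : CVec L} (hv : ‖v‖ = 1) :
    ∫⁻ x, ENNReal.ofReal ((‖(interferenceFree A i x).starProjection v‖ ^ 2 -
      (L - A.card + 1) / L) ^ 2) ∂Measure.pi ν ≤ ENNReal.ofReal (1 / L) := by
  have hA1 : 1 ≤ A.card := Finset.card_pos.2 ⟨i, hi⟩
  have hL : 0 < (L : ℝ) := by exact_mod_cast (by omega : 0 < L)
  have hA' : (A.card : ℝ) ≤ L := by exact_mod_cast hA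
  have hA1' : (1 : ℝ) ≤ A.card := by exact_mod_cast hA1
  have hm : Measurable fun x : Fin m → CVec L => ‖(interferenceFree A i x).starProjection v‖ ^ 2 :=
    (measurable_starProjection_interferenceFree_const A i v).norm.pow_const 2
  have hd : (0 : ℝ) ≤ (L : ℝ) - A.card + 1 := by linarith
  refine lintegral_sub_sq_le hm (fun x => by positivity) (by positivity) (by positivity)
    (lintegral_starProjection_sq hν hA hi hv) ?_
  have h := lintegral_starProjection_pow hν A i hv 4
  have h2 : ∫⁻ x, ∫⁻ g, ENNReal.ofReal (‖(interferenceFree A i x).starProjection g‖ ^ 4)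
      ∂channelLaw L ∂Measure.pi ν =
      ∫⁻ _, ENNReal.ofReal (((L : ℝ) - A.card + 1) ^ 2 + ((L : ℝ) - A.card + 1)) ∂Measure.pi ν := by
    refine lintegral_congr_ae ?_
    filter_upwards [ae_finrank_interferenceFree hν hA hi] with x hx
    rw [lintegral_norm_starProjection_pow_four, hx]
  rw [h2, lintegral_norm_pow_four_channelLaw] at h
  simp only [lintegral_const, measure_univ, mul_one] at h
  simp_rw [← pow_mul]
  refine (ofReal_le_of_mul_le (by positivity) h.le).trans (ENNReal.ofReal_le_ofReal ?_)
  calc (((L : ℝ) - A.card + 1) ^ 2 + ((L : ℝ) - A.card + 1)) / ((L : ℝ) ^ 2 + L)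
      ≤ (((L : ℝ) - A.card + 1) ^ 2 + ((L : ℝ) - A.card + 1)) / ((L : ℝ) ^ 2) :=
        div_le_div_of_nonneg_left (by positivity) (by positivity) (by linarith)
    _ ≤ (((L : ℝ) - A.card + 1) ^ 2 + L) / ((L : ℝ) ^ 2) :=
        div_le_div_of_nonneg_right (by linarith) (by positivity)
    _ = _ := by
        field_simp

/-- With more than `L` users on, the quantised channels of the others span the whole space. -/
lemma ae_zfBeam_eq_zero (hν : ∀ j, IsIsotropic (ν j)) (hA : L < A.card) (hi : i ∈ A) (p : CVec L) :
    ∀ᵐ x ∂Measure.pi ν, zfBeam A (Function.update x i p) i = 0 := by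
  have hc : (A.erase i).card = A.card - 1 := Finset.card_erase_of_mem hi
  obtain ⟨B, hB, hBc⟩ := Finset.exists_subset_card_eq (s := A.erase i) (n := L) (by omega)
  filter_upwards [ae_finrank_span hν i p (fun h => Finset.notMem_erase i A (hB h)) hBc.le] with x hx
  have h1 : Submodule.span ℂ (Function.update x i p '' (B : Set (Fin m))) = ⊤ := by
    refine Submodule.eq_top_of_finrank_eq ?_
    rw [hx, hBc, finrank_euclideanSpace_fin]
  have h2 : Submodule.span ℂ (Function.update x i p '' (A.erase i : Set (Fin m))) = ⊤ := by
    rw [eq_top_iff, ← h1]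
    exact Submodule.span_mono (Set.image_mono (Finset.coe_subset.2 hB))
  rw [zfBeam, (mem_span_iff_starProjection_eq_zero _ _).1 (by rw [h2]; exact Submodule.mem_top)]
  simp [direction]

end Projection

/-! ### The quantisation error -/

lemma channelLaw_cap_zero {n : ℕ} {a : ℝ} (ha : 0 ≤ a) :
    channelLaw (n + 1) {g | a * ∑ j : Fin n, ‖g j.succ‖ ^ 2 ≤ ‖g 0‖ ^ 2} =
      ENNReal.ofReal ((1 + a)⁻¹ ^ n) := by
  have hms : MeasurableSet {g : CVec (n + 1) | a * ∑ j : Fin n, ‖g j.succ‖ ^ 2 ≤ ‖g 0‖ ^ 2} :=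
    measurableSet_le (by fun_prop) (by fun_prop)
  have hms2 : MeasurableSet {z : ℂ × (Fin n → ℂ) | a * ∑ j : Fin n, ‖z.2 j‖ ^ 2 ≤ ‖z.1‖ ^ 2} :=
    measurableSet_le (by fun_prop) (by fun_prop)
  have hmp := measurePreserving_piFinSuccAbove (fun _ : Fin (n + 1) => complexGaussian) 0
  rw [channelLaw, MeasurableEquiv.map_apply]
  have hset : (MeasurableEquiv.toLp 2 (Fin (n + 1) → ℂ)) ⁻¹'
      {g : CVec (n + 1) | a * ∑ j : Fin n, ‖g j.succ‖ ^ 2 ≤ ‖g 0‖ ^ 2} =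
      (MeasurableEquiv.piFinSuccAbove (fun _ : Fin (n + 1) => ℂ) 0) ⁻¹'
        {z : ℂ × (Fin n → ℂ) | a * ∑ j : Fin n, ‖z.2 j‖ ^ 2 ≤ ‖z.1‖ ^ 2} := by
    ext g
    simp [MeasurableEquiv.piFinSuccAbove, Fin.tail]
  rw [hset, hmp.measure_preimage hms2.nullMeasurableSet, Measure.prod_apply_symm hms2]
  have h1 : ∀ y : Fin n → ℂ, complexGaussian ((fun x => (x, y)) ⁻¹'
      {z : ℂ × (Fin n → ℂ) | a * ∑ j : Fin n, ‖z.2 j‖ ^ 2 ≤ ‖z.1‖ ^ 2}) =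
      ∏ j, ENNReal.ofReal (Real.exp (-(a * ‖y j‖ ^ 2))) := by
    intro y
    have := complexGaussian_tail (t := a * ∑ j : Fin n, ‖y j‖ ^ 2) (by positivity)
    rw [← ENNReal.ofReal_prod_of_nonneg fun j _ => (Real.exp_pos _).le, ← Real.exp_sum,
      Finset.sum_neg_distrib, ← Finset.mul_sum, ← this]
    rfl
  simp_rw [h1]
  have hind : iIndepFun (fun (j : Fin n) (y : Fin n → ℂ) =>
      ENNReal.ofReal (Real.exp (-(a * ‖y j‖ ^ 2)))) (Measure.pi fun _ : Fin n => complexGaussian) :=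
    iIndepFun_pi (μ := fun _ : Fin n => complexGaussian)
      (X := fun _ z => ENNReal.ofReal (Real.exp (-(a * ‖z‖ ^ 2)))) fun j => by fun_prop
  rw [lintegral_prod_eq_prod_lintegral_of_indepFun Finset.univ _ hind fun j => by fun_prop]
  have h2 : ∀ j : Fin n, ∫⁻ y, ENNReal.ofReal (Real.exp (-(a * ‖y j‖ ^ 2)))
      ∂(Measure.pi fun _ : Fin n => complexGaussian) = ENNReal.ofReal (1 + a)⁻¹ := by
    intro j
    rw [← lintegral_complexGaussian_exp ha]
    exact (measurePreserving_eval (fun _ : Fin n => complexGaussian) j).lintegral_comp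
      (f := fun z => ENNReal.ofReal (Real.exp (-(a * ‖z‖ ^ 2)))) (by fun_prop)
  simp_rw [h2]
  rw [Finset.prod_const, Finset.card_univ, Fintype.card_fin, ENNReal.ofReal_pow (by positivity)]

/-- The probability that an isotropic vector falls in a spherical cap. -/
lemma isotropicLaw_cap {L : ℕ} (hL : 0 < L) {v : CVec L} (hv : ‖v‖ = 1) {t : ℝ} (ht : 0 < t)
    (ht1 : t ≤ 1) :
    isotropicLaw L {x | 1 - ‖inner ℂ v x‖ ^ 2 ≤ t} = ENNReal.ofReal (t ^ (L - 1)) := by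
  obtain ⟨n, rfl⟩ : ∃ n, L = n + 1 := ⟨L - 1, by omega⟩
  have hcap : ∀ w : CVec (n + 1), MeasurableSet {x : CVec (n + 1) | 1 - ‖inner ℂ w x‖ ^ 2 ≤ t} :=
    fun w => measurableSet_le (by fun_prop) measurable_const
  set e : CVec (n + 1) := EuclideanSpace.single 0 1 with he
  have he1 : ‖e‖ = 1 := by simp [he]
  obtain ⟨U, -, c, hc, hU⟩ := exists_unitary_map_eq_smul (V := ⊤) (u := v) (u' := e)
    Submodule.mem_top Submodule.mem_top (by rw [hv, he1])
  have h1 : isotropicLaw (n + 1) {x | 1 - ‖inner ℂ v x‖ ^ 2 ≤ t} =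
      isotropicLaw (n + 1) {x | 1 - ‖inner ℂ e x‖ ^ 2 ≤ t} := by
    rw [← (isIsotropic_isotropicLaw hL).map_eq U, Measure.map_apply U.continuous.measurable
      (hcap e), (isIsotropic_isotropicLaw hL).map_eq U]
    congr 1
    ext x
    have : ‖inner ℂ e (U x)‖ = ‖inner ℂ v x‖ := by
      rw [← U.inner_map_map v x, hU, inner_smul_left, norm_mul, RCLike.norm_conj, hc, one_mul]
    simp only [Set.mem_preimage, Set.mem_ofPred_eq, this]
  rw [h1, isotropicLaw, Measure.map_apply measurable_direction (hcap e)]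
  have ha : 0 ≤ (1 - t) / t := div_nonneg (by linarith) ht.le
  have h2 := channelLaw_cap_zero (n := n) ha
  have h3 : (1 + (1 - t) / t)⁻¹ = t := by field_simp; ring
  rw [h3] at h2
  rw [Nat.add_sub_cancel, ← h2]
  refine measure_congr ?_
  filter_upwards [channelLaw_ne_zero hL] with g hg
  have hn : 0 < ‖g‖ ^ 2 := by positivity
  have hsplit : ‖g‖ ^ 2 = ‖g 0‖ ^ 2 + ∑ j : Fin n, ‖g j.succ‖ ^ 2 := by
    rw [EuclideanSpace.norm_sq_eq, Fin.sum_univ_succ]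
  have hin : ‖inner ℂ e (direction g)‖ ^ 2 = ‖g 0‖ ^ 2 / ‖g‖ ^ 2 := by
    rw [norm_inner_direction, div_pow, he, EuclideanSpace.inner_single_left]
    simp
  refine propext ?_
  change 1 - ‖inner ℂ e (direction g)‖ ^ 2 ≤ t ↔
    (1 - t) / t * ∑ j : Fin n, ‖g j.succ‖ ^ 2 ≤ ‖g 0‖ ^ 2
  rw [hin, sub_le_iff_le_add, ← sub_le_iff_le_add', le_div_iff₀ hn, div_mul_eq_mul_div,
    div_le_iff₀ ht, hsplit]
  constructor <;> intro h <;> nlinarith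

/-- The quantisation error `1 - |v† p|²`, where `p` is the codeword selected for the channel
direction `v`. -/
def distortion {L r : ℕ} (h : CVec L) (c : Fin (2 ^ r) → CVec L) : ℝ :=
  1 - ‖inner ℂ (direction h) (quantize c h)‖ ^ 2

lemma measurable_distortion {L r : ℕ} :
    Measurable fun y : CVec L × (Fin (2 ^ r) → CVec L) => distortion y.1 y.2 :=
  measurable_const.sub ((((measurable_direction.comp measurable_fst).inner
    measurable_quantize).norm).pow_const 2)

lemma distortion_le {L r : ℕ} (h : CVec L) (c : Fin (2 ^ r) → CVec L) (k : Fin (2 ^ r)) :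
    distortion h c ≤ 1 - ‖inner ℂ (direction h) (c k)‖ ^ 2 :=
  sub_le_sub_left (pow_le_pow_left₀ (norm_nonneg _) (norm_inner_le_quantize c h k) 2) 1

lemma distortion_le_one {L r : ℕ} (h : CVec L) (c : Fin (2 ^ r) → CVec L) : distortion h c ≤ 1 :=
  sub_le_self _ (by positivity)

section Distortion

variable {L r : ℕ} {h : CVec L}

/-- The law of the codebook of a user. -/
abbrev codebookLaw (L r : ℕ) : Measure (Fin (2 ^ r) → CVec L) :=
  Measure.pi fun _ : Fin (2 ^ r) => isotropicLaw L

/-- The union bound over the codewords, each of which lies in the spherical cap with probability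
`t ^ (L - 1)`. -/
lemma codebookLaw_distortion_le (hL : 0 < L) (hh : h ≠ 0) {t : ℝ} (ht : 0 < t) :
    codebookLaw L r {c | distortion h c ≤ t} ≤ ENNReal.ofReal (2 ^ r * t ^ (L - 1)) := by
  rcases le_or_gt t 1 with ht1 | ht1
  · calc _ ≤ codebookLaw L r (⋃ k : Fin (2 ^ r), {c | 1 - ‖inner ℂ (direction h) (c k)‖ ^ 2 ≤ t}) := by
          refine measure_mono fun c hc => ?_
          obtain ⟨k, hk⟩ := quantize_mem_range c h
          refine Set.mem_iUnion.2 ⟨k, ?_⟩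
          have hc' : distortion h c ≤ t := hc
          rw [distortion, hk] at hc'
          exact hc'
      _ ≤ ∑ k : Fin (2 ^ r), codebookLaw L r {c | 1 - ‖inner ℂ (direction h) (c k)‖ ^ 2 ≤ t} :=
          measure_iUnion_fintype_le _ _
      _ = ∑ _k : Fin (2 ^ r), ENNReal.ofReal (t ^ (L - 1)) := by
          refine Finset.sum_congr rfl fun k _ => ?_
          rw [← isotropicLaw_cap hL (norm_direction hh) ht ht1]
          exact (measurePreserving_eval (fun _ : Fin (2 ^ r) => isotropicLaw L) k).measure_preimage
            (measurableSet_le (by fun_prop) measurable_const :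
              MeasurableSet {x | 1 - ‖inner ℂ (direction h) x‖ ^ 2 ≤ t}).nullMeasurableSet
      _ = _ := by
          rw [Finset.sum_const, Finset.card_univ, Fintype.card_fin, nsmul_eq_mul,
            ENNReal.ofReal_mul (by positivity), ENNReal.ofReal_pow zero_le_two]
          simp
  · refine prob_le_one.trans ?_
    rw [← ENNReal.ofReal_one]
    refine ENNReal.ofReal_le_ofReal ?_
    exact one_le_mul_of_one_le_of_one_le (one_le_pow₀ one_le_two) (one_le_pow₀ ht1.le)

/-- All codewords have to miss the spherical cap, independently of each other. -/
lemma codebookLaw_lt_distortion_le (hL : 0 < L) (hh : h ≠ 0) {t : ℝ} (ht : 0 < t) (ht1 : t ≤ 1) :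
    codebookLaw L r {c | t < distortion h c} ≤
      ENNReal.ofReal (Real.exp (-(2 ^ r * t ^ (L - 1)))) := by
  have hms : MeasurableSet {x : CVec L | 1 - ‖inner ℂ (direction h) x‖ ^ 2 ≤ t} :=
    measurableSet_le (by fun_prop) measurable_const
  have h0 : t ^ (L - 1) ≤ 1 := pow_le_one₀ ht.le ht1
  have : IsProbabilityMeasure (isotropicLaw L) := inferInstance
  calc _ ≤ codebookLaw L r (Set.univ.pi fun _ => {x | 1 - ‖inner ℂ (direction h) x‖ ^ 2 ≤ t}ᶜ) := by
        refine measure_mono fun c hc => ?_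
        refine Set.mem_univ_pi.2 fun k => ?_
        have hc' : t < distortion h c := hc
        exact not_le.2 (hc'.trans_le (distortion_le h c k))
    _ = ENNReal.ofReal (1 - t ^ (L - 1)) ^ (2 ^ r) := by
        rw [Measure.pi_pi]
        simp_rw [prob_compl_eq_one_sub hms, isotropicLaw_cap hL (norm_direction hh) ht ht1]
        rw [Finset.prod_const, Finset.card_univ, Fintype.card_fin, ← ENNReal.ofReal_one,
          ENNReal.ofReal_sub _ (by positivity)]
    _ ≤ ENNReal.ofReal (Real.exp (-(t ^ (L - 1)))) ^ (2 ^ r) :=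
        pow_le_pow_left' (ENNReal.ofReal_le_ofReal (Real.one_sub_le_exp_neg _)) _
    _ = _ := by
        rw [← ENNReal.ofReal_pow (Real.exp_pos _).le, ← Real.exp_nat_mul]
        congr 2
        push_cast
        ring

lemma ae_distortion_nonneg (hL : 0 < L) (hh : h ≠ 0) :
    ∀ᵐ c ∂codebookLaw L r, 0 ≤ distortion h c := by
  have h1 : ∀ k : Fin (2 ^ r), ∀ᵐ c ∂codebookLaw L r, ‖c k‖ = 1 := fun k =>
    (measurePreserving_eval (fun _ : Fin (2 ^ r) => isotropicLaw L)
        k).quasiMeasurePreserving.ae (isIsotropic_isotropicLaw hL).norm_eq_one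
  filter_upwards [ae_all_iff.2 h1] with c hc
  obtain ⟨k, hk⟩ := quantize_mem_range c h
  rw [distortion, hk, sub_nonneg]
  refine pow_le_one₀ (norm_nonneg _) ((norm_inner_le_norm _ _).trans ?_)
  rw [norm_direction hh, hc k, one_mul]

lemma ae_distortion_pos (hL : 2 ≤ L) (hh : h ≠ 0) :
    ∀ᵐ c ∂codebookLaw L r, 0 < distortion h c := by
  rw [ae_iff]
  have h1 : ∀ t : ℝ, 0 < t → codebookLaw L r {c | ¬ 0 < distortion h c} ≤
      ENNReal.ofReal (2 ^ r * t ^ (L - 1)) := fun t ht =>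
    (measure_mono fun c hc => (not_lt.1 hc).trans ht.le).trans
      (codebookLaw_distortion_le (by omega) hh ht)
  have h2 : Tendsto (fun t : ℝ => ENNReal.ofReal (2 ^ r * t ^ (L - 1))) (𝓝[>] 0) (𝓝 0) := by
    have : Continuous fun t : ℝ => ENNReal.ofReal (2 ^ r * t ^ (L - 1)) :=
      ENNReal.continuous_ofReal.comp (by fun_prop)
    have h3 := (this.tendsto 0).mono_left (nhdsWithin_le_nhds (s := Set.Ioi 0))
    rwa [zero_pow (by omega), mul_zero, ENNReal.ofReal_zero] at h3
  refine le_antisymm (ge_of_tendsto h2 ?_) (zero_le)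
  filter_upwards [self_mem_nhdsWithin] with t ht using h1 t ht

end Distortion

/-- The distortion `D` of a codebook of rate `R / L ≈ b` is close to `2 ^ (-b)`, uniformly
in `b`. -/
lemma distortion_concentration {δ : ℝ} (hδ : 0 < δ) (hδ1 : δ < 1) :
    ∃ ε > 0, ∃ L₀ : ℕ, ∀ L ≥ L₀, ∀ (r : ℕ) (b : ℝ), 0 ≤ b → |(r : ℝ) / L - b| < ε →
      ∀ h : CVec L, h ≠ 0 →
        codebookLaw L r {c | δ < |distortion h c - (2 : ℝ) ^ (-b)|} ≤ ENNReal.ofReal δ := by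
  -- with this choice of `ε`, both `(1 + δ) 2 ^ (-ε) > 1` and `(1 - δ) 2 ^ ε < 1`
  set ε : ℝ := Real.logb 2 (1 + δ) / 2 with hε
  have hεpos : 0 < ε := by
    have := Real.logb_pos one_lt_two (show 1 < 1 + δ by linarith)
    positivity
  have hy : (2 : ℝ) ^ ε = √(1 + δ) := by
    rw [hε, div_eq_mul_inv, Real.rpow_mul zero_le_two, Real.rpow_logb two_pos (by norm_num)
      (by linarith), Real.sqrt_eq_rpow, one_div]
  have hy1 : 1 < √(1 + δ) := by
    rw [Real.lt_sqrt zero_le_one]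
    linarith
  have hysq : √(1 + δ) ^ 2 = 1 + δ := Real.sq_sqrt (by linarith)
  set y := √(1 + δ) with hydef
  have hy0 : 0 < y := by linarith
  have hyneg : (2 : ℝ) ^ (-ε) = y⁻¹ := by rw [Real.rpow_neg zero_le_two, hy]
  have hz1 : (1 - δ) * y < 1 := by
    have : (1 - δ) * y * ((1 - δ) * y) = (1 - δ) * (1 - δ ^ 2) := by
      rw [show (1 - δ) * y * ((1 - δ) * y) = (1 - δ) ^ 2 * y ^ 2 by ring, hysq]
      ring
    have h2 : 0 < (1 - δ) * y := mul_pos (by linarith) hy0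
    nlinarith [mul_pos hδ hδ, mul_pos (mul_pos hδ hδ) hδ]
  have hz0 : 0 ≤ (1 - δ) * y := mul_nonneg (by linarith) hy0.le
  have hlim1 : Tendsto (fun n : ℕ => Real.exp (-(y ^ n))) atTop (𝓝 0) :=
    Real.tendsto_exp_neg_atTop_nhds_zero.comp (tendsto_pow_atTop_atTop_of_one_lt hy1)
  have hlim2 : Tendsto (fun n : ℕ => y / δ * ((1 - δ) * y) ^ n) atTop (𝓝 0) := by
    simpa using (tendsto_pow_atTop_nhds_zero_of_lt_one hz0 hz1).const_mul (y / δ)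
  obtain ⟨N, hN⟩ := eventually_atTop.1 ((hlim1.eventually_lt_const (half_pos hδ)).and
    (hlim2.eventually_lt_const (half_pos hδ)))
  refine ⟨ε, hεpos, N + 1, fun L hL r b hb hr h hh => ?_⟩
  have hL0 : 0 < L := by omega
  have hLpos : (0 : ℝ) < L := by exact_mod_cast hL0
  obtain ⟨n, rfl⟩ : ∃ n, L = n + 1 := ⟨L - 1, by omega⟩
  obtain ⟨hN1, hN2⟩ := hN n (by omega)
  rw [abs_lt] at hr
  have hr1 : ((n + 1 : ℕ) : ℝ) * (b - ε) ≤ r := by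
    have h1 : b - ε ≤ (r : ℝ) / (n + 1 : ℕ) := by linarith
    rw [le_div_iff₀ hLpos] at h1
    linarith
  have hr2 : (r : ℝ) ≤ ((n + 1 : ℕ) : ℝ) * (b + ε) := by
    have h1 : (r : ℝ) / (n + 1 : ℕ) ≤ b + ε := by linarith
    rw [div_le_iff₀ hLpos] at h1
    linarith
  push_cast at hr1 hr2
  have hn0 : (0 : ℝ) ≤ n := Nat.cast_nonneg n
  have hb1 : (1 : ℝ) ≤ (2 : ℝ) ^ b := Real.one_le_rpow one_le_two hb
  have hbinv : (2 : ℝ) ^ (-b) * (2 : ℝ) ^ b = 1 := by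
    rw [← Real.rpow_add two_pos]
    simp
  have hbpos : (0 : ℝ) < (2 : ℝ) ^ (-b) := Real.rpow_pos_of_pos two_pos _
  -- with about `2 ^ (L * b)` codewords it is unlikely that all miss a cap of probability
  -- `(2 ^ (-b) + δ) ^ (L - 1)`
  have hupper : codebookLaw (n + 1) r {c | (2 : ℝ) ^ (-b) + δ < distortion h c} ≤
      ENNReal.ofReal (δ / 2) := by
    rcases le_or_gt ((2 : ℝ) ^ (-b) + δ) 1 with ht1 | ht1
    · refine (codebookLaw_lt_distortion_le hL0 hh (by positivity) ht1).trans
        (ENNReal.ofReal_le_ofReal (le_trans ?_ hN1.le))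
      refine Real.exp_le_exp.2 (neg_le_neg ?_)
      rw [Nat.add_sub_cancel]
      have hbε : ε ≤ b := by
        by_contra hlt
        have h1 : (2 : ℝ) ^ (-ε) ≤ (2 : ℝ) ^ (-b) :=
          Real.rpow_le_rpow_of_exponent_le one_le_two (by linarith)
        rw [hyneg] at h1
        have h2 : y⁻¹ + δ > 1 := by
          have h3 : y⁻¹ * y = 1 := inv_mul_cancel₀ hy0.ne'
          have h4 : y⁻¹ < 1 := inv_lt_one_of_one_lt₀ hy1
          have h5 : y⁻¹ * y ^ 2 = y := by rw [sq, ← mul_assoc, h3, one_mul]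
          rw [hysq] at h5
          nlinarith
        linarith
      calc y ^ n ≤ ((2 : ℝ) ^ (b - ε) * ((2 : ℝ) ^ (-b) + δ)) ^ n := by
            refine pow_le_pow_left₀ hy0.le ?_ n
            rw [sub_eq_add_neg, Real.rpow_add two_pos, hyneg]
            have h1 : (2 : ℝ) ^ b * y⁻¹ * ((2 : ℝ) ^ (-b) + δ) =
                y⁻¹ * ((2 : ℝ) ^ (-b) * (2 : ℝ) ^ b + δ * (2 : ℝ) ^ b) := by ring
            rw [h1, hbinv]
            have h2 : y = y⁻¹ * (1 + δ) := by rw [← hysq]; field_simp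
            conv_lhs => rw [h2]
            refine mul_le_mul_of_nonneg_left ?_ (by positivity)
            nlinarith
        _ = ((2 : ℝ) ^ (b - ε)) ^ n * ((2 : ℝ) ^ (-b) + δ) ^ n := mul_pow _ _ _
        _ ≤ 2 ^ r * ((2 : ℝ) ^ (-b) + δ) ^ n := by
            refine mul_le_mul_of_nonneg_right ?_ (by positivity)
            rw [← Real.rpow_mul_natCast zero_le_two, ← Real.rpow_natCast 2 r]
            refine Real.rpow_le_rpow_of_exponent_le one_le_two ?_
            nlinarith
    · refine le_of_eq_of_le ?_ zero_le
      refine measure_mono_null (fun c hc => ?_) measure_empty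
      have hc' : (2 : ℝ) ^ (-b) + δ < distortion h c := hc
      linarith [distortion_le_one h c]
  -- the expected number of codewords in a cap of probability `(2 ^ (-b) - δ) ^ (L - 1)` is small
  have hlower : codebookLaw (n + 1) r {c | distortion h c < (2 : ℝ) ^ (-b) - δ} ≤
      ENNReal.ofReal (δ / 2) := by
    rcases lt_or_ge 0 ((2 : ℝ) ^ (-b) - δ) with ht | ht
    · calc _ ≤ codebookLaw (n + 1) r {c | distortion h c ≤ (2 : ℝ) ^ (-b) - δ} :=
            measure_mono fun c (hc : distortion h c < (2 : ℝ) ^ (-b) - δ) => hc.le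
        _ ≤ _ := codebookLaw_distortion_le hL0 hh ht
        _ ≤ _ := by
          refine ENNReal.ofReal_le_ofReal (le_trans ?_ hN2.le)
          rw [Nat.add_sub_cancel]
          have hbδ : (2 : ℝ) ^ b ≤ 1 / δ := by
            rw [le_div_iff₀ hδ]
            nlinarith
          calc (2 : ℝ) ^ r * ((2 : ℝ) ^ (-b) - δ) ^ n
              ≤ ((2 : ℝ) ^ (b + ε) * ((2 : ℝ) ^ (b + ε)) ^ n) * ((2 : ℝ) ^ (-b) - δ) ^ n := by
                refine mul_le_mul_of_nonneg_right ?_ (by positivity)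
                rw [← pow_succ', ← Real.rpow_mul_natCast zero_le_two, ← Real.rpow_natCast 2 r]
                refine Real.rpow_le_rpow_of_exponent_le one_le_two ?_
                push_cast
                linarith
            _ = (2 : ℝ) ^ (b + ε) * ((2 : ℝ) ^ (b + ε) * ((2 : ℝ) ^ (-b) - δ)) ^ n := by
                rw [mul_pow, mul_assoc]
            _ ≤ y / δ * ((1 - δ) * y) ^ n := by
                rw [Real.rpow_add two_pos, hy]
                have h1 : (2 : ℝ) ^ b * y * ((2 : ℝ) ^ (-b) - δ) =
                    ((2 : ℝ) ^ (-b) * (2 : ℝ) ^ b - δ * (2 : ℝ) ^ b) * y := by ring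
                rw [h1, hbinv]
                have h2 : (1 - δ * (2 : ℝ) ^ b) * y ≤ (1 - δ) * y :=
                  mul_le_mul_of_nonneg_right (by nlinarith) hy0.le
                have h3 : 0 ≤ (1 - δ * (2 : ℝ) ^ b) * y := by
                  refine mul_nonneg ?_ hy0.le
                  rw [le_div_iff₀ hδ] at hbδ
                  linarith
                refine mul_le_mul ?_ (pow_le_pow_left₀ h3 h2 n) (by positivity) (by positivity)
                rw [div_eq_mul_one_div, mul_comm]
                exact mul_le_mul_of_nonneg_left hbδ hy0.le
    · refine le_of_eq_of_le ?_ zero_le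
      refine measure_mono_null (fun c hc => ?_)
        (ae_iff.1 (ae_distortion_nonneg (L := n + 1) (r := r) hL0 hh))
      have hc' : distortion h c < (2 : ℝ) ^ (-b) - δ := hc
      exact not_le.2 (by linarith : distortion h c < 0)
  calc _ ≤ codebookLaw (n + 1) r ({c | (2 : ℝ) ^ (-b) + δ < distortion h c} ∪
        {c | distortion h c < (2 : ℝ) ^ (-b) - δ}) := by
        refine measure_mono fun c hc => ?_
        have hc' : δ < |distortion h c - (2 : ℝ) ^ (-b)| := hc
        rcases lt_abs.1 hc' with h1 | h1
        · exact Or.inl (show (2 : ℝ) ^ (-b) + δ < distortion h c by linarith)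
        · exact Or.inr (show distortion h c < (2 : ℝ) ^ (-b) - δ by linarith)
    _ ≤ _ := measure_union_le _ _
    _ ≤ ENNReal.ofReal (δ / 2) + ENNReal.ofReal (δ / 2) := add_le_add hupper hlower
    _ = ENNReal.ofReal δ := by
        rw [← ENNReal.ofReal_add (by positivity) (by positivity), add_halves]

lemma measurable_distortion_const {L r : ℕ} (h : CVec L) :
    Measurable (distortion (r := r) h) := by
  have hq : Measurable fun c : Fin (2 ^ r) → CVec L => quantize c h :=
    measurable_quantize.comp (measurable_prodMk_left (x := h))
  unfold distortion
  exact measurable_const.sub ((measurable_const.inner (𝕜 := ℂ) hq).norm.pow_const 2)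

/-- A moment bound that controls the event of an unusually small distortion. -/
lemma lintegral_distortion_rpow_le {L r : ℕ} (hL : 2 ≤ L) {b : ℝ} (hb : 0 ≤ b)
    (hr : (r : ℝ) ≤ L * (b + 1)) {h : CVec L} (hh : h ≠ 0) :
    ∫⁻ c, ENNReal.ofReal ((2 : ℝ) ^ (-b) * distortion h c ^ (-(1 / 4) : ℝ)) ∂codebookLaw L r ≤
      3 := by
  have hm := measurable_distortion_const (r := r) h
  have hbpos : (0 : ℝ) < (2 : ℝ) ^ (-b) := Real.rpow_pos_of_pos two_pos _
  rw [lintegral_eq_lintegral_meas_le]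
  rotate_left
  · filter_upwards [ae_distortion_nonneg (r := r) (by omega : 0 < L) hh] with c hc
    exact mul_nonneg hbpos.le (Real.rpow_nonneg hc _)
  · exact (by fun_prop : Measurable _).aemeasurable
  -- the layer-cake formula needs a tail bound that is integrable beyond `2`
  have htail : ∀ t ∈ Set.Ioi (2 : ℝ), codebookLaw L r
      {c | t ≤ (2 : ℝ) ^ (-b) * distortion h c ^ (-(1 / 4) : ℝ)} ≤
        ENNReal.ofReal (t ^ (-2 : ℝ)) := by
    intro t ht
    have ht2 : (2 : ℝ) < t := ht
    have ht0 : (0 : ℝ) < t := by linarith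
    obtain ⟨n, rfl⟩ : ∃ n, L = n + 2 := ⟨L - 2, by omega⟩
    calc _ ≤ codebookLaw (n + 2) r {c | distortion h c ≤ ((2 : ℝ) ^ (-b) / t) ^ 4} := by
          refine measure_mono fun c hc => ?_
          have hc' : t ≤ (2 : ℝ) ^ (-b) * distortion h c ^ (-(1 / 4) : ℝ) := hc
          change distortion h c ≤ ((2 : ℝ) ^ (-b) / t) ^ 4
          rcases le_or_gt (distortion h c) 0 with h0 | h0
          · exact h0.trans (by positivity)
          have h1 : distortion h c ^ (1 / 4 : ℝ) ≤ (2 : ℝ) ^ (-b) / t := by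
            rw [Real.rpow_neg h0.le, ← div_eq_mul_inv, le_div_iff₀ (by positivity)] at hc'
            rw [le_div_iff₀ ht0]
            linarith
          have h2 := pow_le_pow_left₀ (by positivity) h1 4
          rwa [← Real.rpow_natCast, ← Real.rpow_mul h0.le, Nat.cast_ofNat,
            one_div_mul_cancel four_ne_zero, Real.rpow_one] at h2
      _ ≤ _ := codebookLaw_distortion_le (by omega) hh (by positivity)
      _ ≤ _ := by
          refine ENNReal.ofReal_le_ofReal ?_
          have e0 : n + 2 - 1 = n + 1 := by omega
          rw [e0]
          have e1 : (2 : ℝ) ^ r * (((2 : ℝ) ^ (-b) / t) ^ 4) ^ (n + 1) ≤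
              (2 : ℝ) ^ (n + 2) / (t ^ 4) ^ (n + 1) := by
            rw [div_pow, div_pow, ← mul_div_assoc]
            refine div_le_div_of_nonneg_right ?_ (by positivity)
            rw [← pow_mul, ← Real.rpow_mul_natCast zero_le_two, ← Real.rpow_natCast 2 r,
              ← Real.rpow_natCast 2 (n + 2), ← Real.rpow_add two_pos]
            refine Real.rpow_le_rpow_of_exponent_le one_le_two ?_
            push_cast at hr ⊢
            have : (0 : ℝ) ≤ n := Nat.cast_nonneg n
            nlinarith [mul_nonneg this hb]
          refine e1.trans ?_
          have ht4 : (2 : ℝ) / t ^ 4 ≤ 1 := by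
            rw [div_le_one (by positivity)]
            have : (2 : ℝ) ^ 4 ≤ t ^ 4 := pow_le_pow_left₀ zero_le_two ht2.le 4
            linarith
          calc (2 : ℝ) ^ (n + 2) / (t ^ 4) ^ (n + 1) = 2 * (2 / t ^ 4) ^ n * (2 / t ^ 4) := by
                rw [div_pow]
                field_simp
                ring
            _ ≤ 2 * 1 * (2 / t ^ 4) := by
                refine mul_le_mul_of_nonneg_right ?_ (by positivity)
                exact mul_le_mul_of_nonneg_left (pow_le_one₀ (by positivity) ht4) zero_le_two
            _ ≤ t ^ (-2 : ℝ) := by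
                rw [Real.rpow_neg ht0.le, Real.rpow_two]
                have : (2 : ℝ) ^ 2 ≤ t ^ 2 := pow_le_pow_left₀ zero_le_two ht2.le 2
                rw [show 2 * 1 * (2 / t ^ 4) = 4 / t ^ 4 by ring, div_le_iff₀ (by positivity),
                  show t ^ 4 = t ^ 2 * t ^ 2 by ring, ← mul_assoc,
                  inv_mul_cancel₀ (by positivity), one_mul]
                linarith
  have hsplit : Set.Ioi (0 : ℝ) = Set.Ioc 0 2 ∪ Set.Ioi 2 :=
    (Set.Ioc_union_Ioi_eq_Ioi zero_le_two).symm
  rw [hsplit]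
  refine (lintegral_union_le _ _ _).trans ?_
  calc _ ≤ (∫⁻ _ in Set.Ioc (0 : ℝ) 2, 1) + ∫⁻ t in Set.Ioi (2 : ℝ), ENNReal.ofReal (t ^ (-2 : ℝ)) :=
        add_le_add (lintegral_mono fun t => prob_le_one)
          (setLIntegral_mono' measurableSet_Ioi htail)
    _ ≤ ENNReal.ofReal 2 + ENNReal.ofReal (1 / 2) := by
        refine add_le_add (by simp) ?_
        rw [← ofReal_integral_eq_lintegral_ofReal
          (integrableOn_Ioi_rpow_of_lt (by norm_num) two_pos),
          integral_Ioi_rpow_of_lt (by norm_num) two_pos]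
        · refine ENNReal.ofReal_le_ofReal ?_
          norm_num [Real.rpow_neg_one]
        · filter_upwards [ae_restrict_mem measurableSet_Ioi] with t ht
          have : (2 : ℝ) < t := ht
          positivity
    _ ≤ 3 := by
        rw [← ENNReal.ofReal_add (by norm_num) (by norm_num)]
        refine (ENNReal.ofReal_le_ofReal (by norm_num : (2 + 1 / 2 : ℝ) ≤ 3)).trans ?_
        simp

/-! ### The signal-to-interference-and-noise ratio of one user -/

/-- The ratio `P_sig / (1 + P_int)` of user `i` as a function of its channel `h` and of the
quantised channels `x`; here `G = ρ γ_i`. -/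
def sinr {L m : ℕ} (G : ℝ) (s : ℕ) (A : Finset (Fin m)) (i : Fin m) (h : CVec L)
    (x : Fin m → CVec L) : ℝ :=
  G / s * ‖inner ℂ h (zfBeam A x i)‖ ^ 2 /
    (1 + G / s * ∑ j ∈ A.erase i, ‖inner ℂ h (zfBeam A x j)‖ ^ 2)

/-- The component `e = v - ⟨p, v⟩ p` of the channel direction `v` that is lost when the receiver
reports the codeword `p`. -/
def quantizationError {L : ℕ} (h p : CVec L) : CVec L :=
  direction h - inner ℂ p (direction h) • p

lemma measurable_inner_zfBeam {L m : ℕ} (A : Finset (Fin m)) (i : Fin m) :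
    Measurable fun z : CVec L × (Fin m → CVec L) => ‖inner ℂ z.1 (zfBeam A z.2 i)‖ ^ 2 :=
  ((measurable_fst.inner (𝕜 := ℂ)
    ((measurable_zfBeam A i).comp measurable_snd)).norm).pow_const 2

lemma measurable_sinr {L m : ℕ} (G : ℝ) (s : ℕ) (A : Finset (Fin m)) (i : Fin m) :
    Measurable fun z : CVec L × (Fin m → CVec L) => sinr G s A i z.1 z.2 :=
  (measurable_const.mul (measurable_inner_zfBeam A i)).div
    (measurable_const.add (measurable_const.mul
      (Finset.measurable_sum _ fun j _ => measurable_inner_zfBeam A j)))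

lemma sinr_nonneg {L m : ℕ} {G : ℝ} (hG : 0 ≤ G) (s : ℕ) (A : Finset (Fin m)) (i : Fin m)
    (h : CVec L) (x : Fin m → CVec L) : 0 ≤ sinr G s A i h x := by
  unfold sinr
  positivity

section Error

variable {L m : ℕ} {h p : CVec L}

lemma quantizationError_mem (hp : ‖p‖ = 1) (h : CVec L) :
    quantizationError h p ∈ (Submodule.span ℂ {p})ᗮ := by
  rw [Submodule.mem_orthogonal_singleton_iff_inner_right, quantizationError, inner_sub_right,
    inner_smul_right, inner_self_eq_ofReal, hp]
  simp

lemma norm_quantizationError_sq (hh : h ≠ 0) (hp : ‖p‖ = 1) :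
    ‖quantizationError h p‖ ^ 2 = 1 - ‖inner ℂ (direction h) p‖ ^ 2 := by
  have h1 := norm_add_sq_eq_norm_sq_add_norm_sq_of_inner_eq_zero (𝕜 := ℂ)
    (inner ℂ p (direction h) • p) (quantizationError h p) (by
      rw [inner_smul_left, (Submodule.mem_orthogonal_singleton_iff_inner_right).1
        (quantizationError_mem hp h), mul_zero])
  rw [quantizationError, add_sub_cancel, norm_direction hh, norm_smul, hp, mul_one,
    norm_inner_symm] at h1
  rw [quantizationError]
  linarith

lemma norm_quantizationError_quantize_sq {r : ℕ} {c : Fin (2 ^ r) → CVec L} (hh : h ≠ 0)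
    (hc : ‖quantize c h‖ = 1) : ‖quantizationError h (quantize c h)‖ ^ 2 = distortion h c :=
  norm_quantizationError_sq hh hc

lemma norm_inner_eq_norm_mul_direction_left (h q : CVec L) :
    ‖inner ℂ h q‖ ^ 2 = ‖h‖ ^ 2 * ‖inner ℂ (direction h) q‖ ^ 2 := by
  rw [norm_inner_symm, norm_inner_eq_norm_mul_direction, norm_inner_symm, mul_pow]

/-- The beams of the other users are orthogonal to the reported codeword, so only the
quantisation error leaks interference. -/
lemma norm_inner_zfBeam_eq_quantizationError {A : Finset (Fin m)} {i j : Fin m} (hi : i ∈ A)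
    (hj : j ∈ A.erase i) (h : CVec L) (x : Fin m → CVec L) :
    ‖inner ℂ (direction h) (zfBeam A x j)‖ =
      ‖inner ℂ (zfBeam A x j) (quantizationError h (x i))‖ := by
  have h1 : inner ℂ (x i) (zfBeam A x j) = 0 :=
    inner_zfBeam_eq_zero x (Finset.mem_erase.2 ⟨(Finset.ne_of_mem_erase hj).symm, hi⟩)
  have h2 : inner ℂ (zfBeam A x j) (x i) = 0 := inner_eq_zero_symm.1 h1
  rw [norm_inner_symm, quantizationError, inner_sub_right, inner_smul_right, h2, mul_zero,
    sub_zero]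

/-- The ratio in terms of the channel direction and the quantisation error. -/
lemma sinr_eq {A : Finset (Fin m)} {i : Fin m} (hi : i ∈ A) (G : ℝ) (s : ℕ) (h : CVec L)
    (x : Fin m → CVec L) :
    sinr G s A i h x = G * (‖h‖ ^ 2 / s) * ‖inner ℂ (direction h) (zfBeam A x i)‖ ^ 2 /
      (1 + G * (‖h‖ ^ 2 / s) *
        ∑ j ∈ A.erase i, ‖inner ℂ (zfBeam A x j) (quantizationError h (x i))‖ ^ 2) := by
  have h1 : ∑ j ∈ A.erase i, ‖inner ℂ h (zfBeam A x j)‖ ^ 2 = ‖h‖ ^ 2 *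
      ∑ j ∈ A.erase i, ‖inner ℂ (zfBeam A x j) (quantizationError h (x i))‖ ^ 2 := by
    rw [Finset.mul_sum]
    refine Finset.sum_congr rfl fun j hj => ?_
    rw [norm_inner_eq_norm_mul_direction_left, norm_inner_zfBeam_eq_quantizationError hi hj]
  rw [sinr, h1, norm_inner_eq_norm_mul_direction_left]
  congr 1 <;> ring

end Error

/-! ### A moment bound for the ratio -/

/-- The comparison of the quadratic and the harmonic mean. It bounds an inverse power of the
interference by first inverse moments of the single terms. -/
lemma inv_sqrt_sum_sq_le {J : Type*} (S : Finset J) (hS : S.Nonempty) {b : J → ℝ}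
    (hb : ∀ j ∈ S, 0 < b j) :
    1 / √(∑ j ∈ S, b j ^ 2) ≤ (∑ j ∈ S, (b j)⁻¹) / (S.card * √S.card) := by
  have hn : (0 : ℝ) < S.card := by exact_mod_cast hS.card_pos
  have hsum : 0 < ∑ j ∈ S, b j := Finset.sum_pos hb hS
  have h1 : (∑ j ∈ S, b j) ^ 2 ≤ S.card * ∑ j ∈ S, b j ^ 2 := sq_sum_le_card_mul_sum_sq
  have hsq : 0 < ∑ j ∈ S, b j ^ 2 := Finset.sum_pos (fun j hj => pow_pos (hb j hj) 2) hS
  have h2 : (S.card : ℝ) ^ 2 ≤ (∑ j ∈ S, b j) * ∑ j ∈ S, (b j)⁻¹ := by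
    have h3 := Finset.sum_mul_sq_le_sq_mul_sq S (fun j => √(b j)) (fun j => (√(b j))⁻¹)
    have e1 : ∑ j ∈ S, √(b j) * (√(b j))⁻¹ = S.card := by
      rw [Finset.cast_card]
      exact Finset.sum_congr rfl fun j hj => mul_inv_cancel₀ (Real.sqrt_pos.2 (hb j hj)).ne'
    have e2 : ∑ j ∈ S, √(b j) ^ 2 = ∑ j ∈ S, b j :=
      Finset.sum_congr rfl fun j hj => Real.sq_sqrt (hb j hj).le
    have e3 : ∑ j ∈ S, (√(b j))⁻¹ ^ 2 = ∑ j ∈ S, (b j)⁻¹ :=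
      Finset.sum_congr rfl fun j hj => by rw [inv_pow, Real.sq_sqrt (hb j hj).le]
    rwa [e1, e2, e3] at h3
  have h4 : ∑ j ∈ S, b j ≤ √S.card * √(∑ j ∈ S, b j ^ 2) := by
    rw [← Real.sqrt_mul hn.le]
    exact Real.le_sqrt_of_sq_le h1
  have hr : 0 < √(S.card : ℝ) := Real.sqrt_pos.2 hn
  have hr2 : √(S.card : ℝ) * √(S.card : ℝ) = S.card := Real.mul_self_sqrt hn.le
  have hi : 0 ≤ ∑ j ∈ S, (b j)⁻¹ := Finset.sum_nonneg fun j hj => (inv_pos.2 (hb j hj)).le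
  rw [div_le_div_iff₀ (Real.sqrt_pos.2 hsq) (by positivity)]
  have h5 := mul_le_mul_of_nonneg_right h4 hi
  have h6 : (S.card : ℝ) ^ 2 ≤ √S.card * ((∑ j ∈ S, (b j)⁻¹) * √(∑ j ∈ S, b j ^ 2)) := by
    linarith
  have h7 : √(S.card : ℝ) * (1 * (S.card * √S.card)) = (S.card : ℝ) ^ 2 := by
    linear_combination (S.card : ℝ) * hr2
  exact le_of_mul_le_mul_left (h7.trans_le h6) hr

/-- Separates the sources of randomness in the ratio: the channel gain `a = ‖h‖² / L`, the
distortion `D`, the signal coefficient `n` of mean `κ`, and the leaked energy `I`; here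
`c = L / s`. With the exponent `1 / 4`, the last factor has bounded mean by the first moment of `n`
and by first inverse moments of the correlations in `I`. -/
lemma ratio_rpow_le {G a c κ D n I : ℝ} (hG : 0 ≤ G) (ha : 0 ≤ a) (hc : 0 < c) (hκ : 0 < κ)
    (hD : 0 < D) (hn : 0 ≤ n) (hI : 0 < I) :
    (G * (c * a) * n / (1 + G * (c * a) * I)) ^ (1 / 4 : ℝ) ≤
      (1 + a) * (c * κ) ^ (1 / 4 : ℝ) * ((1 + G) / (1 + G * D)) ^ (1 / 4 : ℝ) *
        (1 + n / κ + √(D / (c * I))) := by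
  have hpow : ∀ {x y : ℝ}, 0 ≤ x → 0 ≤ y → x ≤ y ^ 4 → x ^ (1 / 4 : ℝ) ≤ y := by
    intro x y hx hy hxy
    calc x ^ (1 / 4 : ℝ) ≤ (y ^ 4) ^ (1 / 4 : ℝ) := Real.rpow_le_rpow hx hxy (by norm_num)
      _ = y := by
        rw [← Real.rpow_natCast, ← Real.rpow_mul hy]
        norm_num
  set u := n / κ with hu
  have hu0 : 0 ≤ u := by positivity
  set t := √(D / (c * I)) with ht
  have ht0 : 0 ≤ t := Real.sqrt_nonneg _
  have ht2 : t ^ 2 = D / (c * I) := Real.sq_sqrt (by positivity)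
  have h1 : G * (c * a) * n / (1 + G * (c * a) * I) ≤
      (1 + a) * ((c * κ) * (((1 + G) / (1 + G * D)) * (u * (1 + t ^ 2)))) := by
    have hn' : n = u * κ := by
      rw [hu]
      field_simp
    rw [hn', ht2]
    have e : (1 + a) * (c * κ * ((1 + G) / (1 + G * D) * (u * (1 + D / (c * I))))) =
        (u * κ * c) * ((1 + a) * (1 + G) * (c * I + D) / ((1 + G * D) * (c * I))) := by
      field_simp
    have e' : G * (c * a) * (u * κ) / (1 + G * (c * a) * I) =
        (u * κ * c) * (G * a / (1 + G * a * (c * I))) := by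
      rw [← mul_div_assoc]
      congr 1 <;> ring
    rw [e, e']
    have hy : 0 < c * I := by positivity
    set y := c * I with hydef
    refine mul_le_mul_of_nonneg_left ?_ (by positivity)
    rw [div_le_div_iff₀ (by positivity) (by positivity)]
    have : (1 + a) * (1 + G) * (y + D) * (1 + G * a * y) - G * a * ((1 + G * D) * y) =
        (1 + a + G) * (y + D) * (1 + G * a * y) + a * G * D * (1 + G * a * y) +
          a * G * y * (G * a * y) - G * a * (G * D * y) := by ring
    have h2 : G * a * (G * D * y) ≤ (1 + a + G) * (y + D) * (1 + G * a * y) := by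
      have : (1 + a + G) * (y + D) * (1 + G * a * y) - G * a * (G * D * y) =
        (1 + a + G) * y * (1 + G * a * y) + (1 + a) * D * (1 + G * a * y) + G * D := by ring
      have : 0 ≤ (1 + a + G) * y * (1 + G * a * y) + (1 + a) * D * (1 + G * a * y) + G * D := by
        positivity
      linarith
    have h3 : 0 ≤ a * G * D * (1 + G * a * y) + a * G * y * (G * a * y) := by positivity
    linarith
  refine (Real.rpow_le_rpow (by positivity) h1 (by norm_num)).trans ?_
  rw [Real.mul_rpow (x := 1 + a) (by positivity) (by positivity),
    Real.mul_rpow (x := c * κ) (by positivity) (by positivity),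
    Real.mul_rpow (x := (1 + G) / (1 + G * D)) (by positivity) (by positivity),
    ← mul_assoc, ← mul_assoc]
  have h2 : (1 + a) ^ (1 / 4 : ℝ) ≤ 1 + a :=
    Real.rpow_le_self_of_one_le (by linarith) (by norm_num)
  have h3 : (u * (1 + t ^ 2)) ^ (1 / 4 : ℝ) ≤ 1 + u + t := by
    refine hpow (by positivity) (by positivity) ?_
    have h4 : u ≤ (1 + u + t) ^ 2 := by nlinarith
    have h5 : 1 + t ^ 2 ≤ (1 + u + t) ^ 2 := by nlinarith
    calc u * (1 + t ^ 2) ≤ (1 + u + t) ^ 2 * (1 + u + t) ^ 2 :=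
          mul_le_mul h4 h5 (by positivity) (by positivity)
      _ = _ := by ring
  have h6 : 0 ≤ (c * κ) ^ (1 / 4 : ℝ) := by positivity
  have h7 : 0 ≤ ((1 + G) / (1 + G * D)) ^ (1 / 4 : ℝ) := by positivity
  gcongr

/-- Replaces the random distortion `D` by its limit `D₀`, at the price of a factor whose
expectation is bounded. -/
lemma div_rpow_le {G D D₀ : ℝ} (hG : 0 ≤ G) (hD : 0 < D) (hD₀ : 0 < D₀) :
    ((1 + G) / (1 + G * D)) ^ (1 / 4 : ℝ) ≤
      (1 + G) / (1 + G * D₀) * (1 + D₀ * D ^ (-(1 / 4) : ℝ)) := by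
  set t := D ^ (1 / 4 : ℝ) with ht
  have ht0 : 0 < t := Real.rpow_pos_of_pos hD _
  have hDt : D = t ^ 4 := by
    rw [ht, ← Real.rpow_natCast, ← Real.rpow_mul hD.le]
    norm_num
  rw [Real.rpow_neg hD.le, ← ht, hDt]
  have hmean : (1 + G * D₀) ^ 4 ≤ (1 + G) ^ 3 * (1 + G * D₀ ^ 4) := by
    have h1 : ∀ x : ℝ, (1 + G * x) ^ 2 ≤ (1 + G) * (1 + G * x ^ 2) := fun x => by
      nlinarith [mul_nonneg hG (sq_nonneg (1 - x))]
    calc (1 + G * D₀) ^ 4 = ((1 + G * D₀) ^ 2) ^ 2 := by ring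
      _ ≤ ((1 + G) * (1 + G * D₀ ^ 2)) ^ 2 := pow_le_pow_left₀ (by positivity) (h1 D₀) 2
      _ = (1 + G) ^ 2 * (1 + G * D₀ ^ 2) ^ 2 := by ring
      _ ≤ (1 + G) ^ 2 * ((1 + G) * (1 + G * (D₀ ^ 2) ^ 2)) :=
          mul_le_mul_of_nonneg_left (h1 _) (by positivity)
      _ = _ := by ring
  have hkey : (1 + G) / (1 + G * t ^ 4) ≤ ((1 + G) / (1 + G * D₀) * (1 + D₀ * t⁻¹)) ^ 4 := by
    have h1 : 1 + G * D₀ ^ 4 ≤ (1 + D₀ * t⁻¹) ^ 4 * (1 + G * t ^ 4) := by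
      have e : (1 + D₀ * t⁻¹) ^ 4 * t ^ 4 = (t + D₀) ^ 4 := by
        rw [← mul_pow]
        congr 1
        field_simp
      have h2 : D₀ ^ 4 ≤ (t + D₀) ^ 4 := pow_le_pow_left₀ hD₀.le (by linarith) 4
      have h3 : 1 ≤ (1 + D₀ * t⁻¹) ^ 4 := one_le_pow₀ (le_add_of_nonneg_right (by positivity))
      calc 1 + G * D₀ ^ 4 ≤ (1 + D₀ * t⁻¹) ^ 4 + G * (t + D₀) ^ 4 :=
            add_le_add h3 (mul_le_mul_of_nonneg_left h2 hG)
        _ = _ := by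
          rw [← e]
          ring
    rw [mul_pow, div_pow, div_mul_eq_mul_div, div_le_div_iff₀ (by positivity) (by positivity)]
    calc (1 + G) * (1 + G * D₀) ^ 4 ≤ (1 + G) * ((1 + G) ^ 3 * (1 + G * D₀ ^ 4)) :=
          mul_le_mul_of_nonneg_left hmean (by positivity)
      _ ≤ (1 + G) * ((1 + G) ^ 3 * ((1 + D₀ * t⁻¹) ^ 4 * (1 + G * t ^ 4))) := by gcongr
      _ = _ := by ring
  calc _ ≤ (((1 + G) / (1 + G * D₀) * (1 + D₀ * t⁻¹)) ^ 4) ^ (1 / 4 : ℝ) :=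
        Real.rpow_le_rpow (by positivity) hkey (by norm_num)
    _ = _ := by
      rw [← Real.rpow_natCast, ← Real.rpow_mul (by positivity)]
      norm_num

section Moment

variable {L m : ℕ} {ν : Fin m → Measure (CVec L)} [∀ j, IsProbabilityMeasure (ν j)]
  {A : Finset (Fin m)} {i : Fin m}

/-- The moment bound given the channel `h` and the codeword `p` of user `i`, by averaging over the
other users. -/
lemma lintegral_sinr_rpow_le_of_channel (hν : ∀ j, IsIsotropic (ν j)) (hA : A.card ≤ L)
    (hA2 : 2 ≤ A.card) (hi : i ∈ A) {G : ℝ} (hG : 0 ≤ G) {h p : CVec L} (hh : h ≠ 0)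
    (hp : ‖p‖ = 1) (he : 0 < ‖quantizationError h p‖ ^ 2) :
    ∫⁻ x, ENNReal.ofReal (sinr G A.card A i h (Function.update x i p) ^ (1 / 4 : ℝ))
        ∂Measure.pi ν ≤
      ENNReal.ofReal (5 * ((1 + ‖h‖ ^ 2 / L) * ((L - A.card + 1) / A.card) ^ (1 / 4 : ℝ) *
        ((1 + G) / (1 + G * ‖quantizationError h p‖ ^ 2)) ^ (1 / 4 : ℝ))) := by
  set e := quantizationError h p with he_def
  have hemem : e ∈ (Submodule.span ℂ {p})ᗮ := quantizationError_mem hp h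
  have he0 : e ≠ 0 := by
    rintro h0
    simp [h0] at he
  have hepos : 0 < ‖e‖ := norm_pos_iff.2 he0
  have hs0 : (0 : ℝ) < A.card := by exact_mod_cast (by omega : 0 < A.card)
  have hL0 : (0 : ℝ) < L := by exact_mod_cast (by omega : 0 < L)
  have hsL : (A.card : ℝ) ≤ L := by exact_mod_cast hA
  have hκ : 0 < ((L : ℝ) - A.card + 1) / L := div_pos (by linarith) hL0
  set S := A.erase i with hSdef
  have hcard : S.card = A.card - 1 := Finset.card_erase_of_mem hi
  have hSne : S.Nonempty := Finset.card_pos.1 (by omega)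
  have hS0 : (0 : ℝ) < S.card := by exact_mod_cast hSne.card_pos
  set Z : ℝ := √(‖e‖ ^ 2 / (L / A.card)) / (S.card * √S.card) with hZ
  have hZ0 : 0 ≤ Z := by positivity
  set B : ℝ := (1 + ‖h‖ ^ 2 / L) * ((L - A.card + 1) / A.card) ^ (1 / 4 : ℝ) *
        ((1 + G) / (1 + G * ‖e‖ ^ 2)) ^ (1 / 4 : ℝ) with hB
  have hB0 : 0 ≤ B := by
    have : 0 ≤ ((L : ℝ) - A.card + 1) / A.card := div_nonneg (by linarith) hs0.le
    positivity
  set b : Fin m → (Fin m → CVec L) → ℝ :=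
    fun j x => ‖inner ℂ (zfBeam A (Function.update x i p) j) e‖ with hb
  have hzm := measurable_zfBeam_update A i p
  have hbm : ∀ j, Measurable (b j) := fun j =>
    (((measurable_pi_apply j).comp hzm).inner (𝕜 := ℂ) measurable_const).norm
  have hbinv : ∀ j ∈ S, ∫⁻ x, (ENNReal.ofReal (b j x))⁻¹ ∂Measure.pi ν ≤
      ENNReal.ofReal (√Real.pi * √L / ‖e‖) := fun j hj =>
    lintegral_inner_zfBeam_inv_le hν hA hi hj hemem he0
  have hbpos : ∀ᵐ x ∂Measure.pi ν, ∀ j ∈ S, 0 < b j x := by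
    refine (Finset.eventually_all S).2 fun j hj => ?_
    have h1 := ae_lt_top ((hbm j).ennreal_ofReal.inv)
      ((hbinv j hj).trans_lt ENNReal.ofReal_lt_top).ne
    filter_upwards [h1] with x hx
    exact ENNReal.ofReal_pos.1 (ENNReal.inv_lt_top.1 hx)
  set T : (Fin m → CVec L) → ℝ :=
    fun x => ‖(interferenceFree A i x).starProjection (direction h)‖ ^ 2 with hT
  have hTm : Measurable T :=
    ((measurable_starProjection_interferenceFree_const A i (direction h)).norm).pow_const 2
  have hpoint : ∀ᵐ x ∂Measure.pi ν,
      ENNReal.ofReal (sinr G A.card A i h (Function.update x i p) ^ (1 / 4 : ℝ)) ≤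
        ENNReal.ofReal B * (1 + ENNReal.ofReal ((((L : ℝ) - A.card + 1) / L)⁻¹) *
          ENNReal.ofReal (T x) +
          ENNReal.ofReal Z * ∑ j ∈ S, (ENNReal.ofReal (b j x))⁻¹) := by
    filter_upwards [hbpos] with x hx
    have hI : 0 < ∑ j ∈ S, b j x ^ 2 := Finset.sum_pos (fun j hj => pow_pos (hx j hj) 2) hSne
    have hn : ‖inner ℂ (direction h) (zfBeam A (Function.update x i p) i)‖ ^ 2 ≤ T x := by
      rw [hT]
      refine pow_le_pow_left₀ (norm_nonneg _) ?_ 2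
      have h1 := norm_inner_zfBeam_le A (Function.update x i p) i (direction h)
      rw [show Submodule.span ℂ (Function.update x i p '' (A.erase i : Set (Fin m))) =
        Submodule.span ℂ (x '' (A.erase i : Set (Fin m))) from by
          have := interferenceFree_update A i x p
          unfold interferenceFree at this
          simpa using congrArg Submodule.orthogonal this] at h1
      exact h1
    have h1 : sinr G A.card A i h (Function.update x i p) ^ (1 / 4 : ℝ) ≤
        B * (1 + (((L : ℝ) - A.card + 1) / L)⁻¹ * T x + Z * ∑ j ∈ S, (b j x)⁻¹) := by
      have h2 := ratio_rpow_le (a := ‖h‖ ^ 2 / L) (c := L / A.card) hG (by positivity)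
        (by positivity) hκ he
        (sq_nonneg ‖inner ℂ (direction h) (zfBeam A (Function.update x i p) i)‖) hI
      have e1 : (L : ℝ) / A.card * (‖h‖ ^ 2 / L) = ‖h‖ ^ 2 / A.card := by field_simp
      have e2 : (L : ℝ) / A.card * ((L - A.card + 1) / L) = (L - A.card + 1) / A.card := by
        field_simp
      rw [e1, e2] at h2
      rw [sinr_eq hi, Function.update_self]
      refine h2.trans (mul_le_mul_of_nonneg_left ?_ hB0)
      have h3 : √(‖e‖ ^ 2 / (L / A.card * ∑ j ∈ S, b j x ^ 2)) ≤ Z * ∑ j ∈ S, (b j x)⁻¹ := by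
        rw [← div_div, Real.sqrt_div (by positivity), hZ, div_eq_mul_one_div, div_mul_eq_mul_div,
          mul_div_assoc]
        exact mul_le_mul_of_nonneg_left (inv_sqrt_sum_sq_le S hSne hx) (Real.sqrt_nonneg _)
      have h4 : ‖inner ℂ (direction h) (zfBeam A (Function.update x i p) i)‖ ^ 2 /
          (((L : ℝ) - A.card + 1) / L) ≤ (((L : ℝ) - A.card + 1) / L)⁻¹ * T x := by
        rw [div_eq_inv_mul]
        exact mul_le_mul_of_nonneg_left hn (inv_pos.2 hκ).le
      linarith
    refine (ENNReal.ofReal_le_ofReal h1).trans (le_of_eq ?_)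
    have hT0 : 0 ≤ T x := by positivity
    have hbs : 0 ≤ ∑ j ∈ S, (b j x)⁻¹ := Finset.sum_nonneg fun j hj => (inv_pos.2 (hx j hj)).le
    have hκ' := (inv_pos.2 hκ).le
    rw [ENNReal.ofReal_mul hB0, ENNReal.ofReal_add (by positivity) (by positivity),
      ENNReal.ofReal_add zero_le_one (by positivity), ENNReal.ofReal_mul hκ',
      ENNReal.ofReal_mul hZ0, ENNReal.ofReal_one,
      ENNReal.ofReal_sum_of_nonneg fun j hj => (inv_pos.2 (hx j hj)).le]
    congr 3
    exact Finset.sum_congr rfl fun j hj => ENNReal.ofReal_inv_of_pos (hx j hj)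
  refine (lintegral_mono_ae hpoint).trans ?_
  have hTE : ∫⁻ x, ENNReal.ofReal (T x) ∂Measure.pi ν =
      ENNReal.ofReal (((L : ℝ) - A.card + 1) / L) :=
    lintegral_starProjection_sq hν hA hi (norm_direction hh)
  have hbsum : Measurable fun x => ∑ j ∈ S, (ENNReal.ofReal (b j x))⁻¹ :=
    Finset.measurable_sum _ fun j _ => (hbm j).ennreal_ofReal.inv
  have hsumE : ∫⁻ x, ∑ j ∈ S, (ENNReal.ofReal (b j x))⁻¹ ∂Measure.pi ν =
      ∑ j ∈ S, ∫⁻ x, (ENNReal.ofReal (b j x))⁻¹ ∂Measure.pi ν :=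
    lintegral_finsetSum S fun j _ => (hbm j).ennreal_ofReal.inv
  rw [lintegral_const_mul _ (by fun_prop), lintegral_add_right _ (hbsum.const_mul _),
    lintegral_add_left measurable_const, lintegral_const_mul _ hTm.ennreal_ofReal,
    lintegral_const_mul _ hbsum, hsumE,
    hTE, ← ENNReal.ofReal_mul (inv_pos.2 hκ).le, inv_mul_cancel₀ hκ.ne', lintegral_const,
    measure_univ, mul_comm 5 B, ENNReal.ofReal_mul hB0, ENNReal.ofReal_one, mul_one]
  refine mul_le_mul_right ?_ _
  have h3 : ENNReal.ofReal Z * ∑ j ∈ S, ∫⁻ x, (ENNReal.ofReal (b j x))⁻¹ ∂Measure.pi ν ≤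
      ENNReal.ofReal 3 := by
    calc _ ≤ ENNReal.ofReal Z * ∑ j ∈ S, ENNReal.ofReal (√Real.pi * √L / ‖e‖) :=
          mul_le_mul_right (Finset.sum_le_sum hbinv) _
      _ = ENNReal.ofReal (Z * (S.card * (√Real.pi * √L / ‖e‖))) := by
          rw [Finset.sum_const, nsmul_eq_mul, ENNReal.ofReal_mul hZ0,
            ENNReal.ofReal_mul (Nat.cast_nonneg _), ENNReal.ofReal_natCast]
      _ ≤ _ := by
          refine ENNReal.ofReal_le_ofReal ?_
          have e1 : Z * (S.card * (√Real.pi * √L / ‖e‖)) = √(Real.pi * (A.card / S.card)) := by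
            have hr : √(S.card : ℝ) ≠ 0 := (Real.sqrt_pos.2 hS0).ne'
            have hr2 : √(L : ℝ) ≠ 0 := (Real.sqrt_pos.2 hL0).ne'
            have hr3 : √(A.card : ℝ) ≠ 0 := (Real.sqrt_pos.2 hs0).ne'
            rw [hZ, Real.sqrt_div (by positivity), Real.sqrt_div hL0.le, Real.sqrt_sq hepos.le,
              Real.sqrt_mul Real.pi_pos.le, Real.sqrt_div hs0.le]
            field_simp
          rw [e1]
          refine Real.sqrt_le_iff.2 ⟨by norm_num, ?_⟩
          have h4 : (A.card : ℝ) / S.card ≤ 2 := by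
            rw [div_le_iff₀ hS0]
            exact_mod_cast (by omega : A.card ≤ 2 * S.card)
          nlinarith [Real.pi_pos, Real.pi_lt_four]
  calc _ ≤ 1 + 1 + ENNReal.ofReal 3 := add_le_add le_rfl h3
    _ = ENNReal.ofReal 5 := by
      rw [← ENNReal.ofReal_one, ← ENNReal.ofReal_add (by norm_num) (by norm_num),
        ← ENNReal.ofReal_add (by norm_num) (by norm_num)]
      norm_num

end Moment

/-- The fractional moment of the ratio is bounded uniformly over the users, up to the factor
`1 + η = (1 + G) / (1 + G 2 ^ (-b))`. -/
lemma lintegral_sinr_rpow_le {L m : ℕ} {R : ℕ → ℕ} {A : Finset (Fin m)} {i : Fin m}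
    (hA : A.card ≤ L) (hA2 : 2 ≤ A.card) (hi : i ∈ A) {G b : ℝ} (hG : 0 ≤ G) (hb : 0 ≤ b)
    (hr : (R i : ℝ) ≤ L * (b + 1)) :
    ∫⁻ ω, ENNReal.ofReal (sinr G A.card A i (ω.1 i) (quantizedChannels ω) ^ (1 / 4 : ℝ))
        ∂sampleLaw L m R ≤
      ENNReal.ofReal (40 * (((L : ℝ) - A.card + 1) / A.card) ^ (1 / 4 : ℝ) *
        ((1 + G) / (1 + G * (2 : ℝ) ^ (-b)))) := by
  have hL : 2 ≤ L := hA2.trans hA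
  have hL0 : (0 : ℝ) < L := by exact_mod_cast (by omega : 0 < L)
  have hs0 : (0 : ℝ) < A.card := by exact_mod_cast (by omega : 0 < A.card)
  have hsL : (A.card : ℝ) ≤ L := by exact_mod_cast hA
  have hiso := isIsotropic_isotropicLaw (L := L) (by omega)
  have hν : ∀ j : Fin m, IsIsotropic (quantizedLaw L (R j)) := fun j =>
    isIsotropic_quantizedLaw (by omega) _
  set D₀ : ℝ := (2 : ℝ) ^ (-b) with hD₀
  have hD₀pos : 0 < D₀ := Real.rpow_pos_of_pos two_pos _
  set M : ℝ := (((L : ℝ) - A.card + 1) / A.card) ^ (1 / 4 : ℝ) with hM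
  have hM0 : 0 ≤ M := Real.rpow_nonneg (div_nonneg (by linarith) hs0.le) _
  set E : ℝ := (1 + G) / (1 + G * D₀) with hE
  have hE0 : 0 ≤ E := by positivity
  have hmeas := measurable_sinr G A.card A i (L := L)
  rw [lintegral_sampleLaw i (H := fun y x =>
    ENNReal.ofReal (sinr G A.card A i y.1 x ^ (1 / 4 : ℝ)))
    ((hmeas.comp ((measurable_fst.comp measurable_fst).prodMk
      measurable_snd)).pow_const _).ennreal_ofReal]
  have h1 : ∀ᵐ y ∂userLaw L (R i), ∫⁻ x, ENNReal.ofReal (sinr G A.card A i y.1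
      (Function.update x i (quantize y.2 y.1)) ^ (1 / 4 : ℝ))
        ∂(Measure.pi fun j : Fin m => quantizedLaw L (R j)) ≤
      ENNReal.ofReal (5 * M * E * (1 + ‖y.1‖ ^ 2 / L)) *
        (1 + ENNReal.ofReal (D₀ * distortion y.1 y.2 ^ (-(1 / 4) : ℝ))) := by
    have hh0 : ∀ᵐ y ∂userLaw L (R i), y.1 ≠ 0 :=
      Measure.quasiMeasurePreserving_fst.ae (channelLaw_ne_zero (by omega))
    have hDpos : ∀ᵐ y ∂userLaw L (R i), y.1 ≠ 0 → 0 < distortion y.1 y.2 := by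
      have hms : MeasurableSet {y : CVec L × (Fin (2 ^ R i) → CVec L) |
          y.1 ≠ 0 → 0 < distortion y.1 y.2} := by
        have e : {y : CVec L × (Fin (2 ^ R i) → CVec L) |
          y.1 ≠ 0 → 0 < distortion y.1 y.2} = {y | y.1 = 0} ∪ {y | 0 < distortion y.1 y.2} := by
            ext y
            simp only [Set.mem_union, Set.mem_ofPred_eq]
            tauto
        rw [e]
        exact (measurable_fst (measurableSet_singleton 0)).union
          (measurableSet_lt measurable_const measurable_distortion)
      refine (Measure.ae_prod_iff_ae_ae hms).2 (Eventually.of_forall fun h => ?_)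
      by_cases hh : h = 0
      · exact Eventually.of_forall fun c hc => absurd hh hc
      · filter_upwards [ae_distortion_pos hL hh] with c hc _ using hc
    filter_upwards [hh0, hDpos, ae_userLaw_quantize (s := {x | ‖x‖ = 1}) hiso.norm_eq_one] with
      y hy0 hyD hy1
    have hy1' : ‖quantize y.2 y.1‖ = 1 := hy1
    have hD := norm_quantizationError_quantize_sq hy0 hy1'
    refine (lintegral_sinr_rpow_le_of_channel hν hA hA2 hi hG hy0 hy1'
      (by rw [hD]; exact hyD hy0)).trans ?_
    rw [hD, ← ENNReal.ofReal_one, ← ENNReal.ofReal_add zero_le_one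
      (mul_nonneg hD₀pos.le (Real.rpow_nonneg (hyD hy0).le _)),
      ← ENNReal.ofReal_mul (by positivity)]
    refine ENNReal.ofReal_le_ofReal ?_
    calc 5 * ((1 + ‖y.1‖ ^ 2 / L) * M * ((1 + G) / (1 + G * distortion y.1 y.2)) ^ (1 / 4 : ℝ))
        ≤ 5 * ((1 + ‖y.1‖ ^ 2 / L) * M *
            (E * (1 + D₀ * distortion y.1 y.2 ^ (-(1 / 4) : ℝ)))) := by
          have := div_rpow_le hG (hyD hy0) hD₀pos
          gcongr
      _ = _ := by ring
  refine (lintegral_mono_ae h1).trans ?_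
  refine (lintegral_prod_le _).trans ?_
  have h2 : ∀ᵐ h ∂channelLaw L, ∫⁻ c, ENNReal.ofReal (5 * M * E * (1 + ‖h‖ ^ 2 / L)) *
        (1 + ENNReal.ofReal (D₀ * distortion h c ^ (-(1 / 4) : ℝ))) ∂codebookLaw L (R i) ≤
      ENNReal.ofReal (20 * M * E) * (1 + ENNReal.ofReal (1 / L) * ENNReal.ofReal (‖h‖ ^ 2)) := by
    filter_upwards [channelLaw_ne_zero (by omega : 0 < L)] with h hh
    have hm := measurable_distortion_const (r := R i) h
    rw [lintegral_const_mul _ (by fun_prop), lintegral_add_left measurable_const, lintegral_const,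
      measure_univ, mul_one]
    calc _ ≤ ENNReal.ofReal (5 * M * E * (1 + ‖h‖ ^ 2 / L)) * (1 + 3) :=
          mul_le_mul_right (add_le_add le_rfl (lintegral_distortion_rpow_le hL hb hr hh)) _
      _ = _ := by
        rw [show (1 + 3 : ENNReal) = ENNReal.ofReal 4 by norm_num, ← ENNReal.ofReal_one,
          ← ENNReal.ofReal_mul (by positivity), ← ENNReal.ofReal_mul (by positivity),
          ← ENNReal.ofReal_add zero_le_one (by positivity), ← ENNReal.ofReal_mul (by positivity)]
        congr 1
        ring
  refine (lintegral_mono_ae h2).trans ?_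
  rw [lintegral_const_mul _ (by fun_prop), lintegral_add_left measurable_const, lintegral_const,
    measure_univ, mul_one, lintegral_const_mul _ (by fun_prop), lintegral_norm_sq_channelLaw,
    ← ENNReal.ofReal_one, ← ENNReal.ofReal_mul (by positivity),
    ← ENNReal.ofReal_add zero_le_one (by positivity), ← ENNReal.ofReal_mul (by positivity)]
  refine ENNReal.ofReal_le_ofReal (le_of_eq ?_)
  field_simp
  ring

/-! ### Elementary estimates for the rate -/

lemma inv_log_two_le : (Real.log 2)⁻¹ ≤ 3 / 2 := by
  rw [inv_le_comm₀ (Real.log_pos one_lt_two) (by norm_num)]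
  linarith [Real.log_two_gt_d9]

lemma abs_logb_one_add_sub_le {x y : ℝ} (hx : 0 ≤ x) (hy : 0 ≤ y) :
    |Real.logb 2 (1 + x) - Real.logb 2 (1 + y)| ≤ 2 * |x - y| := by
  have key : ∀ {x y : ℝ}, 0 ≤ x → 0 ≤ y →
      Real.logb 2 (1 + x) - Real.logb 2 (1 + y) ≤ 2 * |x - y| := by
    intro x y hx hy
    rw [← Real.logb_div (by positivity) (by positivity), Real.logb, div_eq_mul_inv]
    have h1 : Real.log ((1 + x) / (1 + y)) ≤ |x - y| := by
      refine (Real.log_le_sub_one_of_pos (by positivity)).trans ?_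
      rw [div_sub_one (by positivity), div_le_iff₀ (by positivity)]
      nlinarith [le_abs_self (x - y), abs_nonneg (x - y)]
    have h2 := inv_log_two_le
    have h3 : 0 < (Real.log 2)⁻¹ := inv_pos.2 (Real.log_pos one_lt_two)
    nlinarith [abs_nonneg (x - y)]
  refine abs_sub_le_iff.2 ⟨key hx hy, ?_⟩
  rw [abs_sub_comm]
  exact key hy hx

lemma logb_one_add_nonneg {x : ℝ} (hx : 0 ≤ x) : 0 ≤ Real.logb 2 (1 + x) :=
  Real.logb_nonneg one_lt_two (by linarith)

lemma logb_one_add_mono {x y : ℝ} (hx : 0 ≤ x) (hxy : x ≤ y) :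
    Real.logb 2 (1 + x) ≤ Real.logb 2 (1 + y) :=
  Real.logb_le_logb_of_le one_lt_two (by linarith) (by linarith)

lemma logb_one_add_le_two_mul {x : ℝ} (hx : 0 ≤ x) : Real.logb 2 (1 + x) ≤ 2 * x := by
  have h := (le_abs_self _).trans (abs_logb_one_add_sub_le hx le_rfl)
  simpa [abs_of_nonneg hx] using h

lemma logb_one_add_le_rpow {x : ℝ} (hx : 0 ≤ x) {k : ℝ} (hk : 1 ≤ k) :
    Real.logb 2 (1 + x) ≤ 2 * k * x ^ (1 / k) := by
  have hk0 : 0 < k := by linarith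
  have hxk : 0 ≤ x ^ (1 / k) := Real.rpow_nonneg hx _
  have h1 : (1 + x) ^ (1 / k) ≤ 1 + x ^ (1 / k) := by
    have := Real.rpow_add_le_add_rpow zero_le_one hx (by positivity : 0 ≤ 1 / k)
      (by rw [div_le_one hk0]; exact hk)
    rwa [Real.one_rpow] at this
  have h2 : Real.logb 2 (1 + x) = k * Real.logb 2 ((1 + x) ^ (1 / k)) := by
    rw [Real.logb_rpow_eq_mul_logb_of_pos (by linarith)]
    field_simp
  rw [h2]
  calc k * Real.logb 2 ((1 + x) ^ (1 / k)) ≤ k * Real.logb 2 (1 + x ^ (1 / k)) :=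
        mul_le_mul_of_nonneg_left
          (Real.logb_le_logb_of_le one_lt_two (by positivity) h1) hk0.le
    _ ≤ k * (2 * x ^ (1 / k)) :=
        mul_le_mul_of_nonneg_left (logb_one_add_le_two_mul hxk) hk0.le
    _ = _ := by ring

lemma logb_one_add_le_of_pos {x l : ℝ} (hx : 0 ≤ x) (hl : 0 < l) :
    Real.logb 2 (1 + x) ≤ 16 * l + 16 / l * x ^ (1 / 4 : ℝ) := by
  have h1 := logb_one_add_le_rpow hx (by norm_num : (1 : ℝ) ≤ 8)
  set t := x ^ (1 / 8 : ℝ) with ht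
  have ht0 : 0 ≤ t := Real.rpow_nonneg hx _
  have ht2 : x ^ (1 / 4 : ℝ) = t ^ 2 := by
    rw [ht, ← Real.rpow_natCast, ← Real.rpow_mul hx]
    norm_num
  rw [ht2]
  have h2 : t ≤ l + 1 / l * t ^ 2 := by
    rcases le_total t l with h | h
    · have : 0 ≤ 1 / l * t ^ 2 := by positivity
      linarith
    · have : t ≤ 1 / l * t ^ 2 := by
        rw [div_mul_eq_mul_div, one_mul, le_div_iff₀ hl]
        nlinarith
      linarith
  have h3 : 16 / l * t ^ 2 = 16 * (1 / l * t ^ 2) := by ring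
  linarith

lemma abs_mul_mul_sub_le {l a n n₀ σ δ : ℝ} (hσ : 0 < σ) (hσ1 : σ ≤ 1) (hδ : 0 < δ) (hδ1 : δ ≤ 1)
    (hl : |l - 1 / σ| ≤ δ) (ha : |a - 1| ≤ δ) (hn : |n - n₀| ≤ 5 * δ) (hn₀ : 0 ≤ n₀)
    (hn₀1 : n₀ ≤ 1) : |l * a * n - n₀ / σ| ≤ 23 * δ / σ := by
  have h1 : l * a * n - n₀ / σ =
      (l - 1 / σ) * a * n + 1 / σ * ((a - 1) * n) + 1 / σ * (n - n₀) := by ring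
  have hn' : |n| ≤ 6 := by
    have : |n| ≤ |n - n₀| + |n₀| := by
      simpa using abs_add_le (n - n₀) n₀
    rw [abs_of_nonneg hn₀] at this
    linarith
  have ha' : |a| ≤ 2 := by
    have : |a| ≤ |a - 1| + |1| := by simpa using abs_add_le (a - 1) 1
    rw [abs_one] at this
    linarith
  have hσi : 1 ≤ 1 / σ := by rwa [le_div_iff₀ hσ, one_mul]
  rw [h1]
  calc _ ≤ |(l - 1 / σ) * a * n| + |1 / σ * ((a - 1) * n)| + |1 / σ * (n - n₀)| :=
        abs_add_three _ _ _
    _ = |l - 1 / σ| * |a| * |n| + 1 / σ * (|a - 1| * |n|) + 1 / σ * |n - n₀| := by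
        rw [abs_mul, abs_mul, abs_mul, abs_mul, abs_mul, abs_of_pos (by positivity : 0 < 1 / σ)]
    _ ≤ δ * 2 * 6 + 1 / σ * (δ * 6) + 1 / σ * (5 * δ) := by gcongr
    _ ≤ 1 / σ * (δ * 2 * 6) + 1 / σ * (δ * 6) + 1 / σ * (5 * δ) := by
        have : 1 * (δ * 2 * 6) ≤ 1 / σ * (δ * 2 * 6) :=
          mul_le_mul_of_nonneg_right hσi (by positivity)
        linarith
    _ = _ := by ring

lemma abs_ratio_sub_le {G D₀ N₀ N I K σ θ : ℝ} (hG : 0 ≤ G) (hD₀ : 0 ≤ D₀)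
    (hN₀ : 0 ≤ N₀) (hN₀σ : N₀ ≤ 1 / σ) (hK : 0 ≤ K) (hGK : (1 + G) / (1 + G * D₀) ≤ 1 + K)
    (hI : 0 ≤ I) (hθ : θ ≤ 1 / (2 * (1 + K))) (hN : |N - N₀| ≤ θ) (hI' : |I - D₀| ≤ θ) :
    |G * N / (1 + G * I) - G * N₀ / (1 + G * D₀)| ≤ 2 * (1 + K) * (1 + (1 + K) / σ) * θ := by
  have hd0 : 0 < 1 + G * D₀ := by positivity
  have hd : 0 < 1 + G * I := by positivity
  have hθ0 : 0 ≤ θ := (abs_nonneg _).trans hN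
  rw [div_le_iff₀ hd0] at hGK
  have hθ' : θ * (2 * (1 + K)) ≤ 1 := by
    rwa [le_div_iff₀ (by positivity)] at hθ
  have h1 : G ≤ 2 * (1 + K) * (1 + G * I) := by
    have h2 : D₀ - θ ≤ I := by linarith [(abs_le.1 hI').1]
    have h3 : G * (D₀ - θ) ≤ G * I := mul_le_mul_of_nonneg_left h2 hG
    have h4 : G * (θ * (2 * (1 + K))) ≤ G * 1 := mul_le_mul_of_nonneg_left hθ' hG
    nlinarith
  have h2 : 1 + G * D₀ + G * N₀ ≤ (1 + (1 + K) / σ) * (1 + G * D₀) := by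
    have h3 : G ≤ (1 + K) * (1 + G * D₀) := by linarith
    have h4 : G * N₀ ≤ (1 + K) * (1 + G * D₀) * (1 / σ) :=
      mul_le_mul h3 hN₀σ hN₀ (by positivity)
    have h5 : (1 + (1 + K) / σ) * (1 + G * D₀) =
      1 + G * D₀ + (1 + K) * (1 + G * D₀) * (1 / σ) := by ring
    linarith
  have e : G * N / (1 + G * I) - G * N₀ / (1 + G * D₀) =
      G * ((N - N₀) * (1 + G * D₀) + G * N₀ * (D₀ - I)) / ((1 + G * I) * (1 + G * D₀)) := by
    rw [div_sub_div _ _ hd.ne' hd0.ne']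
    congr 1
    ring
  rw [e, abs_div, abs_of_pos (mul_pos hd hd0), div_le_iff₀ (mul_pos hd hd0), abs_mul,
    abs_of_nonneg hG]
  have h5 : |(N - N₀) * (1 + G * D₀) + G * N₀ * (D₀ - I)| ≤ θ * (1 + G * D₀ + G * N₀) := by
    refine (abs_add_le _ _).trans ?_
    rw [abs_mul, abs_mul, abs_of_pos hd0, abs_of_nonneg (mul_nonneg hG hN₀), abs_sub_comm D₀ I]
    have h6 := mul_le_mul_of_nonneg_right hN hd0.le
    have h7 := mul_le_mul_of_nonneg_left hI' (mul_nonneg hG hN₀)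
    linarith
  calc G * |(N - N₀) * (1 + G * D₀) + G * N₀ * (D₀ - I)|
      ≤ (2 * (1 + K) * (1 + G * I)) * (θ * ((1 + (1 + K) / σ) * (1 + G * D₀))) := by
        refine mul_le_mul h1 (h5.trans (mul_le_mul_of_nonneg_left h2 hθ0)) (abs_nonneg _)
          (by positivity)
    _ = _ := by ring

/-! ### Concentration of the ratio -/

/-- The squared deviations of the channel gain, of the interference, of the projection of the
reported codeword on the interference-free space, and of the signal carried by the quantisation
error from their limits. -/
def discrepancy {L m : ℕ} (A : Finset (Fin m)) (i : Fin m) (h : CVec L) (x : Fin m → CVec L) : ℝ :=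
  (‖h‖ ^ 2 / L - 1) ^ 2 +
  (∑ j ∈ A.erase i, ‖inner ℂ (zfBeam A x j) (quantizationError h (x i))‖ ^ 2 -
      ‖quantizationError h (x i)‖ ^ 2 * ((A.card - 1) / (L - 1))) ^ 2 +
  (‖inner ℂ (x i) (zfBeam A x i)‖ ^ 2 - (L - A.card + 1) / L) ^ 2 +
  ‖inner ℂ (zfBeam A x i) (quantizationError h (x i))‖ ^ 2

lemma measurable_quantizationError {L : ℕ} {Ω : Type*} [MeasurableSpace Ω] {f g : Ω → CVec L}
    (hf : Measurable f) (hg : Measurable g) :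
    Measurable fun ω => quantizationError (f ω) (g ω) := by
  have h1 : Measurable fun ω => direction (f ω) := measurable_direction.comp hf
  have h2 : Measurable fun ω => (inner ℂ (g ω) (direction (f ω)) : ℂ) := hg.inner h1
  have h3 : Measurable fun ω => (inner ℂ (g ω) (direction (f ω)) : ℂ) • g ω := h2.smul hg
  exact h1.sub h3

lemma measurable_discrepancy {L m : ℕ} (A : Finset (Fin m)) (i : Fin m) :
    Measurable fun z : CVec L × (Fin m → CVec L) => discrepancy A i z.1 z.2 := by
  have he : Measurable fun z : CVec L × (Fin m → CVec L) => quantizationError z.1 (z.2 i) :=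
    measurable_quantizationError measurable_fst ((measurable_pi_apply i).comp measurable_snd)
  have hz : ∀ j, Measurable fun z : CVec L × (Fin m → CVec L) => zfBeam A z.2 j := fun j =>
    (measurable_zfBeam A j).comp measurable_snd
  have hq : ∀ j, Measurable fun z : CVec L × (Fin m → CVec L) =>
      ‖inner ℂ (zfBeam A z.2 j) (quantizationError z.1 (z.2 i))‖ ^ 2 := fun j =>
    (((hz j).inner (𝕜 := ℂ) he).norm).pow_const 2
  have hn : Measurable fun z : CVec L × (Fin m → CVec L) => ‖z.1‖ ^ 2 :=
    measurable_fst.norm.pow_const 2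
  have ht : Measurable fun z : CVec L × (Fin m → CVec L) =>
      ‖inner ℂ (z.2 i) (zfBeam A z.2 i)‖ ^ 2 :=
    ((((measurable_pi_apply i).comp measurable_snd).inner (𝕜 := ℂ) (hz i)).norm).pow_const 2
  exact (((((hn.div_const _).sub_const _).pow_const 2).add
    (((Finset.measurable_sum _ fun j _ => hq j).sub
      ((he.norm.pow_const 2).mul_const _)).pow_const 2)).add
      ((ht.sub_const _).pow_const 2)).add (hq i)

lemma discrepancy_nonneg {L m : ℕ} (A : Finset (Fin m)) (i : Fin m) (h : CVec L)
    (x : Fin m → CVec L) : 0 ≤ discrepancy A i h x := by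
  unfold discrepancy
  positivity

/-- The mean discrepancy is of order `1 / L` as long as `s / L` stays away from `1`. -/
lemma lintegral_discrepancy_le {L m : ℕ} {R : ℕ → ℕ} {A : Finset (Fin m)} {i : Fin m}
    (hA : A.card ≤ L) (hL : 2 ≤ L) (hi : i ∈ A) :
    ∫⁻ ω, ENNReal.ofReal (discrepancy A i (ω.1 i) (quantizedChannels ω)) ∂sampleLaw L m R ≤
      ENNReal.ofReal (2 / L + ((A.card + (A.card : ℝ) ^ 2 / (L - A.card + 2)) / (L - 1) ^ 2) +
        1 / (L - 1)) := by
  have hL0 : (0 : ℝ) < L := by exact_mod_cast (by omega : 0 < L)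
  have hL1 : (0 : ℝ) < (L : ℝ) - 1 := by
    have : (2 : ℝ) ≤ L := by exact_mod_cast hL
    linarith
  have hsL : (A.card : ℝ) ≤ L := by exact_mod_cast hA
  have hiso := isIsotropic_isotropicLaw (L := L) (by omega)
  have hν : ∀ j : Fin m, IsIsotropic (quantizedLaw L (R j)) := fun j =>
    isIsotropic_quantizedLaw (by omega) _
  set V : ℝ := (A.card + (A.card : ℝ) ^ 2 / (L - A.card + 2)) / (L - 1) ^ 2 with hV
  have hV0 : 0 ≤ V := by
    have : (0 : ℝ) < L - A.card + 2 := by linarith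
    positivity
  rw [lintegral_sampleLaw i (H := fun y x => ENNReal.ofReal (discrepancy A i y.1 x))
    (((measurable_discrepancy A i).comp ((measurable_fst.comp measurable_fst).prodMk
      measurable_snd))).ennreal_ofReal]
  have hh0 : ∀ᵐ y ∂userLaw L (R i), y.1 ≠ 0 :=
    Measure.quasiMeasurePreserving_fst.ae (channelLaw_ne_zero (by omega))
  have h1 : ∀ᵐ y ∂userLaw L (R i), ∫⁻ x, ENNReal.ofReal (discrepancy A i y.1
      (Function.update x i (quantize y.2 y.1)))
        ∂(Measure.pi fun j : Fin m => quantizedLaw L (R j)) ≤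
      ENNReal.ofReal ((‖y.1‖ ^ 2 / L - 1) ^ 2) + ENNReal.ofReal (V + 1 / L + 1 / (L - 1)) := by
    filter_upwards [hh0, ae_userLaw_quantize (s := {x | ‖x‖ = 1}) hiso.norm_eq_one] with y hy0 hy1
    set p := quantize y.2 y.1 with hp
    have hy1' : ‖p‖ = 1 := hy1
    set e := quantizationError y.1 p with he
    have hemem : e ∈ (Submodule.span ℂ {p})ᗮ := quantizationError_mem hy1' y.1
    have he1 : ‖e‖ ^ 2 ≤ 1 := by
      rw [he, norm_quantizationError_sq hy0 hy1']
      exact sub_le_self _ (by positivity)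
    have hzm := measurable_zfBeam_update A i p
    have hbm : ∀ j, Measurable fun x : Fin m → CVec L =>
        ‖inner ℂ (zfBeam A (Function.update x i p) j) e‖ ^ 2 := fun j =>
      ((((measurable_pi_apply j).comp hzm).inner (𝕜 := ℂ) measurable_const).norm).pow_const 2
    have hSm : Measurable fun x : Fin m → CVec L => (∑ j ∈ A.erase i,
        ‖inner ℂ (zfBeam A (Function.update x i p) j) e‖ ^ 2 -
          ‖e‖ ^ 2 * ((A.card - 1) / (L - 1))) ^ 2 :=
      ((Finset.measurable_sum _ fun j _ => hbm j).sub_const _).pow_const 2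
    have hTm : Measurable fun x : Fin m → CVec L =>
        (‖(interferenceFree A i x).starProjection p‖ ^ 2 - (L - A.card + 1) / L) ^ 2 :=
      ((((measurable_starProjection_interferenceFree_const A i p).norm).pow_const 2).sub_const
        _).pow_const 2
    have hE1 := lintegral_interference_sub_sq_le hν hy1' hL hA hi hemem
    have hE2 := lintegral_starProjection_sub_sq_le hν hA hi hy1'
    have hE3 := lintegral_inner_zfBeam_sq_le hν hy1' hL A i i hemem
    have hT : ∀ x : Fin m → CVec L,
        ‖inner ℂ p (zfBeam A (Function.update x i p) i)‖ =
          ‖(interferenceFree A i x).starProjection p‖ := by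
      intro x
      have h2 := inner_self_zfBeam A (Function.update x i p) i
      rw [Function.update_self, show Submodule.span ℂ (Function.update x i p ''
        (A.erase i : Set (Fin m))) = Submodule.span ℂ (x '' (A.erase i : Set (Fin m))) from by
          have := interferenceFree_update A i x p
          unfold interferenceFree at this
          simpa using congrArg Submodule.orthogonal this] at h2
      exact h2
    have hpt : ∀ x : Fin m → CVec L, ENNReal.ofReal (discrepancy A i y.1 (Function.update x i p)) =
        ENNReal.ofReal ((‖y.1‖ ^ 2 / L - 1) ^ 2) +
          (ENNReal.ofReal ((∑ j ∈ A.erase i,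
            ‖inner ℂ (zfBeam A (Function.update x i p) j) e‖ ^ 2 -
              ‖e‖ ^ 2 * ((A.card - 1) / (L - 1))) ^ 2) +
          (ENNReal.ofReal ((‖(interferenceFree A i x).starProjection p‖ ^ 2 -
            (L - A.card + 1) / L) ^ 2) +
          ENNReal.ofReal (‖inner ℂ (zfBeam A (Function.update x i p) i) e‖ ^ 2))) := by
      intro x
      rw [← ENNReal.ofReal_add (by positivity) (by positivity),
        ← ENNReal.ofReal_add (by positivity) (by positivity),
        ← ENNReal.ofReal_add (by positivity) (by positivity), discrepancy, Function.update_self,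
        hT]
      congr 1
      ring
    simp_rw [hpt]
    rw [lintegral_add_left measurable_const, lintegral_const, measure_univ, mul_one,
      lintegral_add_left hSm.ennreal_ofReal, lintegral_add_left hTm.ennreal_ofReal]
    refine add_le_add le_rfl ((add_le_add hE1 (add_le_add hE2 hE3)).trans ?_)
    rw [← ENNReal.ofReal_add (by positivity) (by positivity),
      ← ENNReal.ofReal_add (by positivity) (by positivity)]
    refine ENNReal.ofReal_le_ofReal ?_
    have h4 : ‖e‖ ^ 4 ≤ 1 := by
      calc ‖e‖ ^ 4 = (‖e‖ ^ 2) ^ 2 := by ring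
        _ ≤ 1 := pow_le_one₀ (by positivity) he1
    have h5 : ‖e‖ ^ 4 * V ≤ 1 * V := mul_le_mul_of_nonneg_right h4 hV0
    have h6 : ‖e‖ ^ 2 / ((L : ℝ) - 1) ≤ 1 / (L - 1) := div_le_div_of_nonneg_right he1 hL1.le
    linarith
  refine (lintegral_mono_ae h1).trans ?_
  rw [lintegral_add_right _ measurable_const, lintegral_const, measure_univ, mul_one]
  have h2 : ∫⁻ y, ENNReal.ofReal ((‖y.1‖ ^ 2 / L - 1) ^ 2) ∂userLaw L (R i) ≤
      ENNReal.ofReal (1 / L) := by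
    refine (lintegral_prod_le _).trans ?_
    simp_rw [lintegral_const, measure_univ, mul_one]
    have e : ∀ h : CVec L, ENNReal.ofReal ((‖h‖ ^ 2 / L - 1) ^ 2) =
        ENNReal.ofReal (1 / (L : ℝ) ^ 2) * ENNReal.ofReal ((‖h‖ ^ 2 - L) ^ 2) := by
      intro h
      rw [← ENNReal.ofReal_mul (by positivity)]
      congr 1
      field_simp
    simp_rw [e]
    rw [lintegral_const_mul _ (by fun_prop)]
    refine (mul_le_mul_right (lintegral_norm_sq_sub_sq_channelLaw_le L) _).trans ?_
    rw [← ENNReal.ofReal_mul (by positivity)]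
    refine ENNReal.ofReal_le_ofReal (le_of_eq ?_)
    field_simp
  refine (add_le_add h2 le_rfl).trans ?_
  rw [← ENNReal.ofReal_add (by positivity) (by positivity)]
  refine ENNReal.ofReal_le_ofReal (le_of_eq ?_)
  ring

instance {L m : ℕ} {R : ℕ → ℕ} : IsProbabilityMeasure (sampleLaw L m R) := by
  unfold sampleLaw
  infer_instance

/-- The channel and the codebook of a single user have the law `userLaw`. -/
lemma measurePreserving_user {L m : ℕ} {R : ℕ → ℕ} (i : Fin m) :
    MeasurePreserving (fun ω : Sample L m R => (ω.1 i, ω.2 i)) (sampleLaw L m R)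
      (userLaw L (R i)) := by
  have hp : ∀ j : Fin m, IsProbabilityMeasure (userLaw L (R j)) := fun j => by
    unfold userLaw
    infer_instance
  have h1 : Measurable fun (ω : Sample L m R) (j : Fin m) => (ω.1 j, ω.2 j) :=
    measurable_pi_lambda _ fun j => ((measurable_pi_apply j).comp measurable_fst).prodMk
      ((measurable_pi_apply j).comp measurable_snd)
  have h2 : MeasurePreserving (fun (ω : Sample L m R) (j : Fin m) => (ω.1 j, ω.2 j))
      (sampleLaw L m R) (Measure.pi fun j : Fin m => userLaw L (R j)) :=
    ⟨h1, (pi_userLaw_eq_map L m R).symm⟩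
  exact (measurePreserving_eval (fun j : Fin m => userLaw L (R j)) i).comp h2

/-- `1 + η` in closed form, with `D₀ = 2 ^ (-rbar)`. -/
lemma one_add_eta {G D₀ : ℝ} (hG : 0 ≤ G) (hD₀ : 0 ≤ D₀) :
    1 + G * (1 - D₀) / (1 + G * D₀) = (1 + G) / (1 + G * D₀) := by
  have : 0 < 1 + G * D₀ := by positivity
  field_simp
  ring

lemma abs_signal_sub_le {n α τ D D₀ κ σ δ : ℝ} (hn0 : 0 ≤ n) (hn1 : n ≤ 1) (hα0 : 0 ≤ α)
    (hα1 : α ≤ 1) (hτ0 : 0 ≤ τ) (hτ1 : τ ≤ 1) (hDα : D = 1 - α ^ 2) (hnα : |n - α * τ| ≤ δ)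
    (hD : |D - D₀| ≤ δ) (hκ : |τ ^ 2 - κ| ≤ δ) (hσ : |κ - (1 - σ)| ≤ δ) (hD₀ : 0 ≤ D₀)
    (hD₀1 : D₀ ≤ 1) : |n ^ 2 - (1 - D₀) * (1 - σ)| ≤ 5 * δ := by
  have hδ : 0 ≤ δ := (abs_nonneg _).trans hD
  have hn2 : |(n - α * τ) * (n + α * τ)| ≤ δ * 2 := by
    have h5 : α * τ ≤ 1 := mul_le_one₀ hα1 hτ0 hτ1
    have h6 : 0 ≤ α * τ := mul_nonneg hα0 hτ0
    rw [abs_mul, abs_of_nonneg (by positivity : 0 ≤ n + α * τ)]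
    exact mul_le_mul hnα (by linarith) (by positivity) hδ
  have hT : |τ ^ 2 - (1 - σ)| ≤ 2 * δ :=
    (abs_sub_le _ κ _).trans (by linarith)
  have e1 : n ^ 2 - (1 - D₀) * (1 - σ) =
      (n - α * τ) * (n + α * τ) + (-(D - D₀)) * τ ^ 2 + (1 - D₀) * (τ ^ 2 - (1 - σ)) := by
    rw [hDα]
    ring
  rw [e1]
  refine (abs_add_three _ _ _).trans ?_
  rw [abs_mul (-(D - D₀)), abs_mul (1 - D₀), abs_neg, abs_of_nonneg (sq_nonneg τ),
    abs_of_nonneg (by linarith : 0 ≤ 1 - D₀)]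
  have h5 : |D - D₀| * τ ^ 2 ≤ δ * 1 := mul_le_mul hD (pow_le_one₀ hτ0 hτ1) (sq_nonneg τ) hδ
  have h6 : (1 - D₀) * |τ ^ 2 - (1 - σ)| ≤ 1 * (2 * δ) :=
    mul_le_mul (by linarith) hT (abs_nonneg _) zero_le_one
  linarith

lemma abs_interference_sub_le {S D D₀ κ σ δ : ℝ} (hD0 : 0 ≤ D) (hD1 : D ≤ 1) (hσ : 0 ≤ σ)
    (hσ1 : σ ≤ 1) (hS : |S - D * κ| ≤ δ) (hD : |D - D₀| ≤ δ) (hκ : |κ - σ| ≤ δ) :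
    |S - D₀ * σ| ≤ 5 * δ := by
  have hδ : 0 ≤ δ := (abs_nonneg _).trans hD
  have e1 : S - D₀ * σ = (S - D * κ) + D * (κ - σ) + (D - D₀) * σ := by ring
  rw [e1]
  refine (abs_add_three _ _ _).trans ?_
  rw [abs_mul, abs_mul, abs_of_nonneg hD0, abs_of_nonneg hσ]
  have h5 : D * |κ - σ| ≤ 1 * δ := mul_le_mul hD1 hκ (abs_nonneg _) zero_le_one
  have h6 : |D - D₀| * σ ≤ δ * 1 := mul_le_mul hD hσ1 hσ hδ
  linarith

lemma abs_le_of_sq_add_le {a b c d δ : ℝ} (hδ : 0 ≤ δ)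
    (h : a ^ 2 + b ^ 2 + c ^ 2 + d ^ 2 ≤ δ ^ 2) : |a| ≤ δ ∧ |b| ≤ δ ∧ |c| ≤ δ ∧ |d| ≤ δ := by
  have k1 := sq_nonneg a
  have k2 := sq_nonneg b
  have k3 := sq_nonneg c
  have k4 := sq_nonneg d
  refine ⟨abs_le_of_sq_le_sq ?_ hδ, abs_le_of_sq_le_sq ?_ hδ, abs_le_of_sq_le_sq ?_ hδ,
    abs_le_of_sq_le_sq ?_ hδ⟩ <;> linarith

/-- The limits of the deterministic ratios of `L` and `s`. -/
lemma load_estimates {L s σ δ ε : ℝ} (hσ : 0 < σ) (hL : 2 ≤ L) (hs0 : σ / 2 * L ≤ s) (hsL : s ≤ L)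
    (hδL : 4 < δ * L) (hs : |s / L - σ| < ε) (h1 : ε ≤ δ / 2) (h2 : ε ≤ δ * σ ^ 2 / 2) :
    |L / s - 1 / σ| ≤ δ ∧ |(s - 1) / (L - 1) - σ| ≤ δ ∧ |(L - s + 1) / L - (1 - σ)| ≤ δ := by
  have hL0 : 0 < L := by linarith
  have hs0' : 0 < s := lt_of_lt_of_le (by positivity) hs0
  obtain ⟨hs1, hs2⟩ := abs_lt.1 hs
  refine ⟨?_, ?_, ?_⟩
  · have e : L / s - 1 / σ = -(s / L - σ) * (L / (s * σ)) := by
      field_simp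
      ring
    have h5 : L / (s * σ) ≤ 2 / σ ^ 2 := by
      rw [div_le_div_iff₀ (by positivity) (by positivity)]
      have := mul_le_mul_of_nonneg_right hs0 hσ.le
      linarith
    rw [e, abs_mul, abs_neg, abs_of_pos (by positivity : 0 < L / (s * σ))]
    calc _ ≤ δ * σ ^ 2 / 2 * (2 / σ ^ 2) :=
          mul_le_mul (hs.le.trans h2) h5 (by positivity) ((abs_nonneg _).trans (hs.le.trans h2))
      _ = δ := by field_simp
  · have hL1 : 0 < L - 1 := by linarith
    have e : (s - 1) / (L - 1) - σ = (s / L - σ) - (L - s) / (L * (L - 1)) := by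
      field_simp
      ring
    have h5 : (L - s) / (L * (L - 1)) ≤ δ / 2 := by
      rw [div_le_iff₀ (by positivity)]
      have h6 : 4 * (L - 1) ≤ δ * L * (L - 1) := mul_le_mul_of_nonneg_right hδL.le hL1.le
      linarith
    have h6 : 0 ≤ (L - s) / (L * (L - 1)) := div_nonneg (by linarith) (by positivity)
    rw [e, abs_le]
    constructor <;> linarith
  · have e : (L - s + 1) / L - (1 - σ) = -(s / L - σ) + 1 / L := by
      field_simp
      ring
    have h5 : 1 / L ≤ δ / 2 := by
      rw [div_le_iff₀ hL0]
      linarith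
    have h6 : 0 < 1 / L := by positivity
    rw [e, abs_le]
    constructor <;> linarith

lemma discrepancy_bound_le {L s σ : ℝ} (hσ : 0 < σ) (hσ1 : σ < 1) (hL : 2 ≤ L) (hs : 0 ≤ s)
    (hsu : s ≤ (1 - (1 - σ) / 2) * L) :
    2 / L + ((s + s ^ 2 / (L - s + 2)) / (L - 1) ^ 2) + 1 / (L - 1) ≤ 16 / (1 - σ) / L := by
  have h1σ : 0 < 1 - σ := by linarith
  have hL0 : 0 < L := by linarith
  have hL1 : L / 2 ≤ L - 1 := by linarith
  have hLs : (1 - σ) / 2 * L ≤ L - s + 2 := by linarith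
  have hpos : 0 < (1 - σ) / 2 * L := by positivity
  have hsL : s ≤ L := by linarith
  have b1 : 1 / (L - 1) ≤ 2 / L := by
    rw [div_le_div_iff₀ (by linarith) hL0]
    linarith
  have b2 : s ^ 2 / (L - s + 2) ≤ 2 * L / (1 - σ) := by
    rw [div_le_div_iff₀ (by linarith) h1σ]
    have h5 : s ^ 2 * (1 - σ) ≤ L ^ 2 * (1 - σ) :=
      mul_le_mul_of_nonneg_right (pow_le_pow_left₀ hs hsL 2) h1σ.le
    have h6 : 2 * L * ((1 - σ) / 2 * L) ≤ 2 * L * (L - s + 2) :=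
      mul_le_mul_of_nonneg_left hLs (by positivity)
    linarith
  have b3 : (s + s ^ 2 / (L - s + 2)) / (L - 1) ^ 2 ≤
      (L + 2 * L / (1 - σ)) / (L / 2) ^ 2 :=
    div_le_div₀ (by positivity) (by linarith) (by positivity)
      (pow_le_pow_left₀ (by positivity) hL1 2)
  have b4 : (L + 2 * L / (1 - σ)) / (L / 2) ^ 2 = (4 + 8 / (1 - σ)) / L := by
    field_simp
    ring
  have b5 : 8 ≤ 8 / (1 - σ) := by
    rw [le_div_iff₀ h1σ]
    linarith
  calc _ ≤ 2 / L + (4 + 8 / (1 - σ)) / L + 2 / L := by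
        rw [b4] at b3
        linarith
    _ = (8 + 8 / (1 - σ)) / L := by ring
    _ ≤ _ := by
      refine div_le_div_of_nonneg_right ?_ hL0.le
      have : 16 / (1 - σ) = 8 / (1 - σ) + 8 / (1 - σ) := by ring
      linarith

/-- The rate is a Lipschitz function of the random quantities, with a constant that depends on the
path gain only through the bound `K` for the figure of merit. -/
lemma abs_logb_ratio_sub_le {G D₀ K σ δ l a n S : ℝ} (hG : 0 ≤ G) (hD₀ : 0 ≤ D₀) (hD₀1 : D₀ ≤ 1)
    (hσ : 0 < σ) (hσ1 : σ ≤ 1) (hK : 0 ≤ K) (hGK : (1 + G) / (1 + G * D₀) ≤ 1 + K) (hδ : 0 < δ)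
    (hδ1 : δ ≤ 1) (hδK : 23 * δ / σ ≤ 1 / (2 * (1 + K))) (hl0 : 0 ≤ l) (ha0 : 0 ≤ a) (hn0 : 0 ≤ n)
    (hS0 : 0 ≤ S) (hl : |l - 1 / σ| ≤ δ) (ha : |a - 1| ≤ δ)
    (hn : |n - (1 - D₀) * (1 - σ)| ≤ 5 * δ) (hS : |S - D₀ * σ| ≤ 5 * δ) :
    |Real.logb 2 (1 + G * (l * a * n) / (1 + G * (l * a * S))) -
        limitRate σ (G * (1 - D₀) / (1 + G * D₀))| ≤
      2 * (2 * (1 + K) * (1 + (1 + K) / σ) * (23 * δ / σ)) := by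
  have h1 : 0 ≤ (1 - D₀) * (1 - σ) := mul_nonneg (by linarith) (by linarith)
  have h2 : (1 - D₀) * (1 - σ) ≤ 1 := mul_le_one₀ (by linarith) (by linarith) (by linarith)
  have hN := abs_mul_mul_sub_le hσ hσ1 hδ hδ1 hl ha hn h1 h2
  have hI := abs_mul_mul_sub_le hσ hσ1 hδ hδ1 hl ha hS (mul_nonneg hD₀ hσ.le)
    (mul_le_one₀ hD₀1 hσ.le hσ1)
  rw [mul_div_cancel_right₀ _ hσ.ne'] at hI
  have hfin := abs_ratio_sub_le hG hD₀ (div_nonneg h1 hσ.le)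
    (div_le_div_of_nonneg_right h2 hσ.le) hK hGK (by positivity) hδK hN hI
  have e : G * (1 - D₀) / (1 + G * D₀) * ((1 - σ) / σ) =
      G * ((1 - D₀) * (1 - σ) / σ) / (1 + G * D₀) := by ring
  have hN₀ : 0 ≤ G * ((1 - D₀) * (1 - σ) / σ) / (1 + G * D₀) := by positivity
  rw [limitRate, e]
  exact (abs_logb_one_add_sub_le (by positivity) hN₀).trans
    (mul_le_mul_of_nonneg_left hfin zero_le_two)

lemma measurable_quantizedChannels {L m : ℕ} {R : ℕ → ℕ} :
    Measurable fun ω : Sample L m R => quantizedChannels ω :=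
  measurable_pi_lambda _ fun j => measurable_quantize.comp
    (measurePreserving_user (L := L) (R := R) j).measurable

lemma measurable_user_comp {L m : ℕ} {R : ℕ → ℕ} (i : Fin m)
    {F : CVec L → (Fin m → CVec L) → ℝ}
    (hF : Measurable fun z : CVec L × (Fin m → CVec L) => F z.1 z.2) :
    Measurable fun ω : Sample L m R => F (ω.1 i) (quantizedChannels ω) := by
  have h1 : Measurable fun ω : Sample L m R => (ω.1 i, quantizedChannels ω) :=
    ((measurable_pi_apply i).comp measurable_fst).prodMk measurable_quantizedChannels
  have h2 := hF.comp h1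
  exact h2

/-- On the event that all deviations are small the rate is close to its limit. -/
lemma abs_rate_sub_limitRate_le {L m : ℕ} {A : Finset (Fin m)} {i : Fin m} (hi : i ∈ A)
    {G D₀ K σ δ : ℝ} {h : CVec L} {x : Fin m → CVec L} (hh : h ≠ 0) (hx : ‖x i‖ = 1)
    (hL : 0 < L) (hG : 0 ≤ G) (hD₀ : 0 ≤ D₀) (hD₀1 : D₀ ≤ 1) (hσ : 0 < σ) (hσ1 : σ ≤ 1)
    (hK : 0 ≤ K) (hGK : (1 + G) / (1 + G * D₀) ≤ 1 + K) (hδ : 0 < δ) (hδ1 : δ ≤ 1)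
    (hδK : 23 * δ / σ ≤ 1 / (2 * (1 + K))) (hdisc : discrepancy A i h x ≤ δ ^ 2)
    (hD : |‖quantizationError h (x i)‖ ^ 2 - D₀| ≤ δ) (h1 : |(L : ℝ) / A.card - 1 / σ| ≤ δ)
    (h2 : |((A.card : ℝ) - 1) / (L - 1) - σ| ≤ δ)
    (h3 : |((L : ℝ) - A.card + 1) / L - (1 - σ)| ≤ δ) :
    |Real.logb 2 (1 + sinr G A.card A i h x) - limitRate σ (G * (1 - D₀) / (1 + G * D₀))| ≤
      2 * (2 * (1 + K) * (1 + (1 + K) / σ) * (23 * δ / σ)) := by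
  set q := zfBeam A x i with hq
  set p := x i with hp
  set e := quantizationError h p with he
  set S := ∑ j ∈ A.erase i, ‖inner ℂ (zfBeam A x j) e‖ ^ 2 with hS
  set a := ‖h‖ ^ 2 / L with ha
  set D := ‖e‖ ^ 2 with hDdef
  have hL0 : (0 : ℝ) < L := by exact_mod_cast hL
  have hdisc' : (a - 1) ^ 2 + (S - D * ((A.card - 1) / (L - 1))) ^ 2 +
      (‖inner ℂ p q‖ ^ 2 - (L - A.card + 1) / L) ^ 2 + ‖inner ℂ q e‖ ^ 2 ≤ δ ^ 2 := hdisc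
  obtain ⟨ha1, hS1, hT1, hz1⟩ := abs_le_of_sq_add_le hδ.le hdisc'
  rw [abs_norm] at hz1
  have hq1 : ‖q‖ ≤ 1 := norm_zfBeam_le_one A x i
  have hDn : D = 1 - ‖inner ℂ (direction h) p‖ ^ 2 := norm_quantizationError_sq hh hx
  set α := ‖inner ℂ (direction h) p‖ with hα
  have hv1 : ‖direction h‖ = 1 := norm_direction hh
  have hα1 : α ≤ 1 := (norm_inner_le_norm _ _).trans (by rw [hv1, hx, one_mul])
  have hα0 : 0 ≤ α := norm_nonneg _
  set τ := ‖inner ℂ p q‖ with hτ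
  have hτ1 : τ ≤ 1 := (norm_inner_le_norm _ _).trans (by rw [hx, one_mul]; exact hq1)
  have hτ0 : 0 ≤ τ := norm_nonneg _
  have hD0 : 0 ≤ D := by positivity
  have hD1 : D ≤ 1 := by
    rw [hDn]
    exact sub_le_self _ (by positivity)
  set n := ‖inner ℂ (direction h) q‖ with hn
  have hn0 : 0 ≤ n := norm_nonneg _
  have hn1 : n ≤ 1 := (norm_inner_le_norm _ _).trans (by rw [hv1, one_mul]; exact hq1)
  -- the signal is carried by the component of the channel along the reported codeword
  have hnα : |n - α * τ| ≤ δ := by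
    have e1 : inner ℂ q (direction h) = inner ℂ p (direction h) * inner ℂ q p + inner ℂ q e := by
      rw [he, quantizationError, inner_sub_right, inner_smul_right]
      ring
    have e2 : α * τ = ‖inner ℂ p (direction h) * inner ℂ q p‖ := by
      rw [norm_mul, hα, hτ, norm_inner_symm (direction h), norm_inner_symm p q]
    rw [hn, norm_inner_symm, e1, e2]
    refine (abs_norm_sub_norm_le _ _).trans ?_
    rwa [add_sub_cancel_left]
  have hn3 := abs_signal_sub_le hn0 hn1 hα0 hα1 hτ0 hτ1 hDn hnα hD hT1 h3 hD₀ hD₀1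
  have hS3 := abs_interference_sub_le hD0 hD1 hσ.le hσ1 hS1 hD h2
  have hS0 : 0 ≤ S := Finset.sum_nonneg fun j _ => by positivity
  have e1 : sinr G A.card A i h x = G * (L / A.card * a * n ^ 2) /
      (1 + G * (L / A.card * a * S)) := by
    rw [sinr_eq hi]
    have : (‖h‖ ^ 2 / A.card : ℝ) = L / A.card * a := by
      rw [ha]
      field_simp
    rw [this]
    congr 1 <;> ring
  rw [e1]
  exact abs_logb_ratio_sub_le hG hD₀ hD₀1 hσ hσ1 hK hGK hδ hδ1 hδK (by positivity) (by positivity)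
    (sq_nonneg n) hS0 h1 ha1 hn3 hS3

/-- In the regime `s / L → σ ∈ (0, 1)` the rate of an on-user converges in mean to its limit,
uniformly over the users whose figure of merit is at most `K`. -/
lemma exists_lintegral_rate_sub_le {σ K ε : ℝ} (hσ : 0 < σ) (hσ1 : σ < 1) (hK : 0 ≤ K)
    (hε : 0 < ε) : ∃ ε' > 0, ∃ L₀ : ℕ, ∀ L ≥ L₀, ∀ (m : ℕ) (R : ℕ → ℕ) (A : Finset (Fin m)),
      ∀ i ∈ A, ∀ G b : ℝ, 0 ≤ G → 0 ≤ b → |(A.card : ℝ) / L - σ| < ε' →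
        |(R i : ℝ) / L - b| < ε' → (1 + G) / (1 + G * (2 : ℝ) ^ (-b)) ≤ 1 + K →
        ∫⁻ ω, ENNReal.ofReal |Real.logb 2 (1 + sinr G A.card A i (ω.1 i) (quantizedChannels ω)) -
          limitRate σ (G * (1 - (2 : ℝ) ^ (-b)) / (1 + G * (2 : ℝ) ^ (-b)))| ∂sampleLaw L m R ≤
        ENNReal.ofReal ε := by
  set C : ℝ := 2 * (2 * (1 + K) * (1 + (1 + K) / σ)) * (23 / σ) with hC
  have hCpos : 0 < C := by positivity
  -- the level of the linear bound for the rate, high enough for the fractional moment to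
  -- contribute `ε / 4` only
  set l : ℝ := 16 * (40 * (2 / σ) * (1 + K)) * (4 / ε) with hl
  have hlpos : 0 < l := by positivity
  set F : ℝ := limitRate σ K with hF
  have hσ' : 0 ≤ (1 - σ) / σ := div_nonneg (by linarith) hσ.le
  have hF0 : 0 ≤ F := logb_one_add_nonneg (mul_nonneg hK hσ')
  set M : ℝ := F + 16 * l with hM
  have hMpos : 0 < M := by positivity
  obtain ⟨δ, hδ, hδ1, hδK, hδC, hδM⟩ : ∃ δ : ℝ, 0 < δ ∧ δ < 1 ∧
      23 * δ / σ ≤ 1 / (2 * (1 + K)) ∧ C * δ ≤ ε / 4 ∧ M * δ ≤ ε / 4 := by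
    refine ⟨min (1 / 2) (min (σ / (46 * (1 + K))) (min (ε / 4 / C) (ε / 4 / M))),
      by positivity, (min_le_left _ _).trans_lt (by norm_num), ?_, ?_, ?_⟩
    · have : min (1 / 2) (min (σ / (46 * (1 + K))) (min (ε / 4 / C) (ε / 4 / M))) ≤
        σ / (46 * (1 + K)) := (min_le_right _ _).trans (min_le_left _ _)
      rw [le_div_iff₀ (by positivity)] at this
      rw [div_le_div_iff₀ hσ (by positivity)]
      linarith
    · have : min (1 / 2) (min (σ / (46 * (1 + K))) (min (ε / 4 / C) (ε / 4 / M))) ≤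
        ε / 4 / C := (min_le_right _ _).trans ((min_le_right _ _).trans (min_le_left _ _))
      rw [le_div_iff₀ hCpos] at this
      linarith
    · have : min (1 / 2) (min (σ / (46 * (1 + K))) (min (ε / 4 / C) (ε / 4 / M))) ≤
        ε / 4 / M := (min_le_right _ _).trans ((min_le_right _ _).trans (min_le_right _ _))
      rw [le_div_iff₀ hMpos] at this
      linarith
  obtain ⟨ε₁, hε₁, L₁, hL₁⟩ := distortion_concentration hδ hδ1
  have h1σ : 0 < 1 - σ := by linarith
  set ε' : ℝ := min (min ε₁ 1) (min (min (δ / 2) (σ / 2)) (min (δ * σ ^ 2 / 2) ((1 - σ) / 2)))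
    with hε'
  obtain ⟨N, hN⟩ := exists_nat_gt (max (max (4 / σ) (4 / δ))
    (M / δ ^ 2 * (16 / (1 - σ)) * (4 / ε)))
  refine ⟨ε', by positivity, max L₁ (max N 2), ?_⟩
  intro L hL m R A i hi G b hG hb hs hr hGK
  have hLL₁ : L₁ ≤ L := (le_max_left _ _).trans hL
  have hLN : N ≤ L := (le_max_left _ _).trans ((le_max_right _ _).trans hL)
  have hL2 : 2 ≤ L := (le_max_right _ _).trans ((le_max_right _ _).trans hL)
  have hLN' : (N : ℝ) ≤ L := by exact_mod_cast hLN
  have hL2' : (2 : ℝ) ≤ L := by exact_mod_cast hL2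
  have hL0 : (0 : ℝ) < L := by linarith
  have hLσ : 4 / σ < L := ((le_max_left _ _).trans (le_max_left _ _)).trans_lt (hN.trans_le hLN')
  have hLδ : 4 / δ < L := ((le_max_right _ _).trans (le_max_left _ _)).trans_lt (hN.trans_le hLN')
  have hLM : M / δ ^ 2 * (16 / (1 - σ)) * (4 / ε) < L :=
    (le_max_right _ _).trans_lt (hN.trans_le hLN')
  have hε'1 : ε' ≤ ε₁ := (min_le_left _ _).trans (min_le_left _ _)
  have hε'1' : ε' ≤ 1 := (min_le_left _ _).trans (min_le_right _ _)
  have hε'2 : ε' ≤ δ / 2 := (min_le_right _ _).trans ((min_le_left _ _).trans (min_le_left _ _))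
  have hε'3 : ε' ≤ σ / 2 := (min_le_right _ _).trans ((min_le_left _ _).trans (min_le_right _ _))
  have hε'4 : ε' ≤ δ * σ ^ 2 / 2 :=
    (min_le_right _ _).trans ((min_le_right _ _).trans (min_le_left _ _))
  have hε'5 : ε' ≤ (1 - σ) / 2 :=
    (min_le_right _ _).trans ((min_le_right _ _).trans (min_le_right _ _))
  clear_value ε'
  obtain ⟨hs1, hs2⟩ := abs_lt.1 hs
  have hsl : σ / 2 * L ≤ (A.card : ℝ) := by
    rw [← le_div_iff₀ hL0]
    linarith
  have hsu : (A.card : ℝ) ≤ (1 - (1 - σ) / 2) * L := by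
    rw [← div_le_iff₀ hL0]
    linarith
  have hs2' : 2 ≤ (A.card : ℝ) := by
    rw [div_lt_iff₀ hσ] at hLσ
    linarith
  have hA2 : 2 ≤ A.card := by exact_mod_cast hs2'
  have hsL : (A.card : ℝ) ≤ L := by
    have := mul_pos (half_pos h1σ) hL0
    linarith
  have hAL : A.card ≤ L := by exact_mod_cast hsL
  have hs0 : 0 < (A.card : ℝ) := by linarith
  set D₀ : ℝ := (2 : ℝ) ^ (-b) with hD₀
  have hD₀pos : 0 < D₀ := Real.rpow_pos_of_pos two_pos _
  have hD₀1 : D₀ ≤ 1 := Real.rpow_le_one_of_one_le_of_nonpos one_le_two (by linarith)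
  have hη : 0 ≤ G * (1 - D₀) / (1 + G * D₀) :=
    div_nonneg (mul_nonneg hG (by linarith)) (by positivity)
  set f := limitRate σ (G * (1 - D₀) / (1 + G * D₀)) with hf
  have hf0 : 0 ≤ f := logb_one_add_nonneg (mul_nonneg hη hσ')
  have hfF : f ≤ F := by
    refine logb_one_add_mono (mul_nonneg hη hσ') (mul_le_mul_of_nonneg_right ?_ hσ')
    have := one_add_eta hG hD₀pos.le
    linarith
  have hδL : 4 < δ * L := by
    rw [div_lt_iff₀ hδ] at hLδ
    linarith
  obtain ⟨hc1, hc2, hc3⟩ := load_estimates hσ hL2' hsl hsL hδL hs hε'2 hε'4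
  have hiso := isIsotropic_isotropicLaw (L := L) (by omega)
  -- the three error terms: the distortion, the discrepancy and the fractional moment
  have hprobs : sampleLaw L m R {ω | δ < |distortion (ω.1 i) (ω.2 i) - D₀|} ≤
      ENNReal.ofReal δ := by
    have hms : MeasurableSet {y : CVec L × (Fin (2 ^ R i) → CVec L) |
        δ < |distortion y.1 y.2 - D₀|} :=
      measurableSet_lt measurable_const
        (measurable_distortion.sub_const D₀).abs
    have e := (measurePreserving_user (L := L) (R := R) i).measure_preimage hms.nullMeasurableSet
    refine (le_of_eq e).trans ?_
    rw [userLaw, Measure.prod_apply hms]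
    calc _ ≤ ∫⁻ _ : CVec L, ENNReal.ofReal δ ∂channelLaw L := by
          refine lintegral_mono_ae ?_
          filter_upwards [channelLaw_ne_zero (by omega : 0 < L)] with h hh
          exact hL₁ L hLL₁ (R i) b hb (hr.trans_le hε'1) h hh
      _ = _ := by rw [lintegral_const, measure_univ, mul_one]
  have hdisc := lintegral_discrepancy_le (R := R) hAL hL2 hi
  have hmom := lintegral_sinr_rpow_le (R := R) hAL hA2 hi hG hb (by
    have h5 : (R i : ℝ) / L ≤ b + 1 := by linarith [(abs_lt.1 hr).2]
    rw [div_le_iff₀ hL0] at h5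
    linarith)
  have hdiscm : Measurable fun ω : Sample L m R =>
      discrepancy A i (ω.1 i) (quantizedChannels ω) :=
    measurable_user_comp i (F := discrepancy A i) (measurable_discrepancy A i)
  have hsm : Measurable fun ω : Sample L m R =>
      sinr G A.card A i (ω.1 i) (quantizedChannels ω) :=
    measurable_user_comp i (F := sinr G A.card A i) (measurable_sinr G A.card A i)
  set bad : Set (Sample L m R) := {ω | δ < |distortion (ω.1 i) (ω.2 i) - D₀|} with hbad
  have hbadm : MeasurableSet bad :=
    measurableSet_lt measurable_const ((measurable_distortion.comp
      (measurePreserving_user (L := L) (R := R) i).measurable).sub_const D₀).abs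
  -- away from two rare events the rate is close to its limit; on these events it is bounded by `M`
  -- up to a small multiple of a fractional power of the ratio
  have hpoint : ∀ᵐ ω ∂sampleLaw L m R,
      ENNReal.ofReal |Real.logb 2 (1 + sinr G A.card A i (ω.1 i) (quantizedChannels ω)) - f| ≤
        ENNReal.ofReal (ε / 4) + (ENNReal.ofReal M * bad.indicator 1 ω +
          (ENNReal.ofReal (M / δ ^ 2) *
            ENNReal.ofReal (discrepancy A i (ω.1 i) (quantizedChannels ω)) +
          ENNReal.ofReal (16 / l) * ENNReal.ofReal
            (sinr G A.card A i (ω.1 i) (quantizedChannels ω) ^ (1 / 4 : ℝ)))) := by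
    have hh0 : ∀ᵐ ω ∂sampleLaw L m R, ω.1 i ≠ 0 :=
      (measurePreserving_user (R := R) i).quasiMeasurePreserving.ae
        (Measure.quasiMeasurePreserving_fst.ae (channelLaw_ne_zero (by omega)) :
          ∀ᵐ y ∂userLaw L (R i), y.1 ≠ 0)
    have hp1 : ∀ᵐ ω ∂sampleLaw L m R, ‖quantize (ω.2 i) (ω.1 i)‖ = 1 :=
      (measurePreserving_user (R := R) i).quasiMeasurePreserving.ae
        (ae_userLaw_quantize (s := {x | ‖x‖ = 1}) hiso.norm_eq_one)
    filter_upwards [hh0, hp1] with ω hω0 hω1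
    set X := sinr G A.card A i (ω.1 i) (quantizedChannels ω) with hX
    have hX0 : 0 ≤ X := sinr_nonneg hG _ _ _ _ _
    have hXr : 0 ≤ X ^ (1 / 4 : ℝ) := Real.rpow_nonneg hX0 _
    set Q := discrepancy A i (ω.1 i) (quantizedChannels ω) with hQ
    have hQ0 : 0 ≤ Q := discrepancy_nonneg _ _ _ _
    have hbound : |Real.logb 2 (1 + X) - f| ≤ M + 16 / l * X ^ (1 / 4 : ℝ) := by
      have h5 := logb_one_add_le_of_pos hX0 hlpos
      have h6 := logb_one_add_nonneg hX0
      rw [abs_le]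
      constructor <;> linarith
    by_cases hb1 : ω ∈ bad
    · rw [Set.indicator_of_mem hb1, Pi.one_apply, mul_one]
      refine (ENNReal.ofReal_le_ofReal hbound).trans ?_
      rw [ENNReal.ofReal_add hMpos.le (by positivity), ENNReal.ofReal_mul (by positivity)]
      exact (add_le_add le_rfl le_add_self).trans le_add_self
    by_cases hb2 : Q ≤ δ ^ 2
    · have hnb : |distortion (ω.1 i) (ω.2 i) - D₀| ≤ δ := not_lt.1 hb1
      rw [← norm_quantizationError_quantize_sq hω0 hω1] at hnb
      have h5 := abs_rate_sub_limitRate_le hi (x := quantizedChannels ω) hω0 hω1 (by omega) hG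
        hD₀pos.le hD₀1 hσ hσ1.le hK hGK hδ hδ1.le hδK hb2 hnb hc1 hc2 hc3
      refine (ENNReal.ofReal_le_ofReal (h5.trans ?_)).trans le_self_add
      refine le_trans (le_of_eq ?_) hδC
      rw [hC]
      ring
    · have hb2' : δ ^ 2 < Q := not_le.1 hb2
      refine (ENNReal.ofReal_le_ofReal hbound).trans ?_
      have h5 : M ≤ M / δ ^ 2 * Q := by
        rw [div_mul_eq_mul_div, le_div_iff₀ (by positivity)]
        exact mul_le_mul_of_nonneg_left hb2'.le hMpos.le
      rw [ENNReal.ofReal_add hMpos.le (by positivity), ENNReal.ofReal_mul (by positivity : 0 ≤ 16 / l)]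
      refine le_trans ?_ (le_add_self.trans le_add_self)
      refine add_le_add ?_ le_rfl
      rw [← ENNReal.ofReal_mul (by positivity)]
      exact ENNReal.ofReal_le_ofReal h5
  refine (lintegral_mono_ae hpoint).trans ?_
  rw [lintegral_add_left measurable_const, lintegral_const, measure_univ, mul_one,
    lintegral_add_left ((measurable_one.indicator hbadm).const_mul _),
    lintegral_add_left (hdiscm.ennreal_ofReal.const_mul _),
    lintegral_const_mul _ (measurable_one.indicator hbadm), lintegral_indicator_one hbadm,
    lintegral_const_mul _ hdiscm.ennreal_ofReal,
    lintegral_const_mul _ (hsm.pow_const _).ennreal_ofReal]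
  have t1 : ENNReal.ofReal M * sampleLaw L m R bad ≤ ENNReal.ofReal (ε / 4) := by
    refine (mul_le_mul_right hprobs _).trans ?_
    rw [← ENNReal.ofReal_mul hMpos.le]
    exact ENNReal.ofReal_le_ofReal hδM
  have t2 : ENNReal.ofReal (M / δ ^ 2) * ∫⁻ ω, ENNReal.ofReal
      (discrepancy A i (ω.1 i) (quantizedChannels ω)) ∂sampleLaw L m R ≤
        ENNReal.ofReal (ε / 4) := by
    refine (mul_le_mul_right hdisc _).trans ?_
    rw [← ENNReal.ofReal_mul (by positivity)]
    refine ENNReal.ofReal_le_ofReal ?_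
    have h5 := discrepancy_bound_le hσ hσ1 hL2' hs0.le hsu
    calc _ ≤ M / δ ^ 2 * (16 / (1 - σ) / L) := mul_le_mul_of_nonneg_left h5 (by positivity)
      _ = M / δ ^ 2 * (16 / (1 - σ)) / L := by ring
      _ ≤ _ := by
        rw [div_le_iff₀ hL0]
        have : M / δ ^ 2 * (16 / (1 - σ)) =
          M / δ ^ 2 * (16 / (1 - σ)) * (4 / ε) * (ε / 4) := by
            field_simp
        have h6 := mul_le_mul_of_nonneg_right hLM.le (by positivity : 0 ≤ ε / 4)
        linarith only [h6, this]
  have t3 : ENNReal.ofReal (16 / l) * ∫⁻ ω, ENNReal.ofReal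
      (sinr G A.card A i (ω.1 i) (quantizedChannels ω) ^ (1 / 4 : ℝ)) ∂sampleLaw L m R ≤
        ENNReal.ofReal (ε / 4) := by
    refine (mul_le_mul_right hmom _).trans ?_
    rw [← ENNReal.ofReal_mul (by positivity)]
    refine ENNReal.ofReal_le_ofReal ?_
    have h5 : (((L : ℝ) - (A.card : ℝ) + 1) / (A.card : ℝ)) ^ (1 / 4 : ℝ) ≤ 2 / σ := by
      have h6 : ((L : ℝ) - (A.card : ℝ) + 1) / (A.card : ℝ) ≤ 2 / σ := by
        rw [div_le_div_iff₀ hs0 hσ]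
        have h7 : 0 ≤ ((A.card : ℝ) - 1) * σ := mul_nonneg (by linarith only [hs2']) hσ.le
        linarith only [h7, hsl]
      have h7 : 1 ≤ 2 / σ := by
        rw [le_div_iff₀ hσ]
        linarith only [hσ1]
      calc _ ≤ (2 / σ) ^ (1 / 4 : ℝ) :=
            Real.rpow_le_rpow (div_nonneg (by linarith) hs0.le) h6 (by norm_num)
        _ ≤ _ := Real.rpow_le_self_of_one_le h7 (by norm_num)
    calc _ ≤ 16 / l * (40 * (2 / σ) * (1 + K)) := by
          have h8 : 0 ≤ (1 + G) / (1 + G * D₀) := by positivity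
          gcongr
      _ = ε / 4 := by
        rw [hl]
        field_simp
  refine (add_le_add le_rfl (add_le_add t1 (add_le_add t2 t3))).trans ?_
  rw [← ENNReal.ofReal_add (by positivity) (by positivity),
    ← ENNReal.ofReal_add (by positivity) (by positivity),
    ← ENNReal.ofReal_add (by positivity) (by positivity)]
  refine ENNReal.ofReal_le_ofReal (le_of_eq ?_)
  ring

/-! ### Mean rates -/

/-- The mean rate of user `i` when the users in `A` are on; `G = ρ γ_i`. -/
def meanRate (L m : ℕ) (R : ℕ → ℕ) (G : ℝ) (A : Finset (Fin m)) (i : Fin m) : ℝ :=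
  ∫ ω, Real.logb 2 (1 + sinr G A.card A i (ω.1 i) (quantizedChannels ω)) ∂sampleLaw L m R

/-- With `t = X ^ (1 / 4)`, the rate is at most `4 log₂ (1 + t)`, a concave function of `t`; this is
a linear bound for it at the scale `B`. -/
lemma logb_one_add_le_add_rpow {X B : ℝ} (hX : 0 ≤ X) (hB : 1 ≤ B) :
    Real.logb 2 (1 + X) ≤ 4 * Real.logb 2 B + 8 / B * X ^ (1 / 4 : ℝ) := by
  have hB0 : 0 < B := by linarith
  obtain ⟨t, ht0, htX, ht⟩ : ∃ t : ℝ, 0 ≤ t ∧ X = t ^ 4 ∧ X ^ (1 / 4 : ℝ) = t :=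
    ⟨X ^ (1 / 4 : ℝ), Real.rpow_nonneg hX _, by
      rw [← Real.rpow_natCast, ← Real.rpow_mul hX]
      norm_num, rfl⟩
  rw [ht]
  have h1 : 1 + X ≤ (1 + t) ^ 4 := by
    rw [htX]
    have : 0 ≤ 4 * t + 6 * t ^ 2 + 4 * t ^ 3 := by positivity
    linarith [show (1 + t) ^ 4 = 1 + t ^ 4 + (4 * t + 6 * t ^ 2 + 4 * t ^ 3) by ring]
  have h2 : 1 + t ≤ B * (1 + t / B) := by
    rw [mul_add, mul_one, mul_div_cancel₀ _ hB0.ne']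
    linarith
  have h3 : 0 ≤ t / B := by positivity
  calc Real.logb 2 (1 + X) ≤ Real.logb 2 ((1 + t) ^ 4) :=
        Real.logb_le_logb_of_le one_lt_two (by positivity) h1
    _ = 4 * Real.logb 2 (1 + t) := by rw [Real.logb_pow]; norm_num
    _ ≤ 4 * Real.logb 2 (B * (1 + t / B)) := by
        have := Real.logb_le_logb_of_le one_lt_two (by positivity) h2
        linarith
    _ = 4 * (Real.logb 2 B + Real.logb 2 (1 + t / B)) := by
        rw [Real.logb_mul hB0.ne' (by positivity)]
    _ ≤ 4 * (Real.logb 2 B + 2 * (t / B)) := by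
        have := logb_one_add_le_two_mul h3
        linarith
    _ = _ := by ring

section MeanRate

variable {L m : ℕ} {R : ℕ → ℕ} {G : ℝ} {A : Finset (Fin m)} {i : Fin m}

lemma sinr_le (hG : 0 ≤ G) (s : ℕ) (A : Finset (Fin m)) (i : Fin m) (h : CVec L)
    (x : Fin m → CVec L) : sinr G s A i h x ≤ G / s * ‖h‖ ^ 2 := by
  unfold sinr
  have h1 : ‖inner ℂ h (zfBeam A x i)‖ ≤ ‖h‖ :=
    (norm_inner_le_norm _ _).trans
      (mul_le_of_le_one_right (norm_nonneg _) (norm_zfBeam_le_one A x i))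
  have h2 : 0 ≤ G / s * ∑ j ∈ A.erase i, ‖inner ℂ h (zfBeam A x j)‖ ^ 2 := by positivity
  calc _ ≤ G / s * ‖inner ℂ h (zfBeam A x i)‖ ^ 2 :=
        div_le_self (by positivity) (by linarith)
    _ ≤ _ := mul_le_mul_of_nonneg_left (pow_le_pow_left₀ (norm_nonneg _) h1 2) (by positivity)

lemma measurable_rate (G : ℝ) (s : ℕ) (A : Finset (Fin m)) (i : Fin m) :
    Measurable fun ω : Sample L m R =>
      Real.logb 2 (1 + sinr G s A i (ω.1 i) (quantizedChannels ω)) :=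
  (Real.measurable_log.comp (measurable_const.add
    (measurable_user_comp i (F := sinr G s A i) (measurable_sinr G s A i)))).div_const _

lemma integrable_rate (hG : 0 ≤ G) (s : ℕ) (A : Finset (Fin m)) (i : Fin m) :
    Integrable (fun ω : Sample L m R =>
      Real.logb 2 (1 + sinr G s A i (ω.1 i) (quantizedChannels ω))) (sampleLaw L m R) := by
  refine ⟨(measurable_rate G s A i).aestronglyMeasurable, ?_⟩
  rw [hasFiniteIntegral_iff_ofReal (Eventually.of_forall fun ω =>
    logb_one_add_nonneg (sinr_nonneg hG _ _ _ _ _))]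
  have h1 : ∫⁻ ω, ENNReal.ofReal (2 * (G / s) * ‖ω.1 i‖ ^ 2) ∂sampleLaw L m R < ⊤ := by
    have hm : Measurable fun y : CVec L × (Fin (2 ^ R i) → CVec L) =>
        ENNReal.ofReal (2 * (G / s) * ‖y.1‖ ^ 2) := by fun_prop
    rw [(measurePreserving_user (L := L) (R := R) i).lintegral_comp hm]
    refine (lintegral_prod_le _).trans_lt ?_
    simp_rw [lintegral_const, measure_univ, mul_one,
      ENNReal.ofReal_mul (by positivity : 0 ≤ 2 * (G / s))]
    rw [lintegral_const_mul _ (by fun_prop), lintegral_norm_sq_channelLaw]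
    exact ENNReal.mul_lt_top ENNReal.ofReal_lt_top ENNReal.ofReal_lt_top
  refine lt_of_le_of_lt (lintegral_mono fun ω => ENNReal.ofReal_le_ofReal ?_) h1
  refine (logb_one_add_le_two_mul (sinr_nonneg hG _ _ _ _ _)).trans ?_
  have := sinr_le hG s A i (ω.1 i) (quantizedChannels ω)
  linarith

lemma throughput_eq (ρ : ℝ) (γ : ℕ → ℝ) (s : ℕ) (A : Finset (Fin m)) (ω : Sample L m R) :
    throughput ρ γ s A ω = 1 / (L : ℝ) * ∑ i ∈ A,
      Real.logb 2 (1 + sinr (ρ * γ i) s A i (ω.1 i) (quantizedChannels ω)) := by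
  unfold throughput
  congr 1
  refine Finset.sum_congr rfl fun i _ => ?_
  congr 2
  unfold signalPower interferencePower sinr
  rw [div_mul_eq_mul_div]

lemma integrable_throughput {ρ : ℝ} (hρ : 0 ≤ ρ) {γ : ℕ → ℝ} (hγ : ∀ i, 0 ≤ γ i) (s : ℕ)
    (A : Finset (Fin m)) :
    Integrable (fun ω => throughput ρ γ s A ω) (sampleLaw L m R) := by
  simp_rw [throughput_eq]
  exact (integrable_finsetSum _ fun i _ =>
    integrable_rate (mul_nonneg hρ (hγ _)) s A i).const_mul _

lemma integral_throughput {ρ : ℝ} (hρ : 0 ≤ ρ) {γ : ℕ → ℝ} (hγ : ∀ i, 0 ≤ γ i)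
    (A : Finset (Fin m)) :
    ∫ ω, throughput ρ γ A.card A ω ∂sampleLaw L m R =
      1 / (L : ℝ) * ∑ i ∈ A, meanRate L m R (ρ * γ i) A i := by
  simp_rw [throughput_eq]
  rw [integral_const_mul, integral_finsetSum _ fun i _ =>
    integrable_rate (mul_nonneg hρ (hγ _)) A.card A i]
  rfl

lemma meanRate_nonneg (hG : 0 ≤ G) : 0 ≤ meanRate L m R G A i :=
  integral_nonneg fun _ => logb_one_add_nonneg (sinr_nonneg hG _ _ _ _ _)

/-- With more on-users than antennas every zero-forcing beam vanishes. -/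
lemma meanRate_eq_zero (hL : 0 < L) (hA : L < A.card) (hi : i ∈ A) :
    meanRate L m R G A i = 0 := by
  refine integral_eq_zero_of_ae ?_
  have hν : ∀ j : Fin m, IsIsotropic (quantizedLaw L (R j)) := fun j =>
    isIsotropic_quantizedLaw hL _
  have hm : Measurable fun z : Fin m → CVec L => ENNReal.ofReal ‖zfBeam A z i‖ :=
    (measurable_zfBeam A i).norm.ennreal_ofReal
  have h1 : ∫⁻ ω, ENNReal.ofReal ‖zfBeam A (quantizedChannels ω) i‖ ∂sampleLaw L m R = 0 := by
    rw [lintegral_sampleLaw i (H := fun _ x => ENNReal.ofReal ‖zfBeam A x i‖)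
      (hm.comp measurable_snd)]
    have h2 : ∀ p : CVec L, ∫⁻ x, ENNReal.ofReal ‖zfBeam A (Function.update x i p) i‖
        ∂(Measure.pi fun j : Fin m => quantizedLaw L (R j)) = 0 := by
      intro p
      refine (lintegral_congr_ae ?_).trans lintegral_zero
      filter_upwards [ae_zfBeam_eq_zero hν hA hi p] with x hx
      rw [hx]
      simp
    simp_rw [h2, lintegral_zero]
  have h2 := (lintegral_eq_zero_iff (hm.comp measurable_quantizedChannels)).1 h1
  filter_upwards [h2] with ω hω
  have h3 : ENNReal.ofReal ‖zfBeam A (quantizedChannels ω) i‖ = 0 := hω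
  rw [ENNReal.ofReal_eq_zero] at h3
  have h4 : zfBeam A (quantizedChannels ω) i = 0 := norm_le_zero_iff.1 h3
  simp [sinr, h4]

lemma meanRate_le_of_lintegral {u : ℝ} {Z : Sample L m R → ℝ} {B c d : ℝ} (hG : 0 ≤ G)
    (hZ : Measurable Z) (hZ0 : ∀ ω, 0 ≤ Z ω) (hc : 0 ≤ c) (hd : 0 ≤ d) (hB : 0 ≤ B)
    (hle : ∀ ω : Sample L m R,
      Real.logb 2 (1 + sinr G A.card A i (ω.1 i) (quantizedChannels ω)) ≤ c + d * Z ω)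
    (hint : ∫⁻ ω, ENNReal.ofReal (Z ω) ∂sampleLaw L m R ≤ ENNReal.ofReal B)
    (hu : c + d * B ≤ u) : meanRate L m R G A i ≤ u := by
  refine le_trans ?_ hu
  rw [meanRate, integral_eq_lintegral_of_nonneg_ae (Eventually.of_forall fun ω =>
    logb_one_add_nonneg (sinr_nonneg hG _ _ _ _ _))
    (measurable_rate G A.card A i).aestronglyMeasurable]
  refine ENNReal.toReal_le_of_le_ofReal (by positivity) ?_
  calc _ ≤ ∫⁻ ω, (ENNReal.ofReal c + ENNReal.ofReal d * ENNReal.ofReal (Z ω))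
          ∂sampleLaw L m R := by
        refine lintegral_mono fun ω => (ENNReal.ofReal_le_ofReal (hle ω)).trans ?_
        rw [ENNReal.ofReal_add hc (mul_nonneg hd (hZ0 ω)), ENNReal.ofReal_mul hd]
    _ = ENNReal.ofReal c + ENNReal.ofReal d * ∫⁻ ω, ENNReal.ofReal (Z ω) ∂sampleLaw L m R := by
        rw [lintegral_add_left measurable_const, lintegral_const, measure_univ, mul_one,
          lintegral_const_mul _ hZ.ennreal_ofReal]
    _ ≤ ENNReal.ofReal c + ENNReal.ofReal d * ENNReal.ofReal B :=
        add_le_add le_rfl (mul_le_mul_right hint _)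
    _ = _ := by
        rw [← ENNReal.ofReal_mul hd, ← ENNReal.ofReal_add hc (mul_nonneg hd hB)]

variable {b : ℝ}

/-- Effective when `s / L` is close to `1`, where the first factor is small. -/
lemma meanRate_le_rpow (hA : A.card ≤ L) (hA2 : 2 ≤ A.card) (hi : i ∈ A) (hG : 0 ≤ G)
    (hb : 0 ≤ b) (hr : (R i : ℝ) ≤ L * (b + 1)) :
    meanRate L m R G A i ≤ 320 * (((L : ℝ) - A.card + 1) / A.card) ^ (1 / 4 : ℝ) *
      ((1 + G) / (1 + G * (2 : ℝ) ^ (-b))) := by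
  have hs0 : (0 : ℝ) < A.card := by exact_mod_cast (by omega : 0 < A.card)
  have hsL : (A.card : ℝ) ≤ L := by exact_mod_cast hA
  have h0 : 0 ≤ ((L : ℝ) - A.card + 1) / A.card := div_nonneg (by linarith) hs0.le
  have hZm : Measurable fun ω : Sample L m R =>
      sinr G A.card A i (ω.1 i) (quantizedChannels ω) ^ (1 / 4 : ℝ) :=
    (measurable_user_comp i (F := sinr G A.card A i) (measurable_sinr G A.card A i)).pow_const _
  refine meanRate_le_of_lintegral (c := 0) (d := 8) hG hZm
    (fun ω => Real.rpow_nonneg (sinr_nonneg hG _ _ _ _ _) _) le_rfl (by norm_num) (by positivity)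
    (fun ω => ?_) (lintegral_sinr_rpow_le hA hA2 hi hG hb hr) (le_of_eq (by ring))
  have := logb_one_add_le_rpow (sinr_nonneg hG A.card A i (ω.1 i) (quantizedChannels ω))
    (by norm_num : (1 : ℝ) ≤ 4)
  linarith

/-- Effective for large `η` and for small `s / L`: the mean rate grows at most logarithmically in
`η` and in `L / s`. -/
lemma meanRate_le_logb (hA : A.card ≤ L) (hA2 : 2 ≤ A.card) (hi : i ∈ A) (hG : 0 ≤ G)
    (hb : 0 ≤ b) (hr : (R i : ℝ) ≤ L * (b + 1)) :
    meanRate L m R G A i ≤ 32 + Real.logb 2 (L / A.card) +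
      4 * Real.logb 2 ((1 + G) / (1 + G * (2 : ℝ) ^ (-b))) := by
  have hs0 : (0 : ℝ) < A.card := by exact_mod_cast (by omega : 0 < A.card)
  have hs1 : (1 : ℝ) ≤ A.card := by exact_mod_cast (by omega : 1 ≤ A.card)
  have hsL : (A.card : ℝ) ≤ L := by exact_mod_cast hA
  have hL0 : (0 : ℝ) < L := by linarith
  set E : ℝ := (1 + G) / (1 + G * (2 : ℝ) ^ (-b)) with hE
  have hD₀1 : (2 : ℝ) ^ (-b) ≤ 1 := Real.rpow_le_one_of_one_le_of_nonpos one_le_two (by linarith)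
  have hE1 : 1 ≤ E := by
    rw [hE, one_le_div (by positivity)]
    have := mul_le_mul_of_nonneg_left hD₀1 hG
    linarith
  have hr1 : 1 ≤ (L : ℝ) / A.card := by rwa [one_le_div hs0]
  have hq1 : 1 ≤ ((L : ℝ) / A.card) ^ (1 / 4 : ℝ) := Real.one_le_rpow hr1 (by norm_num)
  set B : ℝ := 40 * ((L : ℝ) / A.card) ^ (1 / 4 : ℝ) * E with hB
  have hB1 : 1 ≤ B := by
    rw [hB]
    nlinarith [mul_le_mul hq1 hE1 zero_le_one (by linarith)]
  have hB0 : 0 < B := by linarith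
  have hlogB : Real.logb 2 B ≤ 6 + 1 / 4 * Real.logb 2 (L / A.card) + Real.logb 2 E := by
    rw [hB, Real.logb_mul (by positivity) (by positivity),
      Real.logb_mul (by positivity) (by positivity),
      Real.logb_rpow_eq_mul_logb_of_pos (by positivity)]
    have : Real.logb 2 40 ≤ 6 := by
      rw [Real.logb_le_iff_le_rpow one_lt_two (by norm_num)]
      norm_num
    linarith
  have hlogB0 : 0 ≤ Real.logb 2 B := Real.logb_nonneg one_lt_two hB1
  have hZm : Measurable fun ω : Sample L m R =>
      sinr G A.card A i (ω.1 i) (quantizedChannels ω) ^ (1 / 4 : ℝ) :=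
    (measurable_user_comp i (F := sinr G A.card A i) (measurable_sinr G A.card A i)).pow_const _
  refine meanRate_le_of_lintegral (c := 4 * Real.logb 2 B) (d := 8 / B) (B := B) hG hZm
    (fun ω => Real.rpow_nonneg (sinr_nonneg hG _ _ _ _ _) _) (by positivity) (by positivity) hB0.le
    (fun ω => ?_) ((lintegral_sinr_rpow_le hA hA2 hi hG hb hr).trans
      (ENNReal.ofReal_le_ofReal ?_)) ?_
  · exact logb_one_add_le_add_rpow (sinr_nonneg hG _ _ _ _ _) hB1
  · have h1 : (((L : ℝ) - A.card + 1) / A.card) ^ (1 / 4 : ℝ) ≤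
        ((L : ℝ) / A.card) ^ (1 / 4 : ℝ) := by
      refine Real.rpow_le_rpow (div_nonneg (by linarith) hs0.le) ?_ (by norm_num)
      exact div_le_div_of_nonneg_right (by linarith) hs0.le
    exact mul_le_mul_of_nonneg_right (mul_le_mul_of_nonneg_left h1 (by norm_num)) (by linarith)
  · rw [div_mul_cancel₀ _ hB0.ne']
    linarith

lemma abs_meanRate_sub_le {f ε : ℝ} (hG : 0 ≤ G) (hε : 0 ≤ ε)
    (h : ∫⁻ ω, ENNReal.ofReal |Real.logb 2 (1 + sinr G A.card A i (ω.1 i) (quantizedChannels ω)) -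
      f| ∂sampleLaw L m R ≤ ENNReal.ofReal ε) : |meanRate L m R G A i - f| ≤ ε := by
  have hint := integrable_rate (L := L) (R := R) hG A.card A i
  have h1 : meanRate L m R G A i - f = ∫ ω,
      (Real.logb 2 (1 + sinr G A.card A i (ω.1 i) (quantizedChannels ω)) - f)
        ∂sampleLaw L m R := by
    rw [integral_sub hint (integrable_const f), integral_const, probReal_univ, one_smul, meanRate]
  rw [h1]
  refine abs_integral_le_integral_abs.trans ?_
  have h2 := integral_eq_lintegral_of_nonneg_ae (Eventually.of_forall fun ω => abs_nonneg _)
    ((hint.sub (integrable_const f)).abs.aestronglyMeasurable)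
  exact h2.trans_le (ENNReal.toReal_le_of_le_ofReal hε h)

end MeanRate

/-! ### Averages over the users -/

/-- The rate `log₂ (1 + x)`, extended to the negative half-line by `0`. -/
def logPos (x : ℝ) : ℝ := Real.logb 2 (1 + max x 0)

lemma continuous_logPos : Continuous logPos := by
  have h1 : Continuous fun x : ℝ => 1 + max x 0 := by fun_prop
  exact (h1.log fun x => (by positivity : (0 : ℝ) < 1 + max x 0).ne').div_const _

lemma logPos_nonneg (x : ℝ) : 0 ≤ logPos x := logb_one_add_nonneg (le_max_right _ _)

lemma logPos_mono : Monotone logPos := fun _ _ hxy =>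
  logb_one_add_mono (le_max_right _ _) (max_le_max_right 0 hxy)

lemma logPos_of_nonneg {x : ℝ} (hx : 0 ≤ x) : logPos x = Real.logb 2 (1 + x) := by
  rw [logPos, max_eq_left hx]

lemma integral_empiricalLaw (η : ℕ → ℝ) (m : ℕ) (g : ℝ → ℝ) :
    ∫ x, g x ∂(empiricalLaw η m : Measure ℝ) =
      1 / (m : ℝ) * ∑ i ∈ Finset.range m, g (η i) := by
  have h1 : (empiricalLaw η m : Measure ℝ) =
      (m : NNReal)⁻¹ • ∑ i ∈ Finset.range m, Measure.dirac (η i) := by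
    simp [empiricalLaw, diracProba, FiniteMeasure.toMeasure_smul, FiniteMeasure.toMeasure_sum]
    rfl
  rw [h1, integral_smul_nnreal_measure, integral_finsetSum_measure fun i _ =>
    integrable_dirac (by simp)]
  simp [NNReal.smul_def]

section Average

variable {η : ℕ → ℝ} {m : ℕ → ℕ} {μ : ProbabilityMeasure ℝ}

lemma tendsto_average_of_bounded
    (hμ : Tendsto (fun n => empiricalLaw η (m n)) atTop (𝓝 μ.toFiniteMeasure))
    {g : ℝ → ℝ} (hg : Continuous g) {C : ℝ} (hC : ∀ x, |g x| ≤ C) :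
    Tendsto (fun n => 1 / (m n : ℝ) * ∑ i ∈ Finset.range (m n), g (η i)) atTop
      (𝓝 (∫ x, g x ∂(μ : Measure ℝ))) := by
  have h := (FiniteMeasure.tendsto_iff_forall_integral_tendsto.1 hμ)
    (BoundedContinuousFunction.ofNormedAddCommGroup g hg C hC)
  have h2 := h.congr fun n => integral_empiricalLaw η (m n) g
  exact h2

/-- The weak limit of laws on `[0, ∞)` is carried by `[0, ∞)`. -/
lemma ae_nonneg_of_tendsto (hη : ∀ i, 0 ≤ η i)
    (hμ : Tendsto (fun n => empiricalLaw η (m n)) atTop (𝓝 μ.toFiniteMeasure)) :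
    ∀ᵐ x ∂(μ : Measure ℝ), 0 ≤ x := by
  have hg : Continuous fun x : ℝ => min 1 (max 0 (-x)) := by fun_prop
  have hb : ∀ x : ℝ, |min 1 (max 0 (-x))| ≤ 1 := fun x => by
    rw [abs_of_nonneg (le_min zero_le_one (le_max_left _ _))]
    exact min_le_left _ _
  have h1 := tendsto_average_of_bounded hμ hg hb
  have h2 : ∀ n, 1 / (m n : ℝ) * ∑ i ∈ Finset.range (m n), min 1 (max 0 (-η i)) = 0 := fun n => by
    rw [Finset.sum_eq_zero, mul_zero]
    intro i _
    rw [max_eq_left (by linarith [hη i]), min_eq_right zero_le_one]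
  simp_rw [h2] at h1
  have h3 := tendsto_nhds_unique h1 tendsto_const_nhds
  have hint : Integrable (fun x : ℝ => min 1 (max 0 (-x))) (μ : Measure ℝ) :=
    (integrable_const (1 : ℝ)).mono' hg.aestronglyMeasurable (Eventually.of_forall hb)
  have h4 := (integral_eq_zero_iff_of_nonneg
    (fun x => le_min zero_le_one (le_max_left _ _)) hint).1 h3
  filter_upwards [h4] with x hx
  by_contra hneg
  have h5 : min 1 (max 0 (-x)) = 0 := hx
  have h6 : 0 < min 1 (max 0 (-x)) := lt_min one_pos (lt_max_of_lt_right (by linarith))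
  linarith

/-- Fatou's lemma for the weak limit: `log₂ (1 + η)` is integrable. -/
lemma integrable_logPos (hη : ∀ i, 0 ≤ η i)
    (hμ : Tendsto (fun n => empiricalLaw η (m n)) atTop (𝓝 μ.toFiniteMeasure))
    (hUI : ∀ ε > 0, ∃ K : ℝ, ∀ᶠ n in atTop, 1 / (m n : ℝ) *
      ∑ i ∈ Finset.range (m n) with K < η i, Real.logb 2 (1 + η i) ≤ ε) :
    Integrable logPos (μ : Measure ℝ) := by
  obtain ⟨K, hK⟩ := hUI 1 one_pos
  have hbound : ∀ k : ℕ, ∫ x, min (logPos x) k ∂(μ : Measure ℝ) ≤ logPos K + 1 := by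
    intro k
    have h1 := tendsto_average_of_bounded (C := k) hμ (continuous_logPos.min continuous_const)
      (fun x => by
        rw [abs_of_nonneg (le_min (logPos_nonneg x) (Nat.cast_nonneg k))]
        exact min_le_right _ _)
    refine le_of_tendsto h1 ?_
    filter_upwards [hK] with n hn
    have h2 : ∑ i ∈ Finset.range (m n), min (logPos (η i)) k ≤
        m n * logPos K + ∑ i ∈ Finset.range (m n) with K < η i, Real.logb 2 (1 + η i) := by
      rw [Finset.sum_filter]
      calc _ ≤ ∑ i ∈ Finset.range (m n),
            (logPos K + if K < η i then Real.logb 2 (1 + η i) else 0) := by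
            refine Finset.sum_le_sum fun i _ => (min_le_left _ _).trans ?_
            split_ifs with h
            · rw [← logPos_of_nonneg (hη i)]
              linarith [logPos_nonneg K]
            · rw [add_zero]
              exact logPos_mono (not_lt.1 h)
        _ = _ := by
          rw [Finset.sum_add_distrib, Finset.sum_const, Finset.card_range, nsmul_eq_mul]
    calc _ ≤ 1 / (m n : ℝ) * (m n * logPos K +
          ∑ i ∈ Finset.range (m n) with K < η i, Real.logb 2 (1 + η i)) :=
          mul_le_mul_of_nonneg_left h2 (by positivity)
      _ = 1 / (m n : ℝ) * m n * logPos K + 1 / (m n : ℝ) *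
          ∑ i ∈ Finset.range (m n) with K < η i, Real.logb 2 (1 + η i) := by ring
      _ ≤ 1 * logPos K + 1 := by
          refine add_le_add (mul_le_mul_of_nonneg_right ?_ (logPos_nonneg K)) hn
          rw [one_div]
          exact inv_mul_le_one
      _ = _ := by rw [one_mul]
  refine ⟨continuous_logPos.aestronglyMeasurable, ?_⟩
  rw [hasFiniteIntegral_iff_ofReal (Eventually.of_forall logPos_nonneg)]
  have hmono : Tendsto (fun k : ℕ => ∫⁻ x, ENNReal.ofReal (min (logPos x) k) ∂(μ : Measure ℝ))
      atTop (𝓝 (∫⁻ x, ENNReal.ofReal (logPos x) ∂(μ : Measure ℝ))) := by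
    refine lintegral_tendsto_of_tendsto_of_monotone
      (fun k => (continuous_logPos.min continuous_const).measurable.ennreal_ofReal.aemeasurable)
      (Eventually.of_forall fun x k l hkl => ENNReal.ofReal_le_ofReal
        (min_le_min_left _ (Nat.cast_le.2 hkl))) (Eventually.of_forall fun x => ?_)
    obtain ⟨N, hN⟩ := exists_nat_ge (logPos x)
    refine tendsto_const_nhds.congr' ?_
    filter_upwards [eventually_ge_atTop N] with k hk
    rw [min_eq_left (hN.trans (Nat.cast_le.2 hk))]
  refine (le_of_tendsto hmono (b := ENNReal.ofReal (logPos K + 1))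
    (Eventually.of_forall fun k => ?_)).trans_lt ENNReal.ofReal_lt_top
  have hnn : ∀ x, 0 ≤ min (logPos x) (k : ℝ) := fun x =>
    le_min (logPos_nonneg x) (Nat.cast_nonneg k)
  have hint : Integrable (fun x => min (logPos x) (k : ℝ)) (μ : Measure ℝ) :=
    (integrable_const (k : ℝ)).mono' (continuous_logPos.min continuous_const).aestronglyMeasurable
      (Eventually.of_forall fun x => by
        rw [Real.norm_of_nonneg (hnn x)]
        exact min_le_right _ _)
  rw [← ofReal_integral_eq_lintegral_ofReal hint (Eventually.of_forall hnn)]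
  exact ENNReal.ofReal_le_ofReal (hbound k)

lemma integrable_of_le_logPos (hint : Integrable logPos (μ : Measure ℝ)) {g : ℝ → ℝ}
    (hg : Continuous g) {C : ℝ} (hC : ∀ x, |g x| ≤ C * (1 + logPos x)) :
    Integrable g (μ : Measure ℝ) :=
  (((integrable_const (1 : ℝ)).add hint).const_mul C).mono' hg.aestronglyMeasurable
    (Eventually.of_forall hC)

/-- Uniform integrability upgrades weak convergence of the empirical distributions to convergence
of the averages of continuous functions of logarithmic growth. -/
lemma tendsto_average (hη : ∀ i, 0 ≤ η i)
    (hμ : Tendsto (fun n => empiricalLaw η (m n)) atTop (𝓝 μ.toFiniteMeasure))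
    (hUI : ∀ ε > 0, ∃ K : ℝ, ∀ᶠ n in atTop, 1 / (m n : ℝ) *
      ∑ i ∈ Finset.range (m n) with K < η i, Real.logb 2 (1 + η i) ≤ ε)
    {g : ℝ → ℝ} (hg : Continuous g) {C : ℝ} (hC : ∀ x, |g x| ≤ C * (1 + logPos x)) :
    Tendsto (fun n => 1 / (m n : ℝ) * ∑ i ∈ Finset.range (m n), g (η i)) atTop
      (𝓝 (∫ x, g x ∂(μ : Measure ℝ))) := by
  have hC0 : 0 ≤ C := by
    have h1 := (abs_nonneg _).trans (hC 0)
    exact nonneg_of_mul_nonneg_left h1 (by linarith [logPos_nonneg 0])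
  have hgi := integrable_of_le_logPos (integrable_logPos hη hμ hUI) hg hC
  -- the truncation of `g` at level `k`
  set T : ℝ → ℝ → ℝ := fun k x => max (-k) (min k (g x)) with hT
  have hTc : ∀ k, Continuous (T k) := fun k => by fun_prop
  have hTb : ∀ k, 0 ≤ k → ∀ x, |T k x| ≤ k := fun k hk x =>
    abs_le.2 ⟨le_max_left _ _, max_le (by linarith) (min_le_left _ _)⟩
  have hTg : ∀ k, 0 ≤ k → ∀ x, |T k x| ≤ |g x| := fun k hk x => by
    rw [abs_le]
    constructor
    · rcases le_total (g x) k with h | h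
      · rw [hT]
        simp only [min_eq_right h]
        exact (neg_abs_le _).trans (le_max_right _ _)
      · rw [hT]
        simp only [min_eq_left h]
        exact (neg_nonpos.2 (abs_nonneg _)).trans (hk.trans (le_max_right _ _))
    · refine max_le ?_ ((min_le_right _ _).trans (le_abs_self _))
      linarith [abs_nonneg (g x)]
  have hTeq : ∀ k x, |g x| ≤ k → T k x = g x := fun k x h => by
    obtain ⟨h1, h2⟩ := abs_le.1 h
    rw [hT]
    simp only [min_eq_right h2, max_eq_right h1]
  have hTlim : Tendsto (fun k : ℕ => ∫ x, T k x ∂(μ : Measure ℝ)) atTop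
      (𝓝 (∫ x, g x ∂(μ : Measure ℝ))) := by
    refine tendsto_integral_of_dominated_convergence (fun x => |g x|)
      (fun k => (hTc k).aestronglyMeasurable) hgi.abs
      (fun k => Eventually.of_forall fun x => hTg k (Nat.cast_nonneg k) x)
      (Eventually.of_forall fun x => ?_)
    obtain ⟨N, hN⟩ := exists_nat_ge |g x|
    refine tendsto_const_nhds.congr' ?_
    filter_upwards [eventually_ge_atTop N] with k hk
    exact (hTeq k x (hN.trans (Nat.cast_le.2 hk))).symm
  rw [Metric.tendsto_atTop']
  intro ε hε
  obtain ⟨K, hK⟩ := hUI (ε / (4 * (2 * C + 1))) (by positivity)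
  obtain ⟨k, hk1, hk2⟩ := ((hTlim.eventually (Metric.ball_mem_nhds _ (by positivity :
    0 < ε / 4))).and (eventually_ge_atTop ⌈C * (1 + logPos (max K 1))⌉₊)).exists
  have hk2' : C * (1 + logPos (max K 1)) ≤ k := Nat.ceil_le.1 hk2
  have hlim := tendsto_average_of_bounded hμ (hTc k) (hTb k (Nat.cast_nonneg k))
  have hev := (hlim.eventually (Metric.ball_mem_nhds _ (by positivity : 0 < ε / 4))).and hK
  obtain ⟨N, hN⟩ := eventually_atTop.1 hev
  refine ⟨N, fun n hn => ?_⟩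
  obtain ⟨hn1, hn2⟩ := hN n hn.le
  have hdiff : |1 / (m n : ℝ) * ∑ i ∈ Finset.range (m n), g (η i) -
      1 / (m n : ℝ) * ∑ i ∈ Finset.range (m n), T k (η i)| ≤ ε / 4 := by
    rw [← mul_sub, ← Finset.sum_sub_distrib, abs_mul, abs_of_nonneg (by positivity :
      (0 : ℝ) ≤ 1 / (m n : ℝ))]
    have h1 : ∀ i, |g (η i) - T k (η i)| ≤
        2 * C * (if K < η i then Real.logb 2 (1 + η i) else 0) := by
      intro i
      rcases le_or_gt (η i) (max K 1) with h | h
      · have h2 : |g (η i)| ≤ k := (hC _).trans (le_trans (mul_le_mul_of_nonneg_left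
          (by linarith [logPos_mono h]) hC0) hk2')
        rw [hTeq k _ h2, sub_self, abs_zero]
        split_ifs
        · have := logb_one_add_nonneg (hη i)
          positivity
        · simp
      · rw [if_pos ((le_max_left _ _).trans_lt h)]
        have h2 : 1 ≤ Real.logb 2 (1 + η i) := by
          rw [Real.le_logb_iff_rpow_le one_lt_two (by linarith [hη i]), Real.rpow_one]
          linarith [le_max_right K 1]
        have h3 : |g (η i) - T k (η i)| ≤ |g (η i)| := by
          rcases le_total |g (η i)| k with h4 | h4
          · rw [hTeq k _ h4, sub_self, abs_zero]
            exact abs_nonneg _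
          · have hk0 : (0 : ℝ) ≤ k := Nat.cast_nonneg k
            rcases le_total 0 (g (η i)) with h5 | h5
            · rw [abs_of_nonneg h5] at h4 ⊢
              have : T k (η i) = k := by
                rw [hT]
                simp only [min_eq_left h4]
                exact max_eq_right (by linarith)
              rw [this, abs_of_nonneg (by linarith)]
              linarith
            · rw [abs_of_nonpos h5] at h4 ⊢
              have : T k (η i) = -k := by
                rw [hT]
                simp only [min_eq_right (h5.trans hk0)]
                exact max_eq_left (by linarith)
              rw [this, abs_of_nonpos (by linarith)]
              linarith
        refine h3.trans ((hC _).trans ?_)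
        rw [logPos_of_nonneg (hη i)]
        have := mul_le_mul_of_nonneg_left h2 hC0
        linarith
    calc _ ≤ 1 / (m n : ℝ) * ∑ i ∈ Finset.range (m n),
          2 * C * (if K < η i then Real.logb 2 (1 + η i) else 0) := by
          refine mul_le_mul_of_nonneg_left ((Finset.abs_sum_le_sum_abs _ _).trans
            (Finset.sum_le_sum fun i _ => h1 i)) (by positivity)
      _ = 2 * C * (1 / (m n : ℝ) *
          ∑ i ∈ Finset.range (m n) with K < η i, Real.logb 2 (1 + η i)) := by
          rw [← Finset.mul_sum, Finset.sum_filter]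
          ring
      _ ≤ 2 * C * (ε / (4 * (2 * C + 1))) := mul_le_mul_of_nonneg_left hn2 (by positivity)
      _ ≤ ε / 4 := by
          rw [mul_div_assoc', div_le_div_iff₀ (by positivity) (by norm_num)]
          nlinarith
  rw [Real.dist_eq] at hk1 hn1
  rw [Real.dist_eq]
  obtain ⟨a1, a2⟩ := abs_le.1 hdiff
  obtain ⟨b1, b2⟩ := abs_lt.1 hk1
  obtain ⟨c1, c2⟩ := abs_lt.1 hn1
  rw [abs_lt]
  constructor <;> linarith

end Average

/-! ### Sums over the best users -/

/-- A bound for the sum over any `s` elements by a sum over all elements, sharp for the best ones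
if `t` is the threshold value. -/
lemma sum_le_card_mul_add {ι : Type*} [Fintype ι] (A : Finset ι) (f : ι → ℝ) (t : ℝ) :
    ∑ i ∈ A, f i ≤ A.card * t + ∑ i, max (f i - t) 0 := by
  calc ∑ i ∈ A, f i = A.card * t + ∑ i ∈ A, (f i - t) := by
        rw [Finset.sum_sub_distrib, Finset.sum_const, nsmul_eq_mul]
        ring
    _ ≤ A.card * t + ∑ i ∈ A, max (f i - t) 0 := by
        gcongr
        exact le_max_left _ _
    _ ≤ _ := (add_le_add_iff_left _).2
        (Finset.sum_le_univ_sum_of_nonneg fun i => le_max_right (f i - t) 0)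

/-- A set of `s` elements with the largest values maximises the weighted sum over all weights in
`[0, 1]` of total mass at most `s`. -/
lemma sum_weight_mul_le {ι : Type*} [Fintype ι] {A : Finset ι} {f w : ι → ℝ}
    (hA : ∀ i ∈ A, ∀ j ∉ A, f j ≤ f i) (hf : ∀ i, 0 ≤ f i) (hw0 : ∀ i, 0 ≤ w i)
    (hw1 : ∀ i, w i ≤ 1) (hw : ∑ i, w i ≤ A.card) : ∑ i, w i * f i ≤ ∑ i ∈ A, f i := by
  classical
  rcases A.eq_empty_or_nonempty with rfl | hne
  · have h0 : ∑ i, w i = 0 := le_antisymm (by simpa using hw) (Finset.sum_nonneg fun i _ => hw0 i)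
    rw [Finset.sum_eq_zero_iff_of_nonneg fun i _ => hw0 i] at h0
    rw [Finset.sum_empty]
    exact (Finset.sum_eq_zero fun i hi => by rw [h0 i hi, zero_mul]).le
  obtain ⟨k, hk, hmin⟩ := Finset.exists_min_image A f hne
  have h1 : ∑ i, w i * (f i - f k) ≤ ∑ i, if i ∈ A then f i - f k else 0 := by
    refine Finset.sum_le_sum fun i _ => ?_
    split_ifs with hi
    · exact mul_le_of_le_one_left (sub_nonneg.2 (hmin i hi)) (hw1 i)
    · exact mul_nonpos_of_nonneg_of_nonpos (hw0 i) (sub_nonpos.2 (hA k hk i hi))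
  rw [Finset.sum_ite_mem, Finset.univ_inter, Finset.sum_sub_distrib, Finset.sum_const,
    nsmul_eq_mul] at h1
  simp_rw [mul_sub] at h1
  rw [Finset.sum_sub_distrib, ← Finset.sum_mul] at h1
  have h2 := mul_le_mul_of_nonneg_right hw (hf k)
  linarith

/-! ### The threshold -/

section Threshold

variable {μ : ProbabilityMeasure ℝ} {mbar σ : ℝ}

lemma mem_levelSet {x : ℝ} :
    x ∈ levelSet μ mbar σ ↔ σ < mbar * (μ : Measure ℝ).real (Set.Ici x) := by
  change σ < mbar * ∫ _ in Set.Ici x, (1 : ℝ) ∂(μ : Measure ℝ) ↔ _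
  simp

lemma zero_mem_levelSet (h0 : ∀ᵐ x ∂(μ : Measure ℝ), 0 ≤ x) (hm : 1 ≤ mbar) (hσ1 : σ < 1) :
    0 ∈ levelSet μ mbar σ := by
  rw [mem_levelSet]
  have h1 : (μ : Measure ℝ).real (Set.Ici 0) = 1 := by
    rw [measureReal_def, (prob_compl_eq_zero_iff measurableSet_Ici).1, ENNReal.toReal_one]
    exact h0
  rw [h1]
  linarith

lemma tendsto_measureReal_Ici {f : ℕ → ℝ} (hf : Tendsto f atTop atTop) :
    Tendsto (fun k => (μ : Measure ℝ).real (Set.Ici (f k))) atTop (𝓝 0) := by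
  have h1 : Tendsto (fun k => ∫ x, (Set.Ici (f k)).indicator (fun _ => (1 : ℝ)) x ∂(μ : Measure ℝ))
      atTop (𝓝 (∫ _, (0 : ℝ) ∂(μ : Measure ℝ))) := by
    refine tendsto_integral_of_dominated_convergence (fun _ => 1)
      (fun k => (measurable_const.indicator measurableSet_Ici).aestronglyMeasurable)
      (integrable_const 1) (fun k => Eventually.of_forall fun x =>
        (norm_indicator_le_norm_self _ _).trans (by simp)) (Eventually.of_forall fun x => ?_)
    refine tendsto_const_nhds.congr' ?_
    filter_upwards [hf.eventually_gt_atTop x] with k hk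
    rw [Set.indicator_of_notMem (by simpa using hk)]
  rw [integral_zero] at h1
  refine h1.congr fun k => ?_
  rw [integral_indicator_const _ measurableSet_Ici]
  simp

lemma bddAbove_levelSet (hm : 0 ≤ mbar) (hσ : 0 < σ) : BddAbove (levelSet μ mbar σ) := by
  have h1 := (tendsto_measureReal_Ici (μ := μ) tendsto_natCast_atTop_atTop).const_mul mbar
  rw [mul_zero] at h1
  obtain ⟨k, hk⟩ := (h1.eventually (gt_mem_nhds hσ)).exists
  refine ⟨k, fun x hx => ?_⟩
  rw [mem_levelSet] at hx
  by_contra hlt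
  have h2 : (μ : Measure ℝ).real (Set.Ici x) ≤ (μ : Measure ℝ).real (Set.Ici (k : ℝ)) :=
    measureReal_mono (Set.Ici_subset_Ici.2 (not_le.1 hlt).le)
  have h3 := mul_le_mul_of_nonneg_left h2 hm
  linarith

lemma isLUB_levelSet (h0 : ∀ᵐ x ∂(μ : Measure ℝ), 0 ≤ x) (hm : 1 ≤ mbar) (hσ : 0 < σ)
    (hσ1 : σ < 1) : IsLUB (levelSet μ mbar σ) (etaThreshold μ mbar σ) :=
  isLUB_csSup ⟨0, zero_mem_levelSet h0 hm hσ1⟩ (bddAbove_levelSet (by linarith) hσ)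

variable {x₀ : ℝ}

lemma mul_measureReal_Ioi_le (hx₀ : IsLUB (levelSet μ mbar σ) x₀) :
    mbar * (μ : Measure ℝ).real (Set.Ioi x₀) ≤ σ := by
  have h1 := (tendsto_integralAbove (μ : Measure ℝ) x₀ (fun _ => 1) (integrable_const 1)).const_mul
    mbar
  have h2 : integralAbove (μ : Measure ℝ) x₀ (fun _ => 1) = (μ : Measure ℝ).real (Set.Ioi x₀) := by
    simp [integralAbove]
  rw [h2] at h1
  refine le_of_tendsto h1 ?_
  filter_upwards [self_mem_nhdsWithin] with δ hδ
  have hδ' : (0 : ℝ) < δ := hδ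
  by_contra hlt
  have h3 := hx₀.1 (show x₀ + δ ∈ levelSet μ mbar σ from not_le.1 hlt)
  linarith

lemma le_mul_measureReal_Ici (hm : 0 ≤ mbar) (hx₀ : IsLUB (levelSet μ mbar σ) x₀) :
    σ ≤ mbar * (μ : Measure ℝ).real (Set.Ici x₀) := by
  have h1 : Tendsto (fun k : ℕ => ∫ x, (Set.Ici (x₀ - 1 / ((k : ℝ) + 1))).indicator
      (fun _ => (1 : ℝ)) x ∂(μ : Measure ℝ)) atTop
      (𝓝 (∫ x, (Set.Ici x₀).indicator (fun _ => (1 : ℝ)) x ∂(μ : Measure ℝ))) := by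
    refine tendsto_integral_of_dominated_convergence (fun _ => 1)
      (fun k => (measurable_const.indicator measurableSet_Ici).aestronglyMeasurable)
      (integrable_const 1) (fun k => Eventually.of_forall fun x =>
        (norm_indicator_le_norm_self _ _).trans (by simp)) (Eventually.of_forall fun x => ?_)
    refine tendsto_const_nhds.congr' ?_
    rcases le_or_gt x₀ x with h | h
    · refine Eventually.of_forall fun k => ?_
      have h2 : (0 : ℝ) < 1 / ((k : ℝ) + 1) := by positivity
      have h3 : x₀ - 1 / ((k : ℝ) + 1) ≤ x := by linarith
      exact (Set.indicator_of_mem (Set.mem_Ici.2 h) _).trans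
        (Set.indicator_of_mem (Set.mem_Ici.2 h3) (fun _ => (1 : ℝ))).symm
    · filter_upwards [tendsto_one_div_add_atTop_nhds_zero_nat.eventually
        (gt_mem_nhds (sub_pos.2 h))] with k hk
      rw [Set.indicator_of_notMem (by simpa using h),
        Set.indicator_of_notMem (by rw [Set.mem_Ici]; linarith)]
  simp_rw [integral_indicator_const _ measurableSet_Ici, smul_eq_mul, mul_one] at h1
  refine ge_of_tendsto (h1.const_mul mbar) (Eventually.of_forall fun k => ?_)
  have h2 : (0 : ℝ) < 1 / ((k : ℝ) + 1) := by positivity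
  obtain ⟨y, hy, hy1, -⟩ := hx₀.exists_between (show x₀ - 1 / ((k : ℝ) + 1) < x₀ by linarith)
  rw [mem_levelSet] at hy
  refine hy.le.trans (mul_le_mul_of_nonneg_left ?_ hm)
  exact measureReal_mono (Set.Ici_subset_Ici.2 hy1.le)

/-- The level `x₀` splits `μ` so that the mass above it, together with a fraction `θ` of its atom,
corresponds to the share `σ` of the on-users. -/
lemma exists_atom_fraction (hm : 0 < mbar) (hx₀ : IsLUB (levelSet μ mbar σ) x₀) :
    ∃ θ : ℝ, 0 ≤ θ ∧ θ ≤ 1 ∧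
      mbar * ((μ : Measure ℝ).real (Set.Ioi x₀) + θ * (μ : Measure ℝ).real {x₀}) = σ := by
  have h1 := mul_measureReal_Ioi_le hx₀
  have h2 := le_mul_measureReal_Ici hm.le hx₀
  have h3 : (μ : Measure ℝ).real (Set.Ici x₀) =
      (μ : Measure ℝ).real (Set.Ioi x₀) + (μ : Measure ℝ).real {x₀} := by
    rw [← Set.Ioi_union_left, measureReal_union (by simp) (measurableSet_singleton x₀)]
  rw [h3] at h2
  set a := (μ : Measure ℝ).real (Set.Ioi x₀)
  have hb : 0 ≤ (μ : Measure ℝ).real {x₀} := measureReal_nonneg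
  set b := (μ : Measure ℝ).real {x₀}
  rcases hb.eq_or_lt with h0 | h0
  · refine ⟨0, le_rfl, zero_le_one, ?_⟩
    rw [← h0] at h2
    linarith
  · refine ⟨(σ - mbar * a) / (mbar * b), by
      have := sub_nonneg.2 h1
      positivity, ?_, ?_⟩
    · rw [div_le_one (by positivity)]
      linarith
    · field_simp
      ring

/-- A continuous approximation of the weight which is `1` above `x₀`, `θ` at `x₀` and `0` below. -/
def softStep (x₀ θ : ℝ) (k : ℕ) (x : ℝ) : ℝ := max 0 (min 1 (θ + k * (x - x₀)))

lemma continuous_softStep (x₀ θ : ℝ) (k : ℕ) : Continuous (softStep x₀ θ k) := by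
  unfold softStep
  fun_prop

lemma softStep_nonneg (x₀ θ : ℝ) (k : ℕ) (x : ℝ) : 0 ≤ softStep x₀ θ k x := le_max_left _ _

lemma softStep_le_one (x₀ θ : ℝ) (k : ℕ) (x : ℝ) : softStep x₀ θ k x ≤ 1 :=
  max_le zero_le_one (min_le_left _ _)

lemma tendsto_integral_softStep_mul {θ : ℝ} (hθ0 : 0 ≤ θ) (hθ1 : θ ≤ 1) {g : ℝ → ℝ}
    (hg : Integrable g (μ : Measure ℝ)) :
    Tendsto (fun k => ∫ x, softStep x₀ θ k x * g x ∂(μ : Measure ℝ)) atTop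
      (𝓝 (∫ x in Set.Ioi x₀, g x ∂(μ : Measure ℝ) +
        θ * ((μ : Measure ℝ).real {x₀} * g x₀))) := by
  have h1 : Tendsto (fun k => ∫ x, softStep x₀ θ k x * g x ∂(μ : Measure ℝ)) atTop
      (𝓝 (∫ x, ((Set.Ioi x₀).indicator g x + θ * ({x₀} : Set ℝ).indicator (fun _ => g x₀) x)
        ∂(μ : Measure ℝ))) := by
    refine tendsto_integral_of_dominated_convergence (fun x => |g x|)
      (fun k => (continuous_softStep x₀ θ k).aestronglyMeasurable.mul hg.aestronglyMeasurable)
      hg.abs (fun k => Eventually.of_forall fun x => ?_) (Eventually.of_forall fun x => ?_)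
    · rw [Real.norm_eq_abs, abs_mul, abs_of_nonneg (softStep_nonneg _ _ _ _)]
      exact mul_le_of_le_one_left (abs_nonneg _) (softStep_le_one _ _ _ _)
    · rcases lt_trichotomy x x₀ with h | rfl | h
      · rw [Set.indicator_of_notMem (by simpa using h.le), Set.indicator_of_notMem (by
          simpa using h.ne), mul_zero, add_zero]
        refine tendsto_const_nhds.congr' ?_
        obtain ⟨N, hN⟩ := exists_nat_gt (θ / (x₀ - x))
        filter_upwards [eventually_ge_atTop N] with k hk
        have h2 : θ / (x₀ - x) < k := hN.trans_le (Nat.cast_le.2 hk)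
        rw [div_lt_iff₀ (sub_pos.2 h)] at h2
        rw [softStep, max_eq_left ((min_le_right _ _).trans (by linarith)), zero_mul]
      · rw [Set.indicator_of_notMem (by simp), Set.indicator_of_mem (by simp), zero_add]
        refine tendsto_const_nhds.congr fun k => ?_
        rw [softStep, sub_self, mul_zero, add_zero, min_eq_right hθ1, max_eq_right hθ0]
      · rw [Set.indicator_of_mem (by simpa using h), Set.indicator_of_notMem (by
          simpa using h.ne'), mul_zero, add_zero]
        refine tendsto_const_nhds.congr' ?_
        obtain ⟨N, hN⟩ := exists_nat_gt (1 / (x - x₀))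
        filter_upwards [eventually_ge_atTop N] with k hk
        have h2 : 1 / (x - x₀) < k := hN.trans_le (Nat.cast_le.2 hk)
        rw [div_lt_iff₀ (sub_pos.2 h)] at h2
        rw [softStep, min_eq_left (by linarith), max_eq_right zero_le_one, one_mul]
  rw [integral_add (hg.indicator measurableSet_Ioi)
    (((integrable_const (g x₀)).indicator (measurableSet_singleton x₀)).const_mul θ),
    integral_indicator measurableSet_Ioi, integral_const_mul,
    integral_indicator_const _ (measurableSet_singleton x₀), smul_eq_mul] at h1
  exact h1

end Threshold

/-! ### The limit of the sums over the best users -/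

section Limit

variable {η : ℕ → ℝ} {L m s : ℕ → ℕ} {mbar σ : ℝ} {μ : ProbabilityMeasure ℝ}

/-- Averages over the `m` users, rescaled to averages per antenna. -/
lemma mul_average_eq (hLm : ∀ n, L n ≤ m n) (n : ℕ) (g : ℝ → ℝ) :
    (m n : ℝ) / L n * (1 / (m n : ℝ) * ∑ i ∈ Finset.range (m n), g (η i)) =
      1 / (L n : ℝ) * ∑ i : Fin (m n), g (η i) := by
  rw [Finset.sum_range]
  rcases Nat.eq_zero_or_pos (m n) with h | h
  · have : L n = 0 := by have := hLm n; omega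
    simp [this]
  · have : (m n : ℝ) ≠ 0 := by exact_mod_cast h.ne'
    field_simp

lemma limitRate_max_le (hσ : 0 < σ) (hσ1 : σ ≤ 1) (x : ℝ) :
    |limitRate σ (max x 0)| ≤ (1 + Real.logb 2 (1 + (1 - σ) / σ)) * (1 + logPos x) := by
  have hc : 0 ≤ (1 - σ) / σ := div_nonneg (by linarith) hσ.le
  set c := (1 - σ) / σ with hcdef
  have hx : 0 ≤ max x 0 := le_max_right _ _
  have h1 : 0 ≤ limitRate σ (max x 0) := logb_one_add_nonneg (mul_nonneg hx hc)
  have h2 : limitRate σ (max x 0) ≤ Real.logb 2 (1 + c) + logPos x := by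
    rw [logPos, ← Real.logb_mul (by positivity) (by positivity), limitRate]
    refine Real.logb_le_logb_of_le one_lt_two (by positivity) ?_
    nlinarith
  rw [abs_of_nonneg h1]
  have h3 := logb_one_add_nonneg hc
  have h4 := logPos_nonneg x
  nlinarith [mul_nonneg h3 h4]

lemma continuous_limitRate_max (hσ : 0 < σ) (hσ1 : σ ≤ 1) :
    Continuous fun x => limitRate σ (max x 0) := by
  have h1 : Continuous fun x : ℝ => 1 + max x 0 * ((1 - σ) / σ) := by fun_prop
  refine (h1.log fun x => ne_of_gt ?_).div_const _
  have := mul_nonneg (le_max_right x 0) (div_nonneg (sub_nonneg.2 hσ1) hσ.le)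
  linarith

lemma integrableOn_limitRate (hlog : Integrable logPos (μ : Measure ℝ)) (hσ : 0 < σ)
    (hσ1 : σ ≤ 1) {x₀ : ℝ} (hx₀ : 0 ≤ x₀) :
    IntegrableOn (limitRate σ) (Set.Ioi x₀) (μ : Measure ℝ) := by
  refine ((integrable_of_le_logPos hlog (continuous_limitRate_max hσ hσ1)
    (limitRate_max_le hσ hσ1)).integrableOn (s := Set.Ioi x₀)).congr_fun (fun x hx => ?_)
    measurableSet_Ioi
  simp only [max_eq_left (hx₀.trans (le_of_lt hx))]

/-- The rates of the best users add up to the tail integral of the limiting rate: test with the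
constant `limitRate σ x₀` from above, and with weights close to the indicator of the tail from
below. -/
lemma eventually_abs_sum_sub_le (hη : ∀ i, 0 ≤ η i) (hLm : ∀ n, L n ≤ m n)
    (hL : Tendsto L atTop atTop)
    (hmbar : Tendsto (fun n => (m n : ℝ) / L n) atTop (𝓝 mbar))
    (hsbar : Tendsto (fun n => (s n : ℝ) / L n) atTop (𝓝 σ))
    (hμ : Tendsto (fun n => empiricalLaw η (m n)) atTop (𝓝 μ.toFiniteMeasure))
    (hUI : ∀ ε > 0, ∃ K : ℝ, ∀ᶠ n in atTop, 1 / (m n : ℝ) *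
      ∑ i ∈ Finset.range (m n) with K < η i, Real.logb 2 (1 + η i) ≤ ε)
    (hσ : 0 < σ) (hσ1 : σ < 1) (hm : 0 < mbar) {x₀ : ℝ} (hx₀0 : 0 ≤ x₀)
    (hx₀ : IsLUB (levelSet μ mbar σ) x₀) {ε : ℝ} (hε : 0 < ε) :
    ∀ᶠ n in atTop, ∀ A : Finset (Fin (m n)), IsOnSet η (s n) A →
      |1 / (L n : ℝ) * ∑ i ∈ A, limitRate σ (η i) -
        (mbar * integralAbove μ x₀ (limitRate σ) +
          (σ - mbar * integralAbove μ x₀ (fun _ => 1)) * limitRate σ x₀)| ≤ ε := by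
  set F : ℝ → ℝ := fun x => limitRate σ (max x 0) with hF
  have hc : 0 ≤ (1 - σ) / σ := div_nonneg (by linarith) hσ.le
  have hFη : ∀ x, 0 ≤ x → F x = limitRate σ x := fun x hx => by rw [hF]; simp only [max_eq_left hx]
  have hFc : Continuous F := continuous_limitRate_max hσ hσ1.le
  have hFmono : Monotone F := fun x y hxy =>
    logb_one_add_mono (mul_nonneg (le_max_right _ _) hc)
      (mul_le_mul_of_nonneg_right (max_le_max_right 0 hxy) hc)
  have hF0 : ∀ x, 0 ≤ F x := fun x => logb_one_add_nonneg (mul_nonneg (le_max_right _ _) hc)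
  set C := 1 + Real.logb 2 (1 + (1 - σ) / σ) with hC
  have hC1 : 1 ≤ C := by have := logb_one_add_nonneg hc; linarith
  have hFC : ∀ x, |F x| ≤ C * (1 + logPos x) := fun x => limitRate_max_le hσ hσ1.le x
  have hlog := integrable_logPos hη hμ hUI
  have hFi : Integrable F (μ : Measure ℝ) := integrable_of_le_logPos hlog hFc hFC
  set f₀ := F x₀ with hf₀
  set a := (μ : Measure ℝ).real (Set.Ioi x₀) with ha
  set J := ∫ x in Set.Ioi x₀, F x ∂(μ : Measure ℝ) with hJ
  have e1 : integralAbove (μ : Measure ℝ) x₀ (fun _ => 1) = a := by simp [integralAbove, ha]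
  have e2 : integralAbove (μ : Measure ℝ) x₀ (limitRate σ) = J :=
    setIntegral_congr_fun measurableSet_Ioi fun x hx =>
      (hFη x (hx₀0.trans (le_of_lt hx))).symm
  rw [e1, e2, ← hFη x₀ hx₀0]
  have hJ0 : 0 ≤ J := integral_nonneg fun x => hF0 x
  have hsum : ∀ n, ∀ A : Finset (Fin (m n)), ∑ i ∈ A, limitRate σ (η i) = ∑ i ∈ A, F (η i) :=
    fun n A => Finset.sum_congr rfl fun i _ => (hFη _ (hη i)).symm
  simp_rw [hsum]
  set I := mbar * J + (σ - mbar * a) * f₀ with hI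
  have hI0 : 0 ≤ I := add_nonneg (mul_nonneg hm.le hJ0)
    (mul_nonneg (sub_nonneg.2 (mul_measureReal_Ioi_le hx₀)) (hF0 x₀))
  -- testing with the constant `f₀` is sharp in the limit, since `F - f₀` changes sign at `x₀`
  have hupper : ∀ᶠ n in atTop, (s n : ℝ) / L n * f₀ +
      1 / (L n : ℝ) * ∑ i : Fin (m n), max (F (η i) - f₀) 0 < I + ε := by
    have h1 := tendsto_average (C := C + f₀) hη hμ hUI
      (g := fun x => max (F x - f₀) 0) (by fun_prop) (fun x => by
        rw [abs_of_nonneg (le_max_right _ _)]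
        have h2 := (le_abs_self _).trans (hFC x)
        have h3 : 0 ≤ f₀ * (1 + logPos x) := mul_nonneg (hF0 _) (by linarith [logPos_nonneg x])
        have h4 : 0 ≤ C * (1 + logPos x) := mul_nonneg (by linarith) (by linarith [logPos_nonneg x])
        refine max_le ?_ ?_
        · linarith [hF0 x₀]
        · linarith)
    have h5 := (hsbar.mul_const f₀).add (hmbar.mul h1)
    have h6 : ∫ x, max (F x - f₀) 0 ∂(μ : Measure ℝ) = J - a * f₀ := by
      have h7 : ∀ x, max (F x - f₀) 0 = (Set.Ioi x₀).indicator (fun x => F x - f₀) x := by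
        intro x
        rcases le_or_gt x x₀ with h | h
        · rw [Set.indicator_of_notMem (by simpa using h)]
          exact max_eq_right (sub_nonpos.2 (hFmono h))
        · rw [Set.indicator_of_mem (by simpa using h)]
          exact max_eq_left (sub_nonneg.2 (hFmono h.le))
      simp_rw [h7]
      rw [integral_indicator measurableSet_Ioi,
        integral_sub hFi.integrableOn (integrable_const f₀), setIntegral_const, smul_eq_mul]
    rw [h6] at h5
    have h8 : σ * f₀ + mbar * (J - a * f₀) < I + ε := by
      rw [hI]
      linarith
    filter_upwards [h5.eventually (gt_mem_nhds h8)] with n hn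
    rwa [mul_average_eq hLm n (fun x => max (F x - f₀) 0)] at hn
  -- the weights are shrunk by the factor `1 - ε₁`, so that their total mass is eventually at most `s`
  obtain ⟨θ, hθ0, hθ1, hθ⟩ := exists_atom_fraction hm hx₀
  set b := (μ : Measure ℝ).real {x₀} with hb
  obtain ⟨ε₁, hε₁, hε₁1, hε₁I⟩ : ∃ ε₁ : ℝ, 0 < ε₁ ∧ ε₁ < 1 ∧ ε₁ * I < ε := by
    refine ⟨min (1 / 2) (ε / (I + 1) / 2), by positivity, (min_le_left _ _).trans_lt (by norm_num),
      ?_⟩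
    calc _ ≤ ε / (I + 1) / 2 * I := mul_le_mul_of_nonneg_right (min_le_right _ _) hI0
      _ < ε := by
        rw [div_mul_eq_mul_div, div_lt_iff₀ two_pos, div_mul_eq_mul_div,
          div_lt_iff₀ (by linarith)]
        nlinarith
  have hstep1 := ((tendsto_integral_softStep_mul (μ := μ) (x₀ := x₀) hθ0 hθ1
    (integrable_const (1 : ℝ))).const_mul mbar).const_mul (1 - ε₁)
  have hstepF := ((tendsto_integral_softStep_mul (μ := μ) (x₀ := x₀) hθ0 hθ1 hFi).const_mul
    mbar).const_mul (1 - ε₁)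
  have hlim1 : (1 - ε₁) * (mbar * (∫ _ in Set.Ioi x₀, (1 : ℝ) ∂(μ : Measure ℝ) +
      θ * (b * 1))) < σ := by
    rw [setIntegral_const, smul_eq_mul, mul_one, mul_one, hθ]
    nlinarith
  have hlimF : I - ε < (1 - ε₁) * (mbar * (J + θ * (b * f₀))) := by
    have h1 : mbar * (J + θ * (b * f₀)) = I := by
      rw [hI, ← hθ]
      ring
    rw [h1]
    linarith
  obtain ⟨k, hk1, hkF⟩ := ((hstep1.eventually (gt_mem_nhds hlim1)).and
    (hstepF.eventually (lt_mem_nhds hlimF))).exists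
  set w : ℝ → ℝ := fun x => (1 - ε₁) * softStep x₀ θ k x with hw
  have hwc : Continuous w := (continuous_softStep x₀ θ k).const_mul _ |>.congr fun x => rfl
  have hw0 : ∀ x, 0 ≤ w x := fun x => mul_nonneg (by linarith) (softStep_nonneg _ _ _ _)
  have hw1 : ∀ x, w x ≤ 1 := fun x =>
    mul_le_one₀ (by linarith) (softStep_nonneg _ _ _ _) (softStep_le_one _ _ _ _)
  have hmass : ∀ᶠ n in atTop, 1 / (L n : ℝ) * ∑ i : Fin (m n), w (η i) < (s n : ℝ) / L n := by
    have h1 := hmbar.mul (tendsto_average_of_bounded (C := 1) hμ hwc fun x => by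
      rw [abs_of_nonneg (hw0 x)]; exact hw1 x)
    have h2 : mbar * ∫ x, w x ∂(μ : Measure ℝ) < σ := by
      rw [hw, integral_const_mul]
      simp_rw [mul_one] at hk1
      linarith
    filter_upwards [h1.eventually_lt hsbar h2] with n hn
    rwa [mul_average_eq hLm n w] at hn
  have hlower : ∀ᶠ n in atTop, I - ε < 1 / (L n : ℝ) * ∑ i : Fin (m n), w (η i) * F (η i) := by
    have h1 := hmbar.mul (tendsto_average (C := C) hη hμ hUI (g := fun x => w x * F x)
      (hwc.mul hFc) fun x => by
        rw [abs_mul, abs_of_nonneg (hw0 x)]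
        exact (mul_le_of_le_one_left (abs_nonneg _) (hw1 x)).trans (hFC x))
    have h2 : I - ε < mbar * ∫ x, w x * F x ∂(μ : Measure ℝ) := by
      simp_rw [hw, mul_assoc]
      rw [integral_const_mul]
      linarith
    filter_upwards [h1.eventually (lt_mem_nhds h2)] with n hn
    rwa [mul_average_eq hLm n (fun x => w x * F x)] at hn
  filter_upwards [hupper, hmass, hlower, hL.eventually_gt_atTop 0] with n h1 h2 h3 h4 A hA
  obtain ⟨hcard, hA⟩ := hA
  have hL0 : (0 : ℝ) < L n := by exact_mod_cast h4
  rw [abs_le]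
  constructor
  · have h5 : ∑ i : Fin (m n), w (η i) * F (η i) ≤ ∑ i ∈ A, F (η i) := by
      refine sum_weight_mul_le (fun i hi j hj => hFmono (hA i hi j hj)) (fun i => hF0 _)
        (fun i => hw0 _) (fun i => hw1 _) ?_
      rw [one_div, inv_mul_eq_div, div_lt_div_iff_of_pos_right hL0] at h2
      rw [hcard]
      exact h2.le
    have h6 := mul_le_mul_of_nonneg_left h5 (by positivity : 0 ≤ 1 / (L n : ℝ))
    linarith
  · have h5 := mul_le_mul_of_nonneg_left (sum_le_card_mul_add A (fun i => F (η i)) f₀)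
      (by positivity : 0 ≤ 1 / (L n : ℝ))
    rw [hcard, mul_add] at h5
    have h6 : 1 / (L n : ℝ) * (s n * f₀) = (s n : ℝ) / L n * f₀ := by ring
    linarith

end Limit

/-! ### The spatial efficiency -/

/-- A bound uniform over the admissible sets of on-users passes to a random one. -/
lemma abs_avgThroughput_sub_le {L m : ℕ} {R : ℕ → ℕ} {ρ : ℝ} {γ : ℕ → ℝ} {s : ℕ}
    {κ : PMF (Finset (Fin m))} {I ε : ℝ}
    (h : ∀ A ∈ κ.support, |∫ ω, throughput ρ γ s A ω ∂sampleLaw L m R - I| ≤ ε) :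
    |avgThroughput L m R ρ γ s κ - I| ≤ ε := by
  have h1 : ∑ A, (κ A).toReal = 1 := by
    have h2 : ∑ A, κ A = 1 := (tsum_fintype fun A => κ A).symm.trans κ.tsum_coe
    rw [← ENNReal.toReal_sum fun A _ => κ.apply_ne_top A, h2, ENNReal.toReal_one]
  have h2 : avgThroughput L m R ρ γ s κ - I =
      ∑ A, (κ A).toReal * (∫ ω, throughput ρ γ s A ω ∂sampleLaw L m R - I) := by
    simp_rw [mul_sub]
    rw [Finset.sum_sub_distrib, ← Finset.sum_mul, h1, one_mul, avgThroughput]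
  rw [h2]
  calc _ ≤ ∑ A, (κ A).toReal * ε := by
        refine (Finset.abs_sum_le_sum_abs _ _).trans (Finset.sum_le_sum fun A _ => ?_)
        rw [abs_mul, abs_of_nonneg ENNReal.toReal_nonneg]
        by_cases hA : A ∈ κ.support
        · exact mul_le_mul_of_nonneg_left (h A hA) ENNReal.toReal_nonneg
        · rw [κ.apply_eq_zero_iff A |>.2 hA]
          simp
    _ = ε := by rw [← Finset.sum_mul, h1, one_mul]

/-- Every user is served eventually, so the limiting rates inherit the sign of the rates. -/
lemma rate_nonneg_of_tendsto {L m : ℕ → ℕ} {R : ℕ → ℕ → ℕ} {rbar : ℕ → ℝ}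
    (hLm : ∀ n, L n ≤ m n) (hL : Tendsto L atTop atTop)
    (hR : ∀ ε > 0, ∀ᶠ n in atTop, ∀ i < m n, |(R n i : ℝ) / L n - rbar i| < ε) (i : ℕ) :
    0 ≤ rbar i := by
  refine le_of_forall_pos_lt_add fun ε hε => ?_
  obtain ⟨n, h1, h2⟩ := ((hR ε hε).and (hL.eventually_gt_atTop i)).exists
  have h3 := (abs_lt.1 (h1 i (h2.trans_le (hLm n)))).2
  have h4 : (0 : ℝ) ≤ (R n i : ℝ) / L n := by positivity
  linarith

lemma sum_filter_le {m : ℕ} (A : Finset (Fin m)) {η : ℕ → ℝ} (hη : ∀ i, 0 ≤ η i) (K : ℝ) :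
    ∑ i ∈ A, (if K < η i then Real.logb 2 (1 + η i) else 0) ≤
      ∑ i ∈ Finset.range m with K < η i, Real.logb 2 (1 + η i) := by
  rw [Finset.sum_filter, Finset.sum_range]
  refine Finset.sum_le_univ_sum_of_nonneg fun i => ?_
  split_ifs
  · exact logb_one_add_nonneg (hη i)
  · exact le_rfl

/-- The level in the uniform integrability condition may be taken to be at least `1`. -/
lemma exists_one_le_tail {η : ℕ → ℝ} (hη : ∀ i, 0 ≤ η i) {m : ℕ → ℕ}
    (hUI : ∀ ε > 0, ∃ K : ℝ, ∀ᶠ n in atTop, 1 / (m n : ℝ) *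
      ∑ i ∈ Finset.range (m n) with K < η i, Real.logb 2 (1 + η i) ≤ ε) {ε : ℝ} (hε : 0 < ε) :
    ∃ K : ℝ, 1 ≤ K ∧ ∀ᶠ n in atTop, 1 / (m n : ℝ) *
      ∑ i ∈ Finset.range (m n) with K < η i, Real.logb 2 (1 + η i) ≤ ε := by
  obtain ⟨K, hK⟩ := hUI ε hε
  refine ⟨max K 1, le_max_right _ _, ?_⟩
  filter_upwards [hK] with n hn
  refine le_trans (mul_le_mul_of_nonneg_left ?_ (by positivity)) hn
  refine Finset.sum_le_sum_of_subset_of_nonneg (fun i hi => ?_)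
    fun i _ _ => logb_one_add_nonneg (hη i)
  rw [Finset.mem_filter] at hi ⊢
  exact ⟨hi.1, (le_max_left _ _).trans_lt hi.2⟩

section Efficiency

variable {ρ : ℝ} {γ rbar η : ℕ → ℝ} {L m s : ℕ → ℕ} {R : ℕ → ℕ → ℕ} {mbar sbar : ℝ}

lemma eta_nonneg (hρ : 0 < ρ) (hγ : ∀ i, 0 ≤ γ i) (hη : ∀ i, η i = eta ρ (γ i) (rbar i))
    (hr : ∀ i, 0 ≤ rbar i) (i : ℕ) : 0 ≤ η i := by
  have hG : 0 ≤ ρ * γ i := mul_nonneg hρ.le (hγ i)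
  have h1 : (2 : ℝ) ^ (-rbar i) ≤ 1 :=
    Real.rpow_le_one_of_one_le_of_nonpos one_le_two (by linarith [hr i])
  rw [hη i, eta]
  exact div_nonneg (mul_nonneg hG (by linarith)) (by positivity)

lemma one_add_eq (hρ : 0 < ρ) (hγ : ∀ i, 0 ≤ γ i) (hη : ∀ i, η i = eta ρ (γ i) (rbar i))
    (i : ℕ) : (1 + ρ * γ i) / (1 + ρ * γ i * (2 : ℝ) ^ (-rbar i)) = 1 + η i := by
  rw [hη i, eta]
  exact (one_add_eta (mul_nonneg hρ.le (hγ i)) (Real.rpow_nonneg zero_le_two _)).symm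

lemma eventually_rate_le (hL : Tendsto L atTop atTop)
    (hR : ∀ ε > 0, ∀ᶠ n in atTop, ∀ i < m n, |(R n i : ℝ) / L n - rbar i| < ε) :
    ∀ᶠ n in atTop, ∀ i < m n, (R n i : ℝ) ≤ L n * (rbar i + 1) := by
  filter_upwards [hR 1 one_pos, hL.eventually_gt_atTop 0] with n h1 h2 i hi
  have hL0 : (0 : ℝ) < L n := by exact_mod_cast h2
  have h3 : (R n i : ℝ) / L n ≤ rbar i + 1 := by linarith [(abs_lt.1 (h1 i hi)).2]
  rw [div_le_iff₀ hL0] at h3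
  linarith

/-- A bound for the average over the on-users of quantities that are at most `c` on the users with
`η ≤ K`, and grow at most logarithmically in `η` on the others. -/
lemma average_onSet_le {m : ℕ} {L : ℕ} (hL : 0 < L) (hm : 0 < m) {A : Finset (Fin m)}
    (hη : ∀ i, 0 ≤ η i) {K c d C δ : ℝ} (hc : 0 ≤ c) (hd : 0 ≤ d) (hC : 0 ≤ C) {z : Fin m → ℝ}
    (h1 : ∀ i ∈ A, η i ≤ K → z i ≤ c)
    (h2 : ∀ i ∈ A, K < η i → z i ≤ d + C * Real.logb 2 (1 + η i))
    (hδ : 1 / (m : ℝ) * ∑ i ∈ Finset.range m with K < η i, Real.logb 2 (1 + η i) ≤ δ) :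
    1 / (L : ℝ) * ∑ i ∈ A, z i ≤ (A.card : ℝ) / L * c + (A.card : ℝ) / L * d +
      (m : ℝ) / L * (C * δ) := by
  have hL0 : (0 : ℝ) < L := by exact_mod_cast hL
  have hm0 : (0 : ℝ) < m := by exact_mod_cast hm
  have h3 : ∑ i ∈ A, z i ≤ A.card * (c + d) +
      C * ∑ i ∈ Finset.range m with K < η i, Real.logb 2 (1 + η i) := by
    calc ∑ i ∈ A, z i ≤ ∑ i ∈ A, ((c + d) +
          C * (if K < η i then Real.logb 2 (1 + η i) else 0)) := by
          refine Finset.sum_le_sum fun i hi => ?_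
          split_ifs with h
          · linarith [h2 i hi h]
          · linarith [h1 i hi (not_lt.1 h)]
      _ = A.card * (c + d) + C * ∑ i ∈ A, (if K < η i then Real.logb 2 (1 + η i) else 0) := by
          rw [Finset.sum_add_distrib, Finset.sum_const, nsmul_eq_mul, Finset.mul_sum]
      _ ≤ _ := (add_le_add_iff_left _).2
          (mul_le_mul_of_nonneg_left (sum_filter_le A hη K) hC)
  rw [one_div, inv_mul_le_iff₀ hm0] at hδ
  rw [one_div, inv_mul_le_iff₀ hL0]
  have h4 := mul_le_mul_of_nonneg_left hδ hC
  refine (h3.trans (add_le_add le_rfl h4)).trans (le_of_eq ?_)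
  field_simp

/-- In the interior regime the mean rates may be replaced by their limits. -/
lemma eventually_abs_sum_meanRate_sub_le (hρ : 0 < ρ) (hγ : ∀ i, 0 ≤ γ i)
    (hη : ∀ i, η i = eta ρ (γ i) (rbar i)) (hLm : ∀ n, L n ≤ m n) (hL : Tendsto L atTop atTop)
    (hs : Tendsto s atTop atTop)
    (hmbar : Tendsto (fun n => (m n : ℝ) / L n) atTop (𝓝 mbar))
    (hsbar : Tendsto (fun n => (s n : ℝ) / L n) atTop (𝓝 sbar))
    (hR : ∀ ε > 0, ∀ᶠ n in atTop, ∀ i < m n, |(R n i : ℝ) / L n - rbar i| < ε)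
    (hUI : ∀ ε > 0, ∃ K : ℝ, ∀ᶠ n in atTop, 1 / (m n : ℝ) *
      ∑ i ∈ Finset.range (m n) with K < η i, Real.logb 2 (1 + η i) ≤ ε)
    (hσ : 0 < sbar) (hσ1 : sbar < 1) {ε : ℝ} (hε : 0 < ε) :
    ∀ᶠ n in atTop, ∀ A : Finset (Fin (m n)), A.card = s n →
      |1 / (L n : ℝ) * ∑ i ∈ A, meanRate (L n) (m n) (R n) (ρ * γ i) A i -
        1 / (L n : ℝ) * ∑ i ∈ A, limitRate sbar (η i)| ≤ ε := by
  have hr := rate_nonneg_of_tendsto hLm hL hR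
  have hη0 := eta_nonneg hρ hγ hη hr
  have hone := one_add_eq hρ hγ hη
  have hmb : 0 ≤ mbar := ge_of_tendsto' hmbar fun n => by positivity
  have hc : 0 ≤ (1 - sbar) / sbar := div_nonneg (by linarith) hσ.le
  -- collects the additive constants of the bounds for a mean rate and for its limit, which may be
  -- multiplied by `log₂ (1 + η) ≥ 1` on the users with `η > K ≥ 1`
  set C : ℝ := 37 + Real.logb 2 (2 / sbar) + Real.logb 2 (1 + (1 - sbar) / sbar) with hC
  have hl1 : 0 ≤ Real.logb 2 (2 / sbar) := Real.logb_nonneg one_lt_two (by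
    rw [le_div_iff₀ hσ]
    linarith)
  have hl2 := logb_one_add_nonneg hc
  have hCpos : 0 < C := by linarith
  obtain ⟨K, hK1, hK⟩ := exists_one_le_tail hη0 hUI
    (show 0 < ε / (2 * (C * (mbar + 1))) by positivity)
  obtain ⟨ε', hε', L₀, hmain⟩ := exists_lintegral_rate_sub_le hσ hσ1 (by linarith : 0 ≤ K)
    (half_pos hε)
  filter_upwards [hK, hL.eventually_ge_atTop (max L₀ 1), hs.eventually_ge_atTop 2,
    hsbar.eventually (Metric.ball_mem_nhds _ hε'), hsbar.eventually (lt_mem_nhds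
      (show sbar / 2 < sbar by linarith)), hsbar.eventually (gt_mem_nhds hσ1),
    hmbar.eventually (gt_mem_nhds (show mbar < mbar + 1 by linarith)), hR ε' hε',
    eventually_rate_le hL hR] with n h1 h2 h3 h4 h5 h6 h7 h8 h9 A hA
  have hLn : 0 < L n := (le_max_right _ _).trans h2
  have hL0 : (0 : ℝ) < L n := by exact_mod_cast hLn
  have hmn : 0 < m n := hLn.trans_le (hLm n)
  have hs0 : (0 : ℝ) < s n := by exact_mod_cast (by omega : 0 < s n)
  have hsL : s n ≤ L n := by
    rw [div_lt_one hL0] at h6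
    exact_mod_cast h6.le
  have hbound : 1 / (L n : ℝ) * ∑ i ∈ A,
      |meanRate (L n) (m n) (R n) (ρ * γ i) A i - limitRate sbar (η i)| ≤
      (A.card : ℝ) / L n * (ε / 2) + (A.card : ℝ) / L n * 0 +
        (m n : ℝ) / L n * (C * (ε / (2 * (C * (mbar + 1))))) := by
    refine average_onSet_le hLn hmn hη0 (half_pos hε).le le_rfl hCpos.le ?_ ?_ h1
    · intro i hi hiK
      have hG : 0 ≤ ρ * γ i := mul_nonneg hρ.le (hγ i)
      refine abs_meanRate_sub_le hG (half_pos hε).le ?_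
      have h10 := hmain (L n) ((le_max_left _ _).trans h2) (m n) (R n) A i hi (ρ * γ i) (rbar i) hG
        (hr i) (by rw [hA]; exact h4) (h8 i i.2) (by rw [hone i]; linarith)
      rw [hη i]
      exact h10
    · intro i hi hiK
      have hG : 0 ≤ ρ * γ i := mul_nonneg hρ.le (hγ i)
      have h10 := meanRate_le_logb (by omega : A.card ≤ L n) (by omega) hi hG (hr i) (h9 i i.2)
      rw [hone i, hA] at h10
      have h11 : 0 ≤ meanRate (L n) (m n) (R n) (ρ * γ i) A i := meanRate_nonneg hG
      have h12 : Real.logb 2 ((L n : ℝ) / s n) ≤ Real.logb 2 (2 / sbar) := by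
        refine Real.logb_le_logb_of_le one_lt_two (by positivity) ?_
        rw [div_le_div_iff₀ hs0 hσ]
        rw [lt_div_iff₀ hL0] at h5
        linarith
      have h13 : 1 ≤ Real.logb 2 (1 + η i) := by
        rw [Real.le_logb_iff_rpow_le one_lt_two (by linarith), Real.rpow_one]
        linarith
      have h14 : 0 ≤ limitRate sbar (η i) := logb_one_add_nonneg (mul_nonneg (hη0 i) hc)
      have h15 : limitRate sbar (η i) ≤
          Real.logb 2 (1 + (1 - sbar) / sbar) + Real.logb 2 (1 + η i) := by
        have hηi := hη0 i
        rw [← Real.logb_mul (by positivity) (by positivity), limitRate]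
        refine Real.logb_le_logb_of_le one_lt_two (by positivity) ?_
        linarith [show (1 + (1 - sbar) / sbar) * (1 + η i) =
          1 + η i * ((1 - sbar) / sbar) + ((1 - sbar) / sbar + η i) by ring]
      have h16 := mul_le_mul_of_nonneg_left h13 hl1
      have h17 := mul_le_mul_of_nonneg_left h13 hl2
      have h18 : |meanRate (L n) (m n) (R n) (ρ * γ i) A i - limitRate sbar (η i)| ≤
          meanRate (L n) (m n) (R n) (ρ * γ i) A i + limitRate sbar (η i) := by
        rw [abs_le]
        constructor <;> linarith
      have h19 : C * Real.logb 2 (1 + η i) = 37 * Real.logb 2 (1 + η i) +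
          Real.logb 2 (2 / sbar) * Real.logb 2 (1 + η i) +
            Real.logb 2 (1 + (1 - sbar) / sbar) * Real.logb 2 (1 + η i) := by
        rw [hC]
        ring
      linarith
  rw [← mul_sub, ← Finset.sum_sub_distrib, abs_mul, abs_of_nonneg (by positivity :
    (0 : ℝ) ≤ 1 / L n)]
  refine (mul_le_mul_of_nonneg_left (Finset.abs_sum_le_sum_abs _ _) (by positivity)).trans
    (hbound.trans ?_)
  rw [hA]
  have e1 : (s n : ℝ) / L n * (ε / 2) ≤ 1 * (ε / 2) :=
    mul_le_mul_of_nonneg_right h6.le (half_pos hε).le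
  have e2 : (m n : ℝ) / L n * (C * (ε / (2 * (C * (mbar + 1))))) ≤
      (mbar + 1) * (C * (ε / (2 * (C * (mbar + 1))))) :=
    mul_le_mul_of_nonneg_right h7.le (by positivity)
  have e3 : (mbar + 1) * (C * (ε / (2 * (C * (mbar + 1))))) = ε / 2 := by
    field_simp
  linarith

/-- The function `x log₂ (1 / x)` is continuous and vanishes at `0` and at `1`. -/
lemma tendsto_load_mul_logb
    (hsbar : Tendsto (fun n => (s n : ℝ) / L n) atTop (𝓝 sbar)) (h01 : sbar = 0 ∨ sbar = 1) :
    Tendsto (fun n => (s n : ℝ) / L n * Real.logb 2 ((L n : ℝ) / s n)) atTop (𝓝 0) := by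
  have h1 := ((Real.continuous_negMulLog.tendsto sbar).comp hsbar).div_const (Real.log 2)
  have h2 : Real.negMulLog sbar = 0 := by
    rcases h01 with rfl | rfl
    · exact Real.negMulLog_zero
    · exact Real.negMulLog_one
  rw [h2, zero_div] at h1
  refine h1.congr fun n => ?_
  rw [Function.comp_apply, Real.negMulLog, Real.logb, ← inv_div (s n : ℝ) (L n : ℝ), Real.log_inv]
  ring

/-- In the boundary regimes the throughput per antenna vanishes. With `s ≪ L` users there are too
few of them, with `s ≈ L` the interference-free space is too small, and with `s > L` the beams
vanish. -/
lemma eventually_sum_meanRate_le (hρ : 0 < ρ) (hγ : ∀ i, 0 ≤ γ i)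
    (hη : ∀ i, η i = eta ρ (γ i) (rbar i)) (hLm : ∀ n, L n ≤ m n) (hL : Tendsto L atTop atTop)
    (hs : Tendsto s atTop atTop)
    (hmbar : Tendsto (fun n => (m n : ℝ) / L n) atTop (𝓝 mbar))
    (hsbar : Tendsto (fun n => (s n : ℝ) / L n) atTop (𝓝 sbar))
    (hR : ∀ ε > 0, ∀ᶠ n in atTop, ∀ i < m n, |(R n i : ℝ) / L n - rbar i| < ε)
    (hUI : ∀ ε > 0, ∃ K : ℝ, ∀ᶠ n in atTop, 1 / (m n : ℝ) *
      ∑ i ∈ Finset.range (m n) with K < η i, Real.logb 2 (1 + η i) ≤ ε)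
    (h01 : sbar ∉ Set.Ioo (0 : ℝ) 1) {ε : ℝ} (hε : 0 < ε) :
    ∀ᶠ n in atTop, ∀ A : Finset (Fin (m n)), A.card = s n →
      1 / (L n : ℝ) * ∑ i ∈ A, meanRate (L n) (m n) (R n) (ρ * γ i) A i ≤ ε := by
  have hr := rate_nonneg_of_tendsto hLm hL hR
  have hη0 := eta_nonneg hρ hγ hη hr
  have hone := one_add_eq hρ hγ hη
  have hmb : 0 ≤ mbar := ge_of_tendsto' hmbar fun n => by positivity
  have hsb : 0 ≤ sbar := ge_of_tendsto' hsbar fun n => by positivity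
  have hzero : ∀ n, 0 < L n → L n < s n → ∀ A : Finset (Fin (m n)), A.card = s n →
      1 / (L n : ℝ) * ∑ i ∈ A, meanRate (L n) (m n) (R n) (ρ * γ i) A i ≤ ε := by
    intro n hLn hsn A hA
    rw [Finset.sum_eq_zero fun i hi => meanRate_eq_zero hLn (by omega) hi, mul_zero]
    exact hε.le
  rcases lt_or_ge 1 sbar with h1s | h1s
  · filter_upwards [hsbar.eventually (lt_mem_nhds h1s), hL.eventually_gt_atTop 0] with n h1 h2
    have hL0 : (0 : ℝ) < L n := by exact_mod_cast h2
    rw [one_lt_div hL0] at h1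
    exact hzero n h2 (by exact_mod_cast h1)
  have h01' : sbar = 0 ∨ sbar = 1 := by
    rcases hsb.eq_or_lt with h | h
    · exact Or.inl h.symm
    · exact Or.inr (le_antisymm h1s (not_lt.1 fun h' => h01 ⟨h, h'⟩))
  have hlog := tendsto_load_mul_logb hsbar h01'
  obtain ⟨K, hK1, hK⟩ := exists_one_le_tail hη0 hUI
    (show 0 < ε / (4 * (36 * (mbar + 1))) by positivity)
  -- a bound for the rates of the users with moderate `η`, negligible when multiplied by `s / L`
  obtain ⟨M, hM0, hMlim, hM⟩ : ∃ M : ℕ → ℝ, (∀ᶠ n in atTop, s n ≤ L n → 0 ≤ M n) ∧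
      Tendsto (fun n => (s n : ℝ) / L n * M n) atTop (𝓝 0) ∧
      ∀ᶠ n in atTop, ∀ A : Finset (Fin (m n)), A.card = s n → s n ≤ L n → ∀ i ∈ A, η i ≤ K →
        meanRate (L n) (m n) (R n) (ρ * γ i) A i ≤ M n := by
    rcases h01' with h0 | h1
    · refine ⟨fun n => 32 + Real.logb 2 ((L n : ℝ) / s n) + 4 * Real.logb 2 (1 + K), ?_, ?_, ?_⟩
      · filter_upwards [hs.eventually_ge_atTop 1] with n hn hsL
        have hs0 : (0 : ℝ) < s n := by exact_mod_cast hn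
        have h1 : 0 ≤ Real.logb 2 ((L n : ℝ) / s n) := Real.logb_nonneg one_lt_two (by
          rw [one_le_div hs0]
          exact_mod_cast hsL)
        have h2 := logb_one_add_nonneg (by linarith : 0 ≤ K)
        positivity
      · have h2 := (hsbar.mul_const (32 + 4 * Real.logb 2 (1 + K))).add hlog
        rw [h0, zero_mul, add_zero] at h2
        refine h2.congr fun n => ?_
        ring
      · filter_upwards [eventually_rate_le hL hR, hs.eventually_ge_atTop 2] with n h1 h2 A hA hsL i
          hi hiK
        have h10 := meanRate_le_logb (by omega : A.card ≤ L n) (by omega) hi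
          (mul_nonneg hρ.le (hγ i)) (hr i) (h1 i i.2)
        rw [hone i, hA] at h10
        have h11 := logb_one_add_mono (hη0 i) hiK
        linarith
    · refine ⟨fun n => 320 * (((L n : ℝ) - s n + 1) / s n) ^ (1 / 4 : ℝ) * (1 + K), ?_, ?_, ?_⟩
      · refine Eventually.of_forall fun n hsL => ?_
        have h2 : (0 : ℝ) ≤ ((L n : ℝ) - s n + 1) / s n := by
          have : (s n : ℝ) ≤ L n := by exact_mod_cast hsL
          exact div_nonneg (by linarith) (Nat.cast_nonneg _)
        positivity
      · have h2 : Tendsto (fun n => ((L n : ℝ) - s n + 1) / s n) atTop (𝓝 0) := by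
          have h3 : Tendsto (fun n => ((s n : ℝ) / L n)⁻¹ - 1 + ((s n : ℝ))⁻¹) atTop
              (𝓝 (1⁻¹ - 1 + 0)) := by
            refine (((h1 ▸ hsbar).inv₀ one_ne_zero).sub_const 1).add ?_
            exact (tendsto_natCast_atTop_atTop.comp hs).inv_tendsto_atTop
          rw [inv_one, sub_self, add_zero] at h3
          refine h3.congr' ?_
          filter_upwards [hs.eventually_ge_atTop 1] with n hn
          have hs0 : (s n : ℝ) ≠ 0 := by exact_mod_cast (by omega : s n ≠ 0)
          rw [inv_div]
          field_simp
        have h3 := h2.rpow_const (p := (1 / 4 : ℝ)) (Or.inr (by norm_num))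
        rw [Real.zero_rpow (by norm_num)] at h3
        have h4 := hsbar.mul ((h3.const_mul 320).mul_const (1 + K))
        rwa [mul_zero, zero_mul, mul_zero] at h4
      · filter_upwards [eventually_rate_le hL hR, hs.eventually_ge_atTop 2] with n h1 h2 A hA hsL i
          hi hiK
        have h10 := meanRate_le_rpow (by omega : A.card ≤ L n) (by omega) hi
          (mul_nonneg hρ.le (hγ i)) (hr i) (h1 i i.2)
        rw [hone i, hA] at h10
        refine h10.trans ?_
        have h11 : (0 : ℝ) ≤ ((L n : ℝ) - s n + 1) / s n := by
          have : (s n : ℝ) ≤ L n := by exact_mod_cast hsL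
          exact div_nonneg (by linarith) (Nat.cast_nonneg _)
        exact mul_le_mul_of_nonneg_left (by linarith) (by positivity)
  filter_upwards [hK, hM0, hMlim.eventually (gt_mem_nhds (show 0 < ε / 4 by positivity)), hM,
    hlog.eventually (gt_mem_nhds (show 0 < ε / 4 by positivity)), hL.eventually_gt_atTop 0,
    hs.eventually_ge_atTop 2, eventually_rate_le hL hR,
    hmbar.eventually (gt_mem_nhds (show mbar < mbar + 1 by linarith))]
    with n h1 h2 h3 h4 h5 h6 h7 h8 h9 A hA
  rcases lt_or_ge (L n) (s n) with hsn | hsn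
  · exact hzero n h6 hsn A hA
  have hs0 : (0 : ℝ) < s n := by exact_mod_cast (by omega : 0 < s n)
  have hl0 : 0 ≤ Real.logb 2 ((L n : ℝ) / s n) := Real.logb_nonneg one_lt_two (by
    rw [one_le_div hs0]
    exact_mod_cast hsn)
  have hbound := average_onSet_le h6 (h6.trans_le (hLm n)) hη0 (h2 hsn) hl0
    (by norm_num : (0 : ℝ) ≤ 36)
    (z := fun i => meanRate (L n) (m n) (R n) (ρ * γ i) A i) (A := A)
    (h4 A hA hsn) (fun i hi hiK => by
      have h10 := meanRate_le_logb (by omega : A.card ≤ L n) (by omega) hi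
        (mul_nonneg hρ.le (hγ i)) (hr i) (h8 i i.2)
      rw [hone i, hA] at h10
      have h13 : 1 ≤ Real.logb 2 (1 + η i) := by
        rw [Real.le_logb_iff_rpow_le one_lt_two (by linarith), Real.rpow_one]
        linarith
      linarith) h1
  refine hbound.trans ?_
  rw [hA]
  have e2 : (m n : ℝ) / L n * (36 * (ε / (4 * (36 * (mbar + 1))))) ≤
      (mbar + 1) * (36 * (ε / (4 * (36 * (mbar + 1))))) :=
    mul_le_mul_of_nonneg_right h9.le (by positivity)
  have e3 : (mbar + 1) * (36 * (ε / (4 * (36 * (mbar + 1))))) = ε / 4 := by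
    field_simp
  linarith

end Efficiency

end ZFBroadcast

end

theorem mainTheorem1
    (ρ : ℝ) (hρ : 0 < ρ)
    (γ rbar : ℕ → ℝ) (hγ : ∀ i, 0 ≤ γ i)
    (η : ℕ → ℝ) (hη : ∀ i, η i = ZFBroadcast.eta ρ (γ i) (rbar i))
    (L m s : ℕ → ℕ) (R : ℕ → ℕ → ℕ) (mbar sbar : ℝ)
    (hLm : ∀ n, L n ≤ m n)
    (hL : Tendsto L atTop atTop) (hs : Tendsto s atTop atTop)
    (hmbar : Tendsto (fun n => (m n : ℝ) / L n) atTop (𝓝 mbar))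
    (hsbar : Tendsto (fun n => (s n : ℝ) / L n) atTop (𝓝 sbar))
    (hR : ∀ ε > 0, ∀ᶠ n in atTop, ∀ i < m n, |(R n i : ℝ) / L n - rbar i| < ε)
    (μ : ProbabilityMeasure ℝ)
    (hμ : Tendsto (fun n => ZFBroadcast.empiricalLaw η (m n)) atTop (𝓝 μ.toFiniteMeasure))
    (hUI : ∀ ε > 0, ∃ K : ℝ, ∀ᶠ n in atTop,
      1 / (m n : ℝ) * ∑ i ∈ Finset.range (m n) with K < η i, Real.logb 2 (1 + η i) ≤ ε)
    (κ : (n : ℕ) → PMF (Finset (Fin (m n))))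
    (hκ : ∀ n, ∀ A ∈ (κ n).support, ZFBroadcast.IsOnSet η (s n) A) :
    (∀ n, ∀ A : Finset (Fin (m n)),
      Integrable (fun ω => ZFBroadcast.throughput ρ γ (s n) A ω)
        (ZFBroadcast.sampleLaw (L n) (m n) (R n))) ∧
    (sbar ∉ Set.Ioo (0 : ℝ) 1 →
      Tendsto (fun n => ZFBroadcast.avgThroughput (L n) (m n) (R n) ρ γ (s n) (κ n))
        atTop (𝓝 0)) ∧
    (sbar ∈ Set.Ioo (0 : ℝ) 1 →
      IsLUB (ZFBroadcast.levelSet μ mbar sbar) (ZFBroadcast.etaThreshold μ mbar sbar) ∧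
      IntegrableOn (ZFBroadcast.limitRate sbar)
        (Set.Ioi (ZFBroadcast.etaThreshold μ mbar sbar)) (μ : Measure ℝ) ∧
      Tendsto (fun n => ZFBroadcast.avgThroughput (L n) (m n) (R n) ρ γ (s n) (κ n))
        atTop (𝓝
          (mbar * ZFBroadcast.integralAbove μ (ZFBroadcast.etaThreshold μ mbar sbar)
              (ZFBroadcast.limitRate sbar)
            + (sbar - mbar * ZFBroadcast.integralAbove μ
                  (ZFBroadcast.etaThreshold μ mbar sbar) (fun _ => 1))
              * ZFBroadcast.limitRate sbar (ZFBroadcast.etaThreshold μ mbar sbar)))) := by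
  have hr := ZFBroadcast.rate_nonneg_of_tendsto hLm hL hR
  have hη0 := ZFBroadcast.eta_nonneg hρ hγ hη hr
  have hint : ∀ n, ∀ A : Finset (Fin (m n)), A.card = s n →
      ∫ ω, ZFBroadcast.throughput ρ γ (s n) A ω ∂ZFBroadcast.sampleLaw (L n) (m n) (R n) =
        1 / (L n : ℝ) * ∑ i ∈ A, ZFBroadcast.meanRate (L n) (m n) (R n) (ρ * γ i) A i := by
    intro n A hA
    rw [← hA]
    exact ZFBroadcast.integral_throughput hρ.le hγ A
  refine ⟨fun n A => ZFBroadcast.integrable_throughput hρ.le hγ (s n) A, fun hsb => ?_,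
    fun hsb => ?_⟩
  · refine Metric.tendsto_nhds.2 fun ε hε => ?_
    filter_upwards [ZFBroadcast.eventually_sum_meanRate_le hρ hγ hη hLm hL hs hmbar hsbar hR hUI hsb
      (half_pos hε)] with n hn
    rw [Real.dist_eq]
    refine (ZFBroadcast.abs_avgThroughput_sub_le fun A hA => ?_).trans_lt (half_lt_self hε)
    have hcard := (hκ n A hA).1
    rw [hint n A hcard, sub_zero, abs_of_nonneg]
    · exact hn A hcard
    · exact mul_nonneg (by positivity) (Finset.sum_nonneg fun i _ =>
        ZFBroadcast.meanRate_nonneg (mul_nonneg hρ.le (hγ i)))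
  · obtain ⟨hσ, hσ1⟩ := hsb
    have hmb : 1 ≤ mbar := by
      refine ge_of_tendsto hmbar ?_
      filter_upwards [hL.eventually_gt_atTop 0] with n hn
      rw [one_le_div (by exact_mod_cast hn)]
      exact_mod_cast hLm n
    have h0 := ZFBroadcast.ae_nonneg_of_tendsto hη0 hμ
    have hlub := ZFBroadcast.isLUB_levelSet h0 hmb hσ hσ1
    have hx₀ : 0 ≤ ZFBroadcast.etaThreshold μ mbar sbar :=
      hlub.1 (ZFBroadcast.zero_mem_levelSet h0 hmb hσ1)
    refine ⟨hlub, ZFBroadcast.integrableOn_limitRate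
      (ZFBroadcast.integrable_logPos hη0 hμ hUI) hσ hσ1.le hx₀, ?_⟩
    refine Metric.tendsto_nhds.2 fun ε hε => ?_
    filter_upwards [ZFBroadcast.eventually_abs_sum_meanRate_sub_le hρ hγ hη hLm hL hs hmbar hsbar hR
      hUI hσ hσ1 (show 0 < ε / 4 by positivity),
      ZFBroadcast.eventually_abs_sum_sub_le hη0 hLm hL hmbar hsbar hμ hUI hσ hσ1
        (by linarith) hx₀ hlub (show 0 < ε / 4 by positivity)] with n h1 h2
    rw [Real.dist_eq]
    refine (ZFBroadcast.abs_avgThroughput_sub_le (ε := ε / 2) fun A hA => ?_).trans_lt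
      (half_lt_self hε)
    have hon := hκ n A hA
    rw [hint n A hon.1]
    have h3 := abs_le.1 (h1 A hon.1)
    have h4 := abs_le.1 (h2 A hon)
    rw [abs_le]
    constructor <;> linarith [h3.1, h3.2, h4.1, h4.2]
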